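/- Let $N\ge 1$, $p>1$, $\beta=\frac1{p-1}$, $\alpha>\max\{\beta(\beta+1)/2,\,1+2\beta,\,2\}$, let $B_x$ be the unit ball of $\mathbb R^N$ centred at $x$, $B=B_0$, and let $W^{k,q}_{loc,u}$ be the space of functions $f$ with weak derivatives up to order $k$ such that $\|f\|_{W^{k,q}_{loc,u}}:=\sup_{x\in\mathbb R^N}\|f\|_{W^{k,q}(B_x)}<\infty$; write $H^k_{loc,u}=W^{k,2}_{loc,u}$ and $L^\infty_{loc,u}=W^{0,\infty}_{loc,u}$. Let $u$ be a solution on $[0,T)\times\mathbb R^N$ (possibly blowing up at time $T>0$) of $$u_{tt}-\Delta u=u_t|u_t|^{p-1},\qquad (u,u_t)(0)=(u_0,u_1),$$ where $(u,u_t)$ is bounded in $H^2_{loc,u}\times H^1_{loc,u}$ on $[0,\tau]$ for every $\tau<T$ and continuous on $[0,T)$ with values in $H^2(B_x)\times H^1(B_x)$ for every $x$. Assume that one of the following holds, and that the norm of $(u_0,u_1)$ in the space $Y_{loc,u}$ named there is at most $M$: (i) $Y_{loc,u}=H^2_{loc,u}\times H^1_{loc,u}$, $p\in\mathbb N$, and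 $p<\frac N{N-2}$ if $N\ge3$; (ii) $Y_{loc,u}=(W^{2,\infty}_{loc,u}\cap H^2_{loc,u})\times(L^\infty_{loc,u}\cap H^1_{loc,u})$, $N\le 3$, and $u_t$ is bounded in $L^\infty_{loc,u}$ on $[0,\tau]$ for every $\tau<T$. Put $s_0=-\log T$ and, for $a,z\in\mathbb R^N$, $s\ge s_0$, $$\theta_a(s,z)=e^{-\beta s}u_t(T-e^{-s},a+z),\qquad \theta_{a,00}(z)=T^{\beta+1}u_0(a+z),$$ $\rho(z)=1-|z|^2$, $g(s)=e^{(\beta+1)s}$, $g_2(s)=e^{(\beta-1)s}$, $h_2(s)=e^{-(\beta-1)s}$, $h_2\star\theta_a(s,z)=\int_{s_0}^s h_2(s-s')\theta_a(s',z)\,ds'$. Writing $\theta$, $\theta_{00}$ for $\theta_a$, $\theta_{a,00}$, define the energy $$\begin{aligned}E[\theta_a](s)=\;&\tfrac\beta2\int_B g(s)\rho^\alpha\theta(s)^2dz-\tfrac1{p+1}\int_B g(s)\rho^\alpha|\theta(s)|^{p+1}dz\\ &-\tfrac18\int_{s_0}^s\!\int_B\rho^\alpha g_2(\tau)\left[|4\nabla\theta(\tau)-\nabla\theta(s)|^2-|\nabla\theta(s)|^2\right]dz\,d\tau\\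 &-\alpha\int_{s_0}^s\!\int_B g_2(\tau)[N\rho-2(\alpha-1)|z|^2]\rho^{\alpha-2}\left[|\theta(s)-\theta(\tau)|^2-|\theta(s)|^2\right]dz\,d\tau\\ &-\alpha\int_{s_0}^s\!\int_B g(\tau)\rho^{\alpha-1}\left[|e^{-2\tau}z\cdot\nabla\theta(s)-\theta(\tau)|^2-|e^{-2\tau}z\cdot\nabla\theta(s)|^2\right]dz\,d\tau\\ &+\tfrac12g(s_0)\int_B\rho^\alpha\left[|\nabla\theta(s)+\nabla\theta_{00}|^2-|\nabla\theta(s)|^2\right]dz\\ &+\alpha g(s_0)\int_B\rho^{\alpha-1}\left[|\theta(s)-z\cdot\nabla\theta_{00}|^2-|\theta(s)|^2\right]dz.\end{aligned}$$ Assume that $E[\theta_a](s)\ge E_0$ for some $E_0\in\mathbb R$, all $s\ge s_0$ and all $a\in\mathbb R^N$. Let $1\le r<\infty$, with $r\le\frac{2N}{N-2}$ if $N\ge3$. Then there is a constant $C$, depending only on $N,p,\alpha,r,E_0,M$ and on positive lower and upper bounds for $T$, such that for all $s\ge s_0+1$ and all $a\in\mathbb R^N$ the function $h_2\star\theta_a(s,\cdot)$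 is defined a.e. in $B$ and $$e^{-rs}\int_B|h_2\star\theta_a(s,z)|^r\,dz\le C.$$ If in addition $r\le\frac{2N}{N-1}$ (no condition if $N=1$), then also $$\int_B|\theta_a(s,z)|^r\,dz\le C.$$ -/

import Mathlib

open MeasureTheory Set Filter Topology
open scoped ENNReal NNReal ContDiff

namespace VelocityWave

/-- The space `ℝ^N` with its Euclidean norm. -/
abbrev Space (N : ℕ) : Type := EuclideanSpace ℝ (Fin N)

/-- The (closed) unit ball centred at `x`. -/
abbrev ball1 {N : ℕ} (x : Space N) : Set (Space N) := Metric.closedBall x 1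

section Sobolev

/-- `g` is the weak partial derivative `∂_i f` on `ℝ^N`: both functions are locally integrable and
`∫ f ∂_i φ = - ∫ g φ` for every `φ ∈ C_c^∞(ℝ^N)`. -/
def HasWeakPartial {N : ℕ} (i : Fin N) (f g : Space N → ℝ) : Prop :=
  LocallyIntegrable f ∧ LocallyIntegrable g ∧
    ∀ φ : Space N → ℝ, ContDiff ℝ ∞ φ → HasCompactSupport φ →
      ∫ x, f x * fderiv ℝ φ x (EuclideanSpace.single i 1) = - ∫ x, g x * φ x

open Classical in
/-- A representative of the weak derivative `∂_i f` (it is unique up to null sets), and `0` when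
there is none. -/
noncomputable def weakPartial {N : ℕ} (i : Fin N) (f : Space N → ℝ) : Space N → ℝ :=
  if h : ∃ g, HasWeakPartial i f g then h.choose else 0

/-- The weak gradient. -/
noncomputable def weakGrad {N : ℕ} (f : Space N → ℝ) (x : Space N) : Space N :=
  WithLp.toLp 2 (fun i => weakPartial i f x)

/-- The weak Laplacian `∑ ∂_i ∂_i f`. -/
noncomputable def weakLaplacian {N : ℕ} (f : Space N → ℝ) (x : Space N) : ℝ :=
  ∑ i, weakPartial i (weakPartial i f) x

/-- `f` is measurable and has weak derivatives of every order up to `k`. -/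
def WeaklyDiff {N : ℕ} : ℕ → (Space N → ℝ) → Prop
  | 0, f => AEStronglyMeasurable f volume
  | k + 1, f => AEStronglyMeasurable f volume ∧
      ∀ i, HasWeakPartial i f (weakPartial i f) ∧ WeaklyDiff k (weakPartial i f)

/-- The `W^{k,q}(s)` norm: `L^q(s)` norms of `f` and its weak derivatives up to order `k`, summed. -/
noncomputable def sobolevNorm {N : ℕ} (q : ℝ≥0∞) (s : Set (Space N)) :
    ℕ → (Space N → ℝ) → ℝ≥0∞
  | 0, f => eLpNorm f q (volume.restrict s)
  | k + 1, f => eLpNorm f q (volume.restrict s) + ∑ i, sobolevNorm q s k (weakPartial i f)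

/-- The uniformly local norm of `W^{k,q}_{loc,u}(ℝ^N)`: the supremum over all unit balls. -/
noncomputable def ulocNorm {N : ℕ} (q : ℝ≥0∞) (k : ℕ) (f : Space N → ℝ) : ℝ≥0∞ :=
  ⨆ x : Space N, sobolevNorm q (ball1 x) k f

/-- The space `W^{k,q}_{loc,u}(ℝ^N)`; for `q = 2` this is `H^k_{loc,u}(ℝ^N)`. -/
def MemUloc {N : ℕ} (q : ℝ≥0∞) (k : ℕ) (f : Space N → ℝ) : Prop :=
  WeaklyDiff k f ∧ ulocNorm q k f < ⊤

end Sobolev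

section Equation

/-- `(f, g)` lies in `Y^{2,2}_{loc,u} = H²_{loc,u} × H¹_{loc,u}` with norm at most `M`. -/
def BoundedY22 {N : ℕ} (M : ℝ≥0) (f g : Space N → ℝ) : Prop :=
  MemUloc 2 2 f ∧ MemUloc 2 1 g ∧ ulocNorm 2 2 f + ulocNorm 2 1 g ≤ M

/-- `(f, g)` lies in `Y^{2,∞}_{loc,u} = (W^{2,∞}_{loc,u} ∩ H²_{loc,u}) × (L^∞_{loc,u} ∩ H¹_{loc,u})`
with norm at most `M`. -/
def BoundedY2infty {N : ℕ} (M : ℝ≥0) (f g : Space N → ℝ) : Prop :=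
  MemUloc ∞ 2 f ∧ MemUloc 2 2 f ∧ MemUloc ∞ 0 g ∧ MemUloc 2 1 g ∧
    ulocNorm ∞ 2 f + ulocNorm 2 2 f + ulocNorm ∞ 0 g + ulocNorm 2 1 g ≤ M

/-- `u`, with time derivative `v = u_t`, solves `u_tt - Δu = u_t |u_t|^{p-1}` on `[0,T) × ℝ^N` with
data `(u, u_t)(0) = (u₀, u₁)`, with values in `H²_{loc,u} × H¹_{loc,u}`. -/
structure IsSolution {N : ℕ} (p T : ℝ) (u₀ u₁ : Space N → ℝ) (u v : ℝ → Space N → ℝ) : Prop where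
  aesm : AEStronglyMeasurable (Function.uncurry v)
    ((volume : Measure (ℝ × Space N)).restrict (Ico 0 T ×ˢ univ))
  mem_u : ∀ t ∈ Ico 0 T, MemUloc 2 2 (u t)
  mem_v : ∀ t ∈ Ico 0 T, MemUloc 2 1 (v t)
  /-- the norm is bounded on `[0,τ]` for every `τ < T` -/
  bdd : ∀ τ ∈ Ico 0 T, ∃ K : ℝ≥0, ∀ t ∈ Icc 0 τ, ulocNorm 2 2 (u t) + ulocNorm 2 1 (v t) ≤ K
  /-- `u` is continuous in time with values in `H²` of every unit ball -/
  cont_u : ∀ x, ∀ t ∈ Ico 0 T,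
    Tendsto (fun τ => sobolevNorm 2 (ball1 x) 2 (u τ - u t)) (𝓝[Ico 0 T] t) (𝓝 0)
  /-- `v` is continuous in time with values in `H¹` of every unit ball -/
  cont_v : ∀ x, ∀ t ∈ Ico 0 T,
    Tendsto (fun τ => sobolevNorm 2 (ball1 x) 1 (v τ - v t)) (𝓝[Ico 0 T] t) (𝓝 0)
  init_u : u 0 =ᵐ[volume] u₀
  init_v : v 0 =ᵐ[volume] u₁
  /-- `u_t = v` in the sense of distributions in `x` -/
  deriv_u : ∀ φ : Space N → ℝ, ContDiff ℝ ∞ φ → HasCompactSupport φ → ∀ t ∈ Ico 0 T,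
    HasDerivWithinAt (fun τ => ∫ x, u τ x * φ x) (∫ x, v t x * φ x) (Ico 0 T) t
  /-- `v_t = Δu + v|v|^{p-1}` in the sense of distributions in `x` -/
  deriv_v : ∀ φ : Space N → ℝ, ContDiff ℝ ∞ φ → HasCompactSupport φ → ∀ t ∈ Ico 0 T,
    HasDerivWithinAt (fun τ => ∫ x, v τ x * φ x)
      (∫ x, (weakLaplacian (u t) x + v t x * |v t x| ^ (p - 1)) * φ x) (Ico 0 T) t

/-- `v` is bounded in `L^∞_{loc,u}(ℝ^N)` on every `[0,τ]`, `τ < T`. -/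
def LocallyBoundedInTime {N : ℕ} (T : ℝ) (v : ℝ → Space N → ℝ) : Prop :=
  ∀ τ ∈ Ico 0 T, ∃ K : ℝ≥0, ∀ t ∈ Icc 0 τ, ulocNorm ∞ 0 (v t) ≤ K

/-- The two admissible settings: either `(u₀,u₁) ∈ Y^{2,2}_{loc,u}`, `p` is an integer, and
`p < N/(N-2)` if `N ≥ 3`; or `(u₀,u₁) ∈ Y^{2,∞}_{loc,u}`, `N ≤ 3`, and `p > 1` is real. The norm of
the data is at most `M`. In the second setting the solution has `u_t` locally bounded in time with
values in `L^∞_{loc,u}`. -/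
def Admissible {N : ℕ} (p T : ℝ) (M : ℝ≥0) (u₀ u₁ : Space N → ℝ) (v : ℝ → Space N → ℝ) : Prop :=
  (BoundedY22 M u₀ u₁ ∧ (∃ m : ℕ, p = m) ∧ (3 ≤ N → p < (N : ℝ) / ((N : ℝ) - 2))) ∨
    (BoundedY2infty M u₀ u₁ ∧ N ≤ 3 ∧ LocallyBoundedInTime T v)

end Equation

section SimilarityVariables

/-- `θ_{T,a}(s,z) = (T-t)^β v(t,x)` with `x = a + z`, `s = -log (T-t)`, that is `T - t = e^{-s}`. -/
noncomputable def theta {N : ℕ} (β T : ℝ) (v : ℝ → Space N → ℝ) (a : Space N) (s : ℝ)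
    (z : Space N) : ℝ :=
  Real.exp (-(β * s)) * v (T - Real.exp (-s)) (a + z)

/-- `θ_{a,00}(z) = T^{β+1} u₀(a + z)`. -/
noncomputable def theta00 {N : ℕ} (β T : ℝ) (u₀ : Space N → ℝ) (a z : Space N) : ℝ :=
  T ^ (β + 1) * u₀ (a + z)

/-- `g(s) = e^{(β+1)s}`. -/
noncomputable def gOne (β s : ℝ) : ℝ := Real.exp ((β + 1) * s)

/-- `g₂(s) = e^{(β-1)s}`. -/
noncomputable def gTwo (β s : ℝ) : ℝ := Real.exp ((β - 1) * s)

/-- `h₂(s) = e^{-(β-1)s}`. -/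
noncomputable def hTwo (β s : ℝ) : ℝ := Real.exp (-(β - 1) * s)

/-- `(h₂ ⋆ θ)(s,z) = ∫_{s₀}^s h₂(s-s') θ(s',z) ds'`. -/
noncomputable def hTwoConv {N : ℕ} (β s₀ : ℝ) (θ : ℝ → Space N → ℝ) (s : ℝ) (z : Space N) : ℝ :=
  ∫ s' in s₀..s, hTwo β (s - s') * θ s' z

/-- `ρ(z) = 1 - |z|²`. -/
noncomputable def rho {N : ℕ} (z : Space N) : ℝ := 1 - ‖z‖ ^ 2

/-- The weighted energy `E[θ](s)`. -/
noncomputable def energy {N : ℕ} (p β α s₀ : ℝ) (θ : ℝ → Space N → ℝ) (θ₀₀ : Space N → ℝ)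
    (s : ℝ) : ℝ :=
  β / 2 * (∫ z in ball1 (0 : Space N), gOne β s * rho z ^ α * θ s z ^ 2)
  - 1 / (p + 1) * (∫ z in ball1 (0 : Space N), gOne β s * rho z ^ α * |θ s z| ^ (p + 1))
  - 1 / 8 * (∫ τ in s₀..s, ∫ z in ball1 (0 : Space N),
      rho z ^ α * gTwo β τ *
        (‖(4 : ℝ) • weakGrad (θ τ) z - weakGrad (θ s) z‖ ^ 2 - ‖weakGrad (θ s) z‖ ^ 2))
  - α * (∫ τ in s₀..s, ∫ z in ball1 (0 : Space N),
      gTwo β τ * ((N : ℝ) * rho z - 2 * (α - 1) * ‖z‖ ^ 2) * rho z ^ (α - 2) *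
        ((θ s z - θ τ z) ^ 2 - θ s z ^ 2))
  - α * (∫ τ in s₀..s, ∫ z in ball1 (0 : Space N),
      gOne β τ * rho z ^ (α - 1) *
        ((Real.exp (-2 * τ) * inner ℝ z (weakGrad (θ s) z) - θ τ z) ^ 2
          - (Real.exp (-2 * τ) * inner ℝ z (weakGrad (θ s) z)) ^ 2))
  + 1 / 2 * gOne β s₀ * (∫ z in ball1 (0 : Space N),
      rho z ^ α * (‖weakGrad (θ s) z + weakGrad θ₀₀ z‖ ^ 2 - ‖weakGrad (θ s) z‖ ^ 2))
  + α * gOne β s₀ * (∫ z in ball1 (0 : Space N),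
      rho z ^ (α - 1) * ((θ s z - inner ℝ z (weakGrad θ₀₀ z)) ^ 2 - θ s z ^ 2))

end SimilarityVariables

end VelocityWave

namespace VelocityWave

/-! ### Weak partial derivatives up to null sets. -/

section WeakDerivatives

variable {N : ℕ}

/-! The energy is built to be expressible through θ, its gradient and the initial data alone, and
the proof undoes this. In each bracket |A - b|² - |b|² (up to the sign of A), b is taken at the
final time s, so the bracket is linear in b. The linear terms are time integrals of θ or ∇θ against
g₂. Since g₂ θ ds = u_t dt, they telescope to increments of u and ∇u. Integration by parts in space
then collects them into -∫ρ^α θ Δu. Hence E equals `reducedEnergy` plus a constant controlled by ∇u₀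
(`expanded_energy_eq`, `IsSolution.energy_eq`).

In similarity time the equation is θ_s = e^{-(β+1)s} Δu - βθ + θ|θ|^{p-1}. It gives d/ds
`reducedEnergy` = -`dissipation` (`hasDerivAt_reducedEnergy`). The dissipation contains g θ_s² and
g₂ |∇θ|² with weight ρ^α, a nonnegative potential term, and a zero-order term which is positive
because ρ ≤ 1 and α > β(β+1)/2. A lower bound for E and the bound M on the data therefore control
the time integral of g(θ² + θ_s²) + g₂|∇θ|² with weight ρ^α, uniformly in s
(`exists_integral_coercive_le`).

The regularity available is low: Δu is only continuous in time with values in L². Weighted integrals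
are therefore treated as continuous bilinear forms on L²(B) evaluated along curves. A curve is
differentiable once its distributional derivative is continuous (`hasDerivAt_of_weak`), the
potential energy is differentiated by convexity (`IsSolution.hasDerivAt_potential`), and the term
with Δu by splitting the difference quotient (`hasDerivAt_wform_laplacian`).

First bound. The convolution h₂ ⋆ θ is e^{-(β-1)s} (u(t) - u(0)) with t = T - e^{-s}
(`IsSolution.ae_hTwoConv_eq`). A Cauchy-Schwarz argument in time bounds the weighted L² norms of
u(t) - u(0) and of its gradient by a constant times e^{βs} (`exists_wform_displacement_le`). The
weight is bounded below on the half ball, so the interior Sobolev embedding gives L^r there. Because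
the energy is bounded below at every centre, finitely many translates cover B, and the powers of e^s
cancel.

Second bound. The function θ(s) is the trace at a fixed time of a function on ℝ × ℝ^N. On the window
[s-1, s+1] the variable y = e^{-s}(s' - s) gives ∂_y θ and ∇θ the same size in L², namely e^{-βs/2}
up to constants. The trace inequality in dimension N+1 reaches exponent 2N/(N-1) (`exists_trace`,
`exists_trace_curve`), and a covering by translates again finishes the argument. -/

theorem HasWeakPartial.ae_unique {i : Fin N} {f g g' : Space N → ℝ} (h : HasWeakPartial i f g)
    (h' : HasWeakPartial i f g') : g =ᵐ[volume] g' := by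
  refine ae_eq_of_integral_contDiff_smul_eq h.2.1 h'.2.1 fun φ hφ hc => ?_
  have h1 := h.2.2 φ hφ hc
  have h2 := h'.2.2 φ hφ hc
  simp only [smul_eq_mul, mul_comm (φ _)]
  linarith

theorem HasWeakPartial.weakPartial_spec {i : Fin N} {f g : Space N → ℝ} (h : HasWeakPartial i f g) :
    HasWeakPartial i f (weakPartial i f) := by
  have hex : ∃ g, HasWeakPartial i f g := ⟨g, h⟩
  simp only [weakPartial, dif_pos hex]
  exact hex.choose_spec

theorem HasWeakPartial.weakPartial_ae_eq {i : Fin N} {f g : Space N → ℝ}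
    (h : HasWeakPartial i f g) : weakPartial i f =ᵐ[volume] g :=
  h.weakPartial_spec.ae_unique h

theorem LocallyIntegrable.congr_ae {f f' : Space N → ℝ} (hf : LocallyIntegrable f)
    (h : f =ᵐ[volume] f') : LocallyIntegrable f' := fun x => by
  obtain ⟨s, hs, hi⟩ := hf x
  exact ⟨s, hs, hi.congr (ae_restrict_of_ae h)⟩

theorem HasWeakPartial.congr {i : Fin N} {f f' g g' : Space N → ℝ} (h : HasWeakPartial i f g)
    (hf : f =ᵐ[volume] f') (hg : g =ᵐ[volume] g') : HasWeakPartial i f' g' := by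
  refine ⟨LocallyIntegrable.congr_ae h.1 hf, LocallyIntegrable.congr_ae h.2.1 hg,
    fun φ hφ hc => ?_⟩
  have h1 := integral_congr_ae
    (hf.mul (ae_eq_refl fun x => fderiv ℝ φ x (EuclideanSpace.single i 1)))
  have h2 := integral_congr_ae (hg.mul (ae_eq_refl φ))
  simp only [Pi.mul_apply] at h1 h2
  rw [← h1, ← h2]
  exact h.2.2 φ hφ hc

/-- The two families of candidates coincide as predicates, so the same representative is chosen. The
equality is therefore pointwise, which permits rewriting inside iterated derivatives. -/
theorem weakPartial_congr (i : Fin N) {f f' : Space N → ℝ} (hf : f =ᵐ[volume] f') :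
    weakPartial i f = weakPartial i f' := by
  have : HasWeakPartial i f = HasWeakPartial i f' := by
    funext g
    exact propext ⟨fun h => h.congr hf (ae_eq_refl _), fun h => h.congr hf.symm (ae_eq_refl _)⟩
  unfold weakPartial
  rw [this]

theorem continuous_fderiv_single {φ : Space N → ℝ} (hφ : ContDiff ℝ ∞ φ) (e : Space N) :
    Continuous fun x => fderiv ℝ φ x e :=
  (hφ.continuous_fderiv (by simp)).clm_apply continuous_const

theorem hasCompactSupport_fderiv_single {φ : Space N → ℝ} (hc : HasCompactSupport φ)
    (e : Space N) : HasCompactSupport fun x => fderiv ℝ φ x e :=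
  hc.fderiv_apply (𝕜 := ℝ) e

theorem integrable_mul_of_locallyIntegrable {f φ : Space N → ℝ} (hf : LocallyIntegrable f)
    (hφ : Continuous φ) (hc : HasCompactSupport φ) : Integrable fun x => f x * φ x := by
  simpa [mul_comm] using hf.integrable_smul_left_of_hasCompactSupport hφ hc

theorem HasWeakPartial.sub {i : Fin N} {f f' g g' : Space N → ℝ} (h : HasWeakPartial i f g)
    (h' : HasWeakPartial i f' g') : HasWeakPartial i (f - f') (g - g') := by
  refine ⟨h.1.sub h'.1, h.2.1.sub h'.2.1, fun φ hφ hc => ?_⟩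
  have e := continuous_fderiv_single hφ (EuclideanSpace.single i 1)
  have e' := hasCompactSupport_fderiv_single hc (EuclideanSpace.single i 1)
  simp only [Pi.sub_apply, sub_mul]
  rw [integral_sub (integrable_mul_of_locallyIntegrable h.1 e e')
      (integrable_mul_of_locallyIntegrable h'.1 e e'),
    integral_sub (integrable_mul_of_locallyIntegrable h.2.1 hφ.continuous hc)
      (integrable_mul_of_locallyIntegrable h'.2.1 hφ.continuous hc),
    h.2.2 φ hφ hc, h'.2.2 φ hφ hc]
  ring

theorem HasWeakPartial.const_mul {i : Fin N} {f g : Space N → ℝ} (h : HasWeakPartial i f g)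
    (c : ℝ) : HasWeakPartial i (fun x => c * f x) (fun x => c * g x) := by
  refine ⟨h.1.smul c, h.2.1.smul c, fun φ hφ hc => ?_⟩
  simp only [mul_assoc, integral_const_mul, h.2.2 φ hφ hc]
  ring

theorem weakPartial_const_mul (i : Fin N) (f : Space N → ℝ) {c : ℝ} (hc : c ≠ 0) :
    weakPartial i (fun x => c * f x) =ᵐ[volume] fun x => c * weakPartial i f x := by
  by_cases h : ∃ g, HasWeakPartial i f g
  · obtain ⟨g, hg⟩ := h
    exact (hg.weakPartial_spec.const_mul c).weakPartial_ae_eq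
  -- Dividing by c would turn a weak derivative of c f into one of f. In this case both sides are
  -- therefore the default value 0.
  · have h' : ¬ ∃ g, HasWeakPartial i (fun x => c * f x) g := by
      rintro ⟨g, hg⟩
      refine h ⟨_, (hg.const_mul c⁻¹).congr (.of_forall fun x => ?_) (ae_eq_refl _)⟩
      simp [hc]
    simp [weakPartial, h, h', Filter.EventuallyEq]

end WeakDerivatives

/-! ### Translation invariance of norms, data and solutions. -/

section Translation

variable {N : ℕ}

/-- Translation of a function. -/
def shift (a : Space N) (f : Space N → ℝ) : Space N → ℝ := fun z => f (a + z)

theorem measurePreserving_shift (a : Space N) :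
    MeasurePreserving (fun z : Space N => a + z) volume volume :=
  measurePreserving_add_left volume a

theorem shift_congr (a : Space N) {f f' : Space N → ℝ} (h : f =ᵐ[volume] f') :
    shift a f =ᵐ[volume] shift a f' :=
  (measurePreserving_shift a).quasiMeasurePreserving.ae_eq_comp h

theorem integral_shift (a : Space N) (f : Space N → ℝ) : ∫ z, shift a f z = ∫ x, f x :=
  integral_add_left_eq_self f a

theorem LocallyIntegrable.shift {f : Space N → ℝ} (hf : LocallyIntegrable f) (a : Space N) :
    LocallyIntegrable (shift a f) := by
  rw [locallyIntegrable_iff] at hf ⊢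
  intro k hk
  have := hf ((fun z => a + z) '' k) (hk.image (by fun_prop))
  have h2 := ((measurePreserving_shift a).integrableOn_image
    (Homeomorph.addLeft a).measurableEmbedding (f := f) (s := k)).1 this
  exact h2

theorem HasWeakPartial.shift {i : Fin N} {f g : Space N → ℝ} (h : HasWeakPartial i f g)
    (a : Space N) : HasWeakPartial i (shift a f) (shift a g) := by
  refine ⟨LocallyIntegrable.shift h.1 a, LocallyIntegrable.shift h.2.1 a, fun φ hφ hc => ?_⟩
  have hφ' : ContDiff ℝ ∞ (VelocityWave.shift (-a) φ) := hφ.comp (by fun_prop)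
  have hc' : HasCompactSupport (VelocityWave.shift (-a) φ) :=
    hc.comp_homeomorph (Homeomorph.addLeft (-a))
  have := h.2.2 _ hφ' hc'
  rw [← integral_shift a, ← integral_shift a (fun x => g x * _)] at this
  have hd : ∀ x, fderiv ℝ (VelocityWave.shift (-a) φ) (a + x) = fderiv ℝ φ x := by
    intro x
    have : VelocityWave.shift (-a) φ = fun z => φ (-a + z) := rfl
    rw [this, fderiv_comp_add_left]
    simp
  simpa [VelocityWave.shift, hd] using this

theorem weakPartial_shift (i : Fin N) (a : Space N) (f : Space N → ℝ) :
    weakPartial i (shift a f) =ᵐ[volume] shift a (weakPartial i f) := by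
  by_cases h : ∃ g, HasWeakPartial i f g
  · obtain ⟨g, hg⟩ := h
    exact (hg.weakPartial_spec.shift a).weakPartial_ae_eq
  · have h' : ¬ ∃ g, HasWeakPartial i (shift a f) g := by
      rintro ⟨g, hg⟩
      refine h ⟨_, (hg.shift (-a)).congr (.of_forall fun x => ?_) (ae_eq_refl _)⟩
      simp [shift]
    simp only [weakPartial, h, h', dif_neg, not_false_eq_true]
    rfl

theorem weaklyDiff_congr {k : ℕ} {f f' : Space N → ℝ} (h : f =ᵐ[volume] f')
    (hf : WeaklyDiff k f) : WeaklyDiff k f' := by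
  cases k with
  | zero => exact AEStronglyMeasurable.congr hf h
  | succ k =>
    refine ⟨hf.1.congr h, fun i => ?_⟩
    rw [← weakPartial_congr i h]
    exact ⟨(hf.2 i).1.congr h (ae_eq_refl _), (hf.2 i).2⟩

theorem WeaklyDiff.shift {k : ℕ} {f : Space N → ℝ} (hf : WeaklyDiff k f) (a : Space N) :
    WeaklyDiff k (shift a f) := by
  induction k generalizing f with
  | zero => exact AEStronglyMeasurable.comp_measurePreserving hf (measurePreserving_shift a)
  | succ k ih =>
    refine ⟨hf.1.comp_measurePreserving (measurePreserving_shift a), fun i => ⟨?_, ?_⟩⟩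
    · exact ((hf.2 i).1.shift a).weakPartial_spec
    · exact weaklyDiff_congr (weakPartial_shift i a f).symm (ih (hf.2 i).2)

theorem eLpNorm_shift (q : ℝ≥0∞) (a x : Space N) (R : ℝ) {f : Space N → ℝ} :
    eLpNorm (shift a f) q (volume.restrict (Metric.closedBall x R))
      = eLpNorm f q (volume.restrict (Metric.closedBall (a + x) R)) := by
  have hmp : MeasurePreserving (fun z : Space N => a + z)
      (volume.restrict (Metric.closedBall x R)) (volume.restrict (Metric.closedBall (a + x) R)) := by
    have := (measurePreserving_shift a).restrict_preimage
      (Metric.isClosed_closedBall (x := a + x) (ε := R)).measurableSet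
    have he : (fun z : Space N => a + z) ⁻¹' Metric.closedBall (a + x) R
        = Metric.closedBall x R := by
      ext z; simp
    rwa [he] at this
  have he : MeasurableEmbedding (fun z : Space N => a + z) :=
    (Homeomorph.addLeft a).measurableEmbedding
  rw [← hmp.map_eq, he.eLpNorm_map_measure]
  rfl

theorem sobolevNorm_congr (q : ℝ≥0∞) (s : Set (Space N)) (k : ℕ) {f f' : Space N → ℝ}
    (h : f =ᵐ[volume] f') : sobolevNorm q s k f = sobolevNorm q s k f' := by
  cases k with
  | zero => exact eLpNorm_congr_ae (ae_restrict_of_ae h)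
  | succ k =>
    simp only [sobolevNorm, weakPartial_congr _ h]
    rw [eLpNorm_congr_ae (ae_restrict_of_ae h)]

theorem sobolevNorm_shift (q : ℝ≥0∞) (a x : Space N) (R : ℝ) (k : ℕ) (f : Space N → ℝ) :
    sobolevNorm q (Metric.closedBall x R) k (shift a f)
      = sobolevNorm q (Metric.closedBall (a + x) R) k f := by
  induction k generalizing f with
  | zero => exact eLpNorm_shift q a x R
  | succ k ih =>
    simp only [sobolevNorm, eLpNorm_shift, ← ih]
    congr 1
    exact Finset.sum_congr rfl fun i _ => sobolevNorm_congr _ _ _ (weakPartial_shift i a f)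

theorem ulocNorm_shift (q : ℝ≥0∞) (a : Space N) (k : ℕ) (f : Space N → ℝ) :
    ulocNorm q k (shift a f) = ulocNorm q k f := by
  simp only [ulocNorm, ball1, sobolevNorm_shift]
  exact (Equiv.addLeft a).iSup_comp (g := fun x => sobolevNorm q (Metric.closedBall x 1) k f)

theorem MemUloc.shift {q : ℝ≥0∞} {k : ℕ} {f : Space N → ℝ} (h : MemUloc q k f) (a : Space N) :
    MemUloc q k (shift a f) :=
  ⟨h.1.shift a, by rw [ulocNorm_shift]; exact h.2⟩

theorem weakLaplacian_shift (a : Space N) (f : Space N → ℝ) :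
    weakLaplacian (shift a f) =ᵐ[volume] shift a (weakLaplacian f) := by
  have : ∀ᵐ x, ∀ i, weakPartial i (weakPartial i (shift a f)) x
      = shift a (weakPartial i (weakPartial i f)) x := by
    refine ae_all_iff.2 fun i => ?_
    rw [weakPartial_congr i (weakPartial_shift i a f)]
    exact weakPartial_shift i a _
  filter_upwards [this] with x hx
  simp only [weakLaplacian, hx]
  rfl

theorem Admissible.shift {p T : ℝ} {M : ℝ≥0} {u₀ u₁ : Space N → ℝ} {v : ℝ → Space N → ℝ}
    (h : Admissible p T M u₀ u₁ v) (a : Space N) :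
    Admissible p T M (shift a u₀) (shift a u₁) (fun t => shift a (v t)) := by
  rcases h with ⟨⟨h1, h2, h3⟩, h4⟩ | ⟨⟨h1, h2, h3, h4, h5⟩, h6, h7⟩
  · exact Or.inl ⟨⟨h1.shift a, h2.shift a, by simpa only [ulocNorm_shift] using h3⟩, h4⟩
  · refine Or.inr ⟨⟨h1.shift a, h2.shift a, h3.shift a, h4.shift a,
      by simpa only [ulocNorm_shift] using h5⟩, h6, fun τ hτ => ?_⟩
    simpa only [ulocNorm_shift] using h7 τ hτ

/-- The equation has constant coefficients and the norms are suprema over all centres. Every later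
estimate is therefore proved around the origin only and transported by this lemma. -/
theorem IsSolution.shift {p T : ℝ} {u₀ u₁ : Space N → ℝ} {u v : ℝ → Space N → ℝ}
    (h : IsSolution p T u₀ u₁ u v) (a : Space N) :
    IsSolution p T (shift a u₀) (shift a u₁) (fun t => shift a (u t)) (fun t => shift a (v t)) := by
  have test : ∀ (f φ : Space N → ℝ),
      ∫ x, VelocityWave.shift a f x * φ x = ∫ x, f x * VelocityWave.shift (-a) φ x := by
    intro f φ
    rw [← integral_shift a (fun x => f x * _)]
    simp [VelocityWave.shift]
  have hφ' : ∀ φ : Space N → ℝ, ContDiff ℝ ∞ φ → ContDiff ℝ ∞ (VelocityWave.shift (-a) φ) :=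
    fun φ hφ => hφ.comp (by fun_prop)
  have hc' : ∀ φ : Space N → ℝ, HasCompactSupport φ →
      HasCompactSupport (VelocityWave.shift (-a) φ) :=
    fun φ hc => hc.comp_homeomorph (Homeomorph.addLeft (-a))
  have sub : ∀ f f' : Space N → ℝ, VelocityWave.shift a f - VelocityWave.shift a f'
    = VelocityWave.shift a (f - f') := fun f f' => rfl
  refine ⟨?_, fun t ht => (h.mem_u t ht).shift a, fun t ht => (h.mem_v t ht).shift a,
    ?_, ?_, ?_, ?_, ?_, ?_, ?_⟩
  · have hmp : MeasurePreserving (Prod.map id (fun z : Space N => a + z))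
        ((volume : Measure (ℝ × Space N)).restrict (Ico 0 T ×ˢ univ))
        ((volume : Measure (ℝ × Space N)).restrict (Ico 0 T ×ˢ univ)) := by
      have h0 : MeasurePreserving (Prod.map (id : ℝ → ℝ) (fun z : Space N => a + z))
          (volume : Measure (ℝ × Space N)) volume :=
        (MeasurePreserving.id volume).prod (measurePreserving_shift a)
      have := h0.restrict_preimage (s := Ico 0 T ×ˢ univ) (measurableSet_Ico.prod .univ)
      have he : Prod.map (id : ℝ → ℝ) (fun z : Space N => a + z) ⁻¹' (Ico 0 T ×ˢ univ)
          = Ico 0 T ×ˢ univ := by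
        ext z; simp
      rwa [he] at this
    exact h.aesm.comp_measurePreserving hmp
  · simpa only [ulocNorm_shift] using h.bdd
  · intro x t ht
    simpa only [sub, ball1, sobolevNorm_shift] using h.cont_u (a + x) t ht
  · intro x t ht
    simpa only [sub, ball1, sobolevNorm_shift] using h.cont_v (a + x) t ht
  · exact shift_congr a h.init_u
  · exact shift_congr a h.init_v
  · intro φ hφ hc t ht
    simpa only [test] using h.deriv_u _ (hφ' φ hφ) (hc' φ hc) t ht
  · intro φ hφ hc t ht
    have := h.deriv_v _ (hφ' φ hφ) (hc' φ hc) t ht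
    rw [← test] at this
    simp only [test]
    convert this using 1
    refine integral_congr_ae ?_
    filter_upwards [weakLaplacian_shift a (u t)] with x hx
    rw [hx]
    rfl

end Translation

/-! ### Weighted bilinear forms on L²(B). -/

section Forms

variable {N : ℕ}

/-- Lebesgue measure on the closed unit ball. -/
noncomputable abbrev ballMeasure (N : ℕ) : Measure (Space N) :=
  (volume : Measure (Space N)).restrict (ball1 (0 : Space N))

/-- The Hilbert space `L²(B)`. -/
noncomputable abbrev BallL2 (N : ℕ) : Type := Lp ℝ 2 (ballMeasure N)

open Classical in
/-- The class in `L²(B)` of a function, and `0` when it is not square integrable on `B`. -/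
noncomputable def toL2 (f : Space N → ℝ) : BallL2 N :=
  if h : MemLp f 2 (ballMeasure N) then h.toLp f else 0

theorem coeFn_toL2 {f : Space N → ℝ} (h : MemLp f 2 (ballMeasure N)) :
    toL2 f =ᵐ[ballMeasure N] f := by
  rw [toL2, dif_pos h]
  exact h.coeFn_toLp

theorem enorm_toL2 {f : Space N → ℝ} (h : MemLp f 2 (ballMeasure N)) :
    ‖toL2 f‖ₑ = eLpNorm f 2 (ballMeasure N) := by
  rw [Lp.enorm_def, eLpNorm_congr_ae (coeFn_toL2 h)]

theorem toL2_congr {f g : Space N → ℝ} (h : f =ᵐ[ballMeasure N] g) : toL2 f = toL2 g := by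
  by_cases hf : MemLp f 2 (ballMeasure N)
  · rw [toL2, toL2, dif_pos hf, dif_pos ((memLp_congr_ae h).1 hf)]
    exact MemLp.toLp_congr _ _ h
  · rw [toL2, toL2, dif_neg hf, dif_neg (fun h' => hf ((memLp_congr_ae h).2 h'))]

theorem toL2_sub {f g : Space N → ℝ} (hf : MemLp f 2 (ballMeasure N))
    (hg : MemLp g 2 (ballMeasure N)) : toL2 (f - g) = toL2 f - toL2 g := by
  rw [toL2, toL2, toL2, dif_pos hf, dif_pos hg, dif_pos (hf.sub hg)]
  exact MemLp.toLp_sub _ _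

theorem toL2_add {f g : Space N → ℝ} (hf : MemLp f 2 (ballMeasure N))
    (hg : MemLp g 2 (ballMeasure N)) : toL2 (f + g) = toL2 f + toL2 g := by
  rw [toL2, toL2, toL2, dif_pos hf, dif_pos hg, dif_pos (hf.add hg)]
  exact MemLp.toLp_add _ _

theorem toL2_const_mul {f : Space N → ℝ} (hf : MemLp f 2 (ballMeasure N)) (c : ℝ) :
    toL2 (fun x => c * f x) = c • toL2 f := by
  rw [toL2, toL2, dif_pos hf, dif_pos (hf.const_mul c)]
  exact MemLp.toLp_const_smul c hf

open Classical in
/-- The bilinear form `(f,g) ↦ ∫_B w f g` on `L²(B)`, for a bounded weight `w`. -/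
noncomputable def wform (w : Space N → ℝ) : BallL2 N →L[ℝ] BallL2 N →L[ℝ] ℝ :=
  if h : MemLp w ∞ (ballMeasure N) then
    ((ContinuousLinearMap.mul ℝ ℝ).lpPairing (ballMeasure N) 2 2).comp
      ((ContinuousLinearMap.mul ℝ ℝ).holderL (ballMeasure N) ∞ 2 2 (h.toLp w))
  else 0

theorem memLp_top_of_continuous {w : Space N → ℝ} (hw : Continuous w) :
    MemLp w ∞ (ballMeasure N) := by
  obtain ⟨C, hC⟩ := (isCompact_closedBall (0 : Space N) 1).exists_bound_of_continuousOn
    hw.continuousOn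
  refine memLp_top_of_bound hw.aestronglyMeasurable C ?_
  exact (ae_restrict_iff' Metric.isClosed_closedBall.measurableSet).2 (.of_forall hC)

/-- Boundedness of the form reduces the time regularity of weighted integrals to that of curves in
L²(B), with no differentiation under the integral sign. This formula is the bridge back to
integrals. -/
theorem wform_apply {w : Space N → ℝ} (hw : Continuous w) (f g : BallL2 N) :
    wform w f g = ∫ z in ball1 (0 : Space N), w z * f z * g z := by
  have h := memLp_top_of_continuous hw
  rw [wform, dif_pos h]
  simp only [ContinuousLinearMap.comp_apply, ContinuousLinearMap.lpPairing_eq_integral]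
  refine integral_congr_ae ?_
  filter_upwards [h.coeFn_toLp, (ContinuousLinearMap.mul ℝ ℝ).coeFn_holder (r := 2) (h.toLp w) f]
    with z h1 h2
  have h3 : (((ContinuousLinearMap.mul ℝ ℝ).holderL (ballMeasure N) ∞ 2 2) (h.toLp w)) f
    = (ContinuousLinearMap.mul ℝ ℝ).holder 2 (h.toLp w) f := rfl
  rw [h3, h2, h1]
  simp

theorem wform_toL2 {w : Space N → ℝ} (hw : Continuous w) {f g : Space N → ℝ}
    (hf : MemLp f 2 (ballMeasure N)) (hg : MemLp g 2 (ballMeasure N)) :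
    wform w (toL2 f) (toL2 g) = ∫ z in ball1 (0 : Space N), w z * f z * g z := by
  rw [wform_apply hw]
  refine integral_congr_ae ?_
  filter_upwards [coeFn_toL2 hf, coeFn_toL2 hg] with z h1 h2
  rw [h1, h2]

theorem integrable_weight_mul_mul {w : Space N → ℝ} (hw : Continuous w) {f g : Space N → ℝ}
    (hf : MemLp f 2 (ballMeasure N)) (hg : MemLp g 2 (ballMeasure N)) :
    Integrable (fun z => w z * f z * g z) (ballMeasure N) := by
  have h : MemLp (fun z => w z * f z) 2 (ballMeasure N) :=
    hf.mul' (memLp_top_of_continuous hw)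
  exact h.integrable_mul hg

theorem wform_comm {w : Space N → ℝ} (hw : Continuous w) (f g : BallL2 N) :
    wform w f g = wform w g f := by
  rw [wform_apply hw, wform_apply hw]
  exact integral_congr_ae (.of_forall fun z => by simp only; ring)

theorem wform_self_mono {w w' : Space N → ℝ} (hw : Continuous w) (hw' : Continuous w')
    (h : ∀ z ∈ ball1 (0 : Space N), w z ≤ w' z) (f : BallL2 N) : wform w f f ≤ wform w' f f := by
  rw [wform_apply hw, wform_apply hw']
  refine integral_mono_ae (integrable_weight_mul_mul hw (Lp.memLp f) (Lp.memLp f))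
    (integrable_weight_mul_mul hw' (Lp.memLp f) (Lp.memLp f)) ?_
  refine (ae_restrict_iff' Metric.isClosed_closedBall.measurableSet).2 (.of_forall fun z hz => ?_)
  simp only [mul_assoc]
  exact mul_le_mul_of_nonneg_right (h z hz) (mul_self_nonneg _)

theorem wform_self_nonneg {w : Space N → ℝ} (hw : Continuous w)
    (h : ∀ z ∈ ball1 (0 : Space N), 0 ≤ w z) (f : BallL2 N) : 0 ≤ wform w f f := by
  rw [wform_apply hw]
  refine setIntegral_nonneg Metric.isClosed_closedBall.measurableSet fun z hz => ?_
  rw [mul_assoc]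
  exact mul_nonneg (h z hz) (mul_self_nonneg _)

theorem wform_one_self (f : BallL2 N) : wform (fun _ => 1) f f = ‖f‖ ^ 2 := by
  rw [wform_apply continuous_const, ← real_inner_self_eq_norm_sq, L2.inner_def]
  simp [sq]

theorem wform_mul_const (w : Space N → ℝ) (hw : Continuous w) (c : ℝ) (f g : BallL2 N) :
    wform (fun z => c * w z) f g = c * wform w f g := by
  rw [wform_apply hw, wform_apply (by fun_prop), ← integral_const_mul]
  exact integral_congr_ae (.of_forall fun z => by simp only; ring)

end Forms

/-! ### Mollification and its L² bounds. -/

section Mollification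

variable {N : ℕ}

/-- Mollification by a normalised bump function. -/
noncomputable def moll (φ : ContDiffBump (0 : Space N)) (f : Space N → ℝ) : Space N → ℝ :=
  convolution (φ.normed volume) f (ContinuousLinearMap.lsmul ℝ ℝ) volume

theorem moll_apply (φ : ContDiffBump (0 : Space N)) (f : Space N → ℝ) (x : Space N) :
    moll φ f x = ∫ y, f y * φ.normed volume (x - y) := by
  rw [moll, convolution_eq_swap]
  simp [mul_comm]

theorem contDiff_moll (φ : ContDiffBump (0 : Space N)) {f : Space N → ℝ}
    (hf : LocallyIntegrable f) : ContDiff ℝ ∞ (moll φ f) :=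
  φ.hasCompactSupport_normed.contDiff_convolution_left _ φ.contDiff_normed hf

theorem integral_reflect (x : Space N) (F : Space N → ℝ) : ∫ y, F (x - y) = ∫ y, F y :=
  integral_sub_left_eq_self F volume x

theorem contDiff_normed_reflect (φ : ContDiffBump (0 : Space N)) (x : Space N) :
    ContDiff ℝ ∞ fun y => φ.normed volume (x - y) :=
  φ.contDiff_normed.comp (contDiff_const.sub contDiff_id)

theorem hasCompactSupport_normed_reflect (φ : ContDiffBump (0 : Space N)) (x : Space N) :
    HasCompactSupport fun y => φ.normed volume (x - y) :=
  φ.hasCompactSupport_normed.comp_homeomorph (Homeomorph.subLeft x)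

/-- For fixed x the reflected kernel y ↦ φ(x - y) is a test function. The definition of the weak
derivative thus moves the derivative from the kernel to f. -/
theorem fderiv_moll (φ : ContDiffBump (0 : Space N)) {i : Fin N} {f g : Space N → ℝ}
    (h : HasWeakPartial i f g) (x : Space N) :
    fderiv ℝ (moll φ f) x (EuclideanSpace.single i 1) = moll φ g x := by
  have hd := φ.hasCompactSupport_normed.hasFDerivAt_convolution_left (𝕜 := ℝ)
    (ContinuousLinearMap.lsmul ℝ ℝ) (φ.contDiff_normed (μ := volume) (n := 1)) h.1 x
  have hw := h.2.2 _ (contDiff_normed_reflect φ x) (hasCompactSupport_normed_reflect φ x)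
  have hchain : ∀ y, fderiv ℝ (fun y => φ.normed volume (x - y)) y (EuclideanSpace.single i 1)
      = - fderiv ℝ (φ.normed volume) (x - y) (EuclideanSpace.single i 1) := by
    intro y
    have h1 : HasFDerivAt (φ.normed volume) (fderiv ℝ (φ.normed volume) (x - y)) (x - y) :=
      ((φ.contDiff_normed (n := 1)).differentiable one_ne_zero _).hasFDerivAt
    have h2 : HasFDerivAt (fun y => φ.normed volume (x - y)) _ y :=
      h1.comp y ((hasFDerivAt_id y).const_sub x)
    rw [h2.fderiv]
    simp
  simp only [hchain, mul_neg, integral_neg, neg_inj] at hw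
  rw [moll_apply, ← hw]
  change fderiv ℝ (convolution (φ.normed volume) f (ContinuousLinearMap.lsmul ℝ ℝ) volume) x _ = _
  have hex : ConvolutionExistsAt (fderiv ℝ (φ.normed volume)) f x
      ((ContinuousLinearMap.lsmul ℝ ℝ).precompL (Space N)) volume :=
    (φ.hasCompactSupport_normed.fderiv ℝ).convolutionExists_left _
      ((φ.contDiff_normed (n := 1)).continuous_fderiv one_ne_zero) h.1 x
  rw [hd.fderiv, convolution_def, ContinuousLinearMap.integral_apply hex]
  rw [← integral_reflect x]
  refine integral_congr_ae (.of_forall fun y => ?_)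
  simp [ContinuousLinearMap.precompL_apply, mul_comm]

theorem lintegral_normed (φ : ContDiffBump (0 : Space N)) :
    ∫⁻ y, ENNReal.ofReal (φ.normed volume y) = 1 := by
  rw [← ofReal_integral_eq_lintegral_ofReal φ.integrable_normed (.of_forall φ.nonneg_normed),
    φ.integral_normed, ENNReal.ofReal_one]

/-- Jensen's inequality for the probability density φ, obtained from Cauchy-Schwarz after splitting
the kernel into two square roots. -/
theorem enorm_moll_sq_le (φ : ContDiffBump (0 : Space N)) {f : Space N → ℝ}
    (hf : AEStronglyMeasurable f volume) (x : Space N) :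
    ‖moll φ f x‖ₑ ^ 2 ≤ ∫⁻ y, ENNReal.ofReal (φ.normed volume y) * ‖f (x - y)‖ₑ ^ 2 := by
  have hfx : AEMeasurable (fun y => ‖f (x - y)‖ₑ) volume :=
    (hf.comp_quasiMeasurePreserving
      (Measure.measurePreserving_sub_left volume x).quasiMeasurePreserving).enorm
  have hη : Measurable fun y => ENNReal.ofReal (φ.normed volume y) :=
    (φ.continuous_normed.measurable).ennreal_ofReal
  have h1 : ‖moll φ f x‖ₑ ≤ ∫⁻ y, ENNReal.ofReal (φ.normed volume y) * ‖f (x - y)‖ₑ := by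
    rw [moll, convolution_def]
    refine (enorm_integral_le_lintegral_enorm _).trans (lintegral_mono fun y => ?_)
    simp [enorm_mul, Real.enorm_of_nonneg (φ.nonneg_normed y)]
  have h2 : ∫⁻ y, ENNReal.ofReal (φ.normed volume y) * ‖f (x - y)‖ₑ
      ≤ (∫⁻ y, ENNReal.ofReal (φ.normed volume y)) ^ (1 / 2 : ℝ)
        * (∫⁻ y, ENNReal.ofReal (φ.normed volume y) * ‖f (x - y)‖ₑ ^ 2) ^ (1 / 2 : ℝ) := by
    have := ENNReal.lintegral_mul_le_Lp_mul_Lq volume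
      (f := fun y => ENNReal.ofReal (φ.normed volume y) ^ (1 / 2 : ℝ))
      (g := fun y => ENNReal.ofReal (φ.normed volume y) ^ (1 / 2 : ℝ) * ‖f (x - y)‖ₑ)
      (Real.HolderConjugate.two_two) (hη.pow_const _).aemeasurable
      ((hη.pow_const _).aemeasurable.mul hfx)
    have e : ∀ a : ℝ≥0∞, a ^ (2⁻¹ : ℝ) * a ^ (2⁻¹ : ℝ) = a := fun a => by
      rw [← ENNReal.rpow_add_of_nonneg _ _ (by norm_num) (by norm_num)]; norm_num
    have e2 : ∀ a : ℝ≥0∞, (a ^ (2⁻¹ : ℝ)) ^ 2 = a := fun a => by rw [sq, e]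
    simpa [← mul_assoc, e, e2, mul_pow] using this
  rw [lintegral_normed, ENNReal.one_rpow, one_mul] at h2
  calc ‖moll φ f x‖ₑ ^ 2 ≤ ((∫⁻ y, ENNReal.ofReal (φ.normed volume y) * ‖f (x - y)‖ₑ ^ 2)
        ^ (1 / 2 : ℝ)) ^ 2 := by gcongr; exact h1.trans h2
    _ = _ := by
      rw [← ENNReal.rpow_natCast, ← ENNReal.rpow_mul]; norm_num

/-- By Tonelli the left side is an average, over y in the support of the kernel, of integrals over
translated balls. Each translate stays in the larger ball, so the constant is one. -/
theorem lintegral_moll_sq_le (φ : ContDiffBump (0 : Space N)) {f : Space N → ℝ}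
    (hf : AEStronglyMeasurable f volume) (R R' : ℝ) (hR : R + φ.rOut ≤ R') (c : Space N) :
    ∫⁻ x in Metric.closedBall c R, ‖moll φ f x‖ₑ ^ 2
      ≤ ∫⁻ x in Metric.closedBall c R', ‖f x‖ₑ ^ 2 := by
  have hη : Measurable fun y => ENNReal.ofReal (φ.normed volume y) :=
    (φ.continuous_normed.measurable).ennreal_ofReal
  have hjoint : AEMeasurable (fun q : Space N × Space N => ‖f (q.1 - q.2)‖ₑ ^ 2)
      ((volume.restrict (Metric.closedBall c R)).prod volume) := by
    have h0 : AEMeasurable (fun q : Space N × Space N => ‖f (q.1 - q.2)‖ₑ ^ 2)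
        ((volume : Measure (Space N)).prod volume) :=
      (hf.comp_quasiMeasurePreserving (quasiMeasurePreserving_sub volume volume)).enorm.pow_const 2
    refine h0.mono_measure ?_
    conv_rhs => rw [← Measure.restrict_univ (μ := (volume : Measure (Space N)).prod volume),
      ← univ_prod_univ, ← Measure.prod_restrict]
    exact Measure.prod_mono (Measure.restrict_mono (subset_univ _) le_rfl) (by simp)
  calc ∫⁻ x in Metric.closedBall c R, ‖moll φ f x‖ₑ ^ 2
      ≤ ∫⁻ x in Metric.closedBall c R, ∫⁻ y, ENNReal.ofReal (φ.normed volume y)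
          * ‖f (x - y)‖ₑ ^ 2 := lintegral_mono fun x => enorm_moll_sq_le φ hf x
    _ = ∫⁻ y, ∫⁻ x in Metric.closedBall c R, ENNReal.ofReal (φ.normed volume y)
          * ‖f (x - y)‖ₑ ^ 2 :=
        lintegral_lintegral_swap ((hη.comp measurable_snd).aemeasurable.mul hjoint)
    _ ≤ ∫⁻ y, ENNReal.ofReal (φ.normed volume y) *
          ∫⁻ x in Metric.closedBall c R', ‖f x‖ₑ ^ 2 := by
        refine lintegral_mono fun y => ?_
        dsimp only
        rw [lintegral_const_mul' _ _ ENNReal.ofReal_ne_top]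
        by_cases hy : y ∈ Metric.ball (0 : Space N) φ.rOut
        · refine mul_le_mul_right ?_ _
          have hmp := (measurePreserving_sub_right (volume : Measure (Space N)) y).restrict_preimage
            (Metric.isClosed_closedBall (x := c) (ε := R')).measurableSet
          have := hmp.lintegral_comp_emb (MeasurableEquiv.subRight y).measurableEmbedding
            (fun x => ‖f x‖ₑ ^ 2)
          rw [← this]
          refine lintegral_mono_set fun x hx => ?_
          simp only [mem_preimage, Metric.mem_closedBall, dist_eq_norm, Metric.mem_ball,
            sub_zero] at *
          calc ‖x - y - c‖ = ‖(x - c) - y‖ := by congr 1; abel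
            _ ≤ ‖x - c‖ + ‖y‖ := norm_sub_le _ _
            _ ≤ R' := by linarith
        · have : φ.normed volume y = 0 := by
            rw [← Function.notMem_support, φ.support_normed_eq]; exact hy
          simp [this]
    _ = _ := by rw [lintegral_mul_const _ hη, lintegral_normed, one_mul]

theorem eLpNorm_two_eq {μ : Measure (Space N)} (f : Space N → ℝ) :
    eLpNorm f 2 μ = (∫⁻ x, ‖f x‖ₑ ^ 2 ∂μ) ^ (1 / 2 : ℝ) := by
  rw [eLpNorm_eq_lintegral_rpow_enorm_toReal (by simp) (by simp)]
  simp

theorem eLpNorm_moll_le (φ : ContDiffBump (0 : Space N)) {f : Space N → ℝ}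
    (hf : AEStronglyMeasurable f volume) (R R' : ℝ) (hR : R + φ.rOut ≤ R') (c : Space N) :
    eLpNorm (moll φ f) 2 (volume.restrict (Metric.closedBall c R))
      ≤ eLpNorm f 2 (volume.restrict (Metric.closedBall c R')) := by
  rw [eLpNorm_two_eq, eLpNorm_two_eq]
  exact ENNReal.rpow_le_rpow (lintegral_moll_sq_le φ hf R R' hR c) (by norm_num)

theorem moll_sub (φ : ContDiffBump (0 : Space N)) {f g : Space N → ℝ} (hf : LocallyIntegrable f)
    (hg : LocallyIntegrable g) : moll φ (f - g) = moll φ f - moll φ g := by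
  funext x
  simp only [Pi.sub_apply, moll_apply, sub_mul]
  exact integral_sub
    (integrable_mul_of_locallyIntegrable hf (contDiff_normed_reflect φ x).continuous
      (hasCompactSupport_normed_reflect φ x))
    (integrable_mul_of_locallyIntegrable hg (contDiff_normed_reflect φ x).continuous
      (hasCompactSupport_normed_reflect φ x))

/-- Mollifiers with supports shrinking to a point converge in `L²` of every ball. -/
theorem tendsto_eLpNorm_moll_sub {φ : ℕ → ContDiffBump (0 : Space N)}
    (hφ : Tendsto (fun n => (φ n).rOut) atTop (𝓝 0)) {f : Space N → ℝ} (hf : LocallyIntegrable f)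
    {R R' : ℝ} (hR : R < R') (h2 : MemLp f 2 (volume.restrict (Metric.closedBall 0 R'))) :
    Tendsto (fun n => eLpNorm (moll (φ n) f - f) 2 (volume.restrict (Metric.closedBall 0 R)))
      atTop (𝓝 0) := by
  have hle : (volume : Measure (Space N)).restrict (Metric.closedBall 0 R)
      ≤ volume.restrict (Metric.closedBall 0 R') :=
    Measure.restrict_mono (Metric.closedBall_subset_closedBall hR.le) le_rfl
  set V := (volume : Measure (Space N)).restrict (Metric.closedBall 0 R) univ with hV
  have hVtop : V ≠ ⊤ := by
    rw [hV, Measure.restrict_apply_univ]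
    exact measure_closedBall_lt_top.ne
  rw [ENNReal.tendsto_nhds_zero]
  intro ε hε
  obtain ⟨g, hgc, hgε, hgcont, hg2⟩ := h2.exists_hasCompactSupport_eLpNorm_sub_le (by simp)
    (ε := ε / 3) (by simpa using hε.ne')
  have hgL : LocallyIntegrable g := hgcont.locallyIntegrable
  -- A uniform error δ costs at most V^{1/2} δ in L² of a set of measure V, so δ is fixed to make
  -- this at most ε/3.
  obtain ⟨δ, hδ, hδV⟩ : ∃ δ : ℝ, 0 < δ ∧ V ^ (1 / 2 : ℝ) * ENNReal.ofReal δ ≤ ε / 3 := by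
    have ht : Tendsto (fun δ : ℝ => V ^ (1 / 2 : ℝ) * ENNReal.ofReal δ) (𝓝[>] 0) (𝓝 0) := by
      have h1 : Tendsto (fun δ : ℝ => ENNReal.ofReal δ) (𝓝[>] 0) (𝓝 0) := by
        simpa using (ENNReal.tendsto_ofReal (tendsto_id (α := ℝ) (x := 𝓝 0))).mono_left
          nhdsWithin_le_nhds
      simpa using ENNReal.Tendsto.const_mul (a := V ^ (1 / 2 : ℝ)) h1
        (Or.inr (ENNReal.rpow_ne_top_of_nonneg (by norm_num) hVtop))
    have h3 : (0 : ℝ≥0∞) < ε / 3 := by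
      rw [ENNReal.div_pos_iff]; exact ⟨hε.ne', by simp⟩
    obtain ⟨δ, h4, h5⟩ := ((ht.eventually (eventually_lt_nhds h3)).and self_mem_nhdsWithin).exists
    exact ⟨δ, h5, h4.le⟩
  obtain ⟨η, hη, hgu⟩ := Metric.uniformContinuous_iff.1
    (hgc.uniformContinuous_of_continuous hgcont) δ hδ
  filter_upwards [hφ.eventually (eventually_lt_nhds hη),
    hφ.eventually (eventually_lt_nhds (sub_pos.2 hR))] with n hn1 hn2
  -- The outer two pieces are small because g approximates f, and the middle one because g is
  -- uniformly continuous.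
  have e : moll (φ n) f - f = moll (φ n) (f - g) + (moll (φ n) g - g) + (g - f) := by
    rw [moll_sub _ hf hgL]; abel
  have mfg : AEStronglyMeasurable (moll (φ n) (f - g)) volume :=
    (contDiff_moll _ (hf.sub hgL)).continuous.aestronglyMeasurable
  have mg : AEStronglyMeasurable (moll (φ n) g - g) volume :=
    ((contDiff_moll _ hgL).continuous.sub hgcont).aestronglyMeasurable
  have mgf : AEStronglyMeasurable (g - f) volume :=
    hgcont.aestronglyMeasurable.sub hf.aestronglyMeasurable
  have i1 : eLpNorm (moll (φ n) (f - g)) 2 (volume.restrict (Metric.closedBall 0 R)) ≤ ε / 3 :=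
    (eLpNorm_moll_le _ (hf.sub hgL).aestronglyMeasurable R R' (by linarith) 0).trans hgε
  have i3 : eLpNorm (g - f) 2 (volume.restrict (Metric.closedBall 0 R)) ≤ ε / 3 := by
    rw [eLpNorm_sub_comm]
    exact (eLpNorm_mono_measure _ hle).trans hgε
  have i2 : eLpNorm (moll (φ n) g - g) 2 (volume.restrict (Metric.closedBall 0 R)) ≤ ε / 3 := by
    refine (eLpNorm_le_of_ae_bound (C := δ) (.of_forall fun x => ?_)).trans ?_
    · have := (φ n).dist_normed_convolution_le (μ := volume) (x₀ := x) (ε := δ)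
        hgcont.aestronglyMeasurable
        fun y hy => (hgu (lt_trans (Metric.mem_ball.1 hy) hn1)).le
      rwa [Real.dist_eq] at this
    · refine le_trans (le_of_eq ?_) hδV
      rw [hV]; norm_num
  rw [e]
  calc _ ≤ _ := (eLpNorm_add_le (mfg.add mg).restrict mgf.restrict (by norm_num)).trans
        (add_le_add_left (eLpNorm_add_le mfg.restrict mg.restrict (by norm_num)) _)
    _ ≤ ε / 3 + ε / 3 + ε / 3 := by gcongr
    _ = ε := ENNReal.add_thirds ε

end Mollification

/-! ### Integration by parts against weights vanishing off the ball. -/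

section ByParts

variable {N : ℕ}

theorem fderiv_eq_zero_of_notMem_ball {ψ : Space N → ℝ}
    (hs : ∀ x ∉ ball1 (0 : Space N), ψ x = 0) {x : Space N} (hx : x ∉ ball1 (0 : Space N)) :
    fderiv ℝ ψ x = 0 := by
  have : ψ =ᶠ[𝓝 x] fun _ => 0 := by
    filter_upwards [Metric.isClosed_closedBall.isOpen_compl.mem_nhds hx] with y hy using hs y hy
  rw [this.fderiv_eq]
  simp

theorem memLp_ball_of_continuous {f : Space N → ℝ} (hf : Continuous f) :
    MemLp f 2 (ballMeasure N) := by
  have : IsFiniteMeasure (ballMeasure N) := ⟨by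
    rw [Measure.restrict_apply_univ]; exact measure_closedBall_lt_top⟩
  exact (memLp_top_of_continuous hf).mono_exponent le_top

/-- The weight vanishes outside B, so every integral over B is an integral over the whole space. The
product rule for ψ f h then leaves no boundary term. -/
theorem wform_byParts_of_contDiff {ψ : Space N → ℝ} (hψ : ContDiff ℝ 1 ψ)
    (hs : ∀ x ∉ ball1 (0 : Space N), ψ x = 0) {f h : Space N → ℝ} (hf : ContDiff ℝ ∞ f)
    (hh : ContDiff ℝ ∞ h) (e : Space N) :
    wform ψ (toL2 f) (toL2 fun x => fderiv ℝ h x e)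
      + wform ψ (toL2 fun x => fderiv ℝ f x e) (toL2 h)
      + wform (fun x => fderiv ℝ ψ x e) (toL2 f) (toL2 h) = 0 := by
  have hψc : HasCompactSupport ψ :=
    HasCompactSupport.intro (isCompact_closedBall (0 : Space N) 1) hs
  have cf : Continuous fun x => fderiv ℝ f x e := continuous_fderiv_single hf e
  have ch : Continuous fun x => fderiv ℝ h x e := continuous_fderiv_single hh e
  have cψ : Continuous fun x => fderiv ℝ ψ x e :=
    (hψ.continuous_fderiv one_ne_zero).clm_apply continuous_const
  have df := hf.differentiable (by simp)
  have dh := hh.differentiable (by simp)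
  have dψ := hψ.differentiable one_ne_zero
  have hψc' : HasCompactSupport fun x => fderiv ℝ ψ x e := hψc.fderiv_apply (𝕜 := ℝ) e
  have hmul : ∀ x, fderiv ℝ (fun y => f y * h y) x e
      = f x * fderiv ℝ h x e + fderiv ℝ f x e * h x := by
    intro x
    rw [fderiv_fun_mul (df x) (dh x)]
    simp [mul_comm]
  have key := integral_mul_fderiv_eq_neg_fderiv_mul_of_integrable (μ := (volume : Measure (Space N)))
    (f := ψ) (g := fun y => f y * h y) (v := e)
    ((cψ.mul (hf.continuous.mul hh.continuous)).integrable_of_hasCompactSupport hψc'.mul_right)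
    (by
      simp only [hmul]
      exact (hψ.continuous.mul ((hf.continuous.mul ch).add
        (cf.mul hh.continuous))).integrable_of_hasCompactSupport hψc.mul_right)
    ((hψ.continuous.mul (hf.continuous.mul hh.continuous)).integrable_of_hasCompactSupport
      hψc.mul_right)
    (fun x _ => dψ x) (fun x _ => (df x).mul (dh x))
  rw [wform_toL2 hψ.continuous (memLp_ball_of_continuous hf.continuous)
      (memLp_ball_of_continuous ch),
    wform_toL2 hψ.continuous (memLp_ball_of_continuous cf)
      (memLp_ball_of_continuous hh.continuous),
    wform_toL2 cψ (memLp_ball_of_continuous hf.continuous)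
      (memLp_ball_of_continuous hh.continuous),
    setIntegral_eq_integral_of_forall_compl_eq_zero (fun x hx => by simp [hs x hx]),
    setIntegral_eq_integral_of_forall_compl_eq_zero (fun x hx => by simp [hs x hx]),
    setIntegral_eq_integral_of_forall_compl_eq_zero
      (fun x hx => by simp [fderiv_eq_zero_of_notMem_ball hs hx])]
  simp only [hmul, mul_add, ← mul_assoc] at key
  rw [integral_add] at key
  · linarith
  · exact ((hψ.continuous.mul hf.continuous).mul ch).integrable_of_hasCompactSupport
      (hψc.mul_right.mul_right)
  · exact ((hψ.continuous.mul cf).mul hh.continuous).integrable_of_hasCompactSupport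
      (hψc.mul_right.mul_right)

theorem tendsto_toL2 {ι : Type*} {l : Filter ι} {F : ι → Space N → ℝ} {f : Space N → ℝ}
    (hF : ∀ᶠ n in l, MemLp (F n) 2 (ballMeasure N)) (hf : MemLp f 2 (ballMeasure N))
    (h : Tendsto (fun n => eLpNorm (F n - f) 2 (ballMeasure N)) l (𝓝 0)) :
    Tendsto (fun n => toL2 (F n)) l (𝓝 (toL2 f)) := by
  rw [tendsto_iff_edist_tendsto_0]
  refine h.congr' ?_
  filter_upwards [hF] with n hn
  rw [edist_eq_enorm_sub, ← toL2_sub hn hf, enorm_toL2 (hn.sub hf)]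

/-- The ratio bound gives almost everywhere convergence of mollifications. The bound 1/8 keeps
supports inside the slightly larger balls of the local estimates. The shrinking radii give
convergence in L². -/
theorem exists_bumps (N : ℕ) : ∃ φ : ℕ → ContDiffBump (0 : Space N),
    (∀ n, (φ n).rOut ≤ 2 * (φ n).rIn) ∧ (∀ n, (φ n).rOut ≤ 1 / 8) ∧
      Tendsto (fun n => (φ n).rOut) atTop (𝓝 0) := by
  refine ⟨fun n => ⟨1 / (16 * (n + 1)), 1 / (8 * (n + 1)), by positivity, ?_⟩, fun n => ?_,
    fun n => ?_, ?_⟩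
  · have : (0 : ℝ) < n + 1 := by positivity
    rw [one_div_lt_one_div (by positivity) (by positivity)]
    linarith
  · refine le_of_eq ?_
    simp only
    field_simp
    norm_num
  · simp only
    rw [one_div_le_one_div (by positivity) (by norm_num)]
    have : (0 : ℝ) ≤ n := by positivity
    linarith
  · have := tendsto_one_div_add_atTop_nhds_zero_nat (𝕜 := ℝ)
    have h2 := this.const_mul (1 / 8)
    simp only [mul_zero] at h2
    refine h2.congr fun n => ?_
    simp only
    field_simp

theorem memLp_ball_of_memLp {f : Space N → ℝ} {R : ℝ} (hR : 1 ≤ R)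
    (hf : MemLp f 2 (volume.restrict (Metric.closedBall (0 : Space N) R))) :
    MemLp f 2 (ballMeasure N) :=
  hf.mono_measure (Measure.restrict_mono (Metric.closedBall_subset_closedBall hR) le_rfl)

/-- Integration by parts for weakly differentiable functions against a `C¹` weight supported in the
unit ball. -/
theorem wform_byParts {ψ : Space N → ℝ} (hψ : ContDiff ℝ 1 ψ)
    (hs : ∀ x ∉ ball1 (0 : Space N), ψ x = 0) {i : Fin N} {f f' h h' : Space N → ℝ}
    (hf : HasWeakPartial i f f') (hh : HasWeakPartial i h h')
    (mf : MemLp f 2 (volume.restrict (Metric.closedBall 0 2)))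
    (mf' : MemLp f' 2 (volume.restrict (Metric.closedBall 0 2)))
    (mh : MemLp h 2 (volume.restrict (Metric.closedBall 0 2)))
    (mh' : MemLp h' 2 (volume.restrict (Metric.closedBall 0 2))) :
    wform ψ (toL2 f) (toL2 h') + wform ψ (toL2 f') (toL2 h)
      + wform (fun x => fderiv ℝ ψ x (EuclideanSpace.single i 1)) (toL2 f) (toL2 h) = 0 := by
  obtain ⟨φ, -, -, hφ⟩ := exists_bumps N
  -- Mollification on B sees values slightly outside B, which is why square integrability is asked
  -- on the ball of radius 2.
  have conv : ∀ {g : Space N → ℝ}, LocallyIntegrable g →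
      MemLp g 2 (volume.restrict (Metric.closedBall 0 2)) →
      Tendsto (fun n => toL2 (moll (φ n) g)) atTop (𝓝 (toL2 g)) := fun hg mg =>
    tendsto_toL2 (.of_forall fun n => memLp_ball_of_continuous (contDiff_moll _ hg).continuous)
      (memLp_ball_of_memLp one_le_two mg) (tendsto_eLpNorm_moll_sub hφ hg one_lt_two mg)
  have bil : ∀ (w : Space N → ℝ) {F G : ℕ → BallL2 N} {F' G' : BallL2 N},
      Tendsto F atTop (𝓝 F') → Tendsto G atTop (𝓝 G') →
      Tendsto (fun n => wform w (F n) (G n)) atTop (𝓝 (wform w F' G')) := fun w _ _ _ _ h1 h2 =>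
    ((wform w).continuous₂.tendsto (_, _)).comp (h1.prodMk_nhds h2)
  have lim := ((bil ψ (conv hf.1 mf) (conv hh.2.1 mh')).add
    (bil ψ (conv hf.2.1 mf') (conv hh.1 mh))).add
    (bil (fun x => fderiv ℝ ψ x (EuclideanSpace.single i 1)) (conv hf.1 mf) (conv hh.1 mh))
  -- For every n the approximating expression vanishes by the smooth case, as mollification commutes
  -- with weak derivatives. Its limit must then vanish too.
  refine tendsto_nhds_unique lim (tendsto_const_nhds.congr fun n => ?_)
  rw [← wform_byParts_of_contDiff hψ hs (contDiff_moll (φ n) hf.1) (contDiff_moll (φ n) hh.1)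
    (EuclideanSpace.single i 1)]
  simp only [fderiv_moll (φ n) hf, fderiv_moll (φ n) hh]

end ByParts

/-! ### The weights ρ^γ, extended by zero outside the ball. -/

section Weights

/-- The positive part raised to the power `γ`. -/
noncomputable def posPow (γ x : ℝ) : ℝ := max x 0 ^ γ

theorem continuous_posPow {γ : ℝ} (hγ : 0 ≤ γ) : Continuous (posPow γ) :=
  (Real.continuous_rpow_const hγ).comp (by fun_prop)

/-- Away from the origin the function is locally zero or a genuine power. At the origin it is the
product of the positive part, which is O(x), with its power γ - 1, which is o(1) because γ > 1. -/
theorem hasDerivAt_posPow {γ : ℝ} (hγ : 1 < γ) (x : ℝ) :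
    HasDerivAt (posPow γ) (γ * posPow (γ - 1) x) x := by
  have hγ0 : γ - 1 ≠ 0 := by linarith
  rcases lt_trichotomy x 0 with hx | rfl | hx
  · have h1 : posPow γ =ᶠ[𝓝 x] fun _ => 0 := by
      filter_upwards [eventually_lt_nhds hx] with y hy
      rw [posPow, max_eq_right hy.le, Real.zero_rpow (by linarith)]
    have h2 : posPow (γ - 1) x = 0 := by
      rw [posPow, max_eq_right hx.le, Real.zero_rpow hγ0]
    rw [h2, mul_zero]
    exact (hasDerivAt_const x (0 : ℝ)).congr_of_eventuallyEq h1
  · have h2 : posPow (γ - 1) 0 = 0 := by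
      rw [posPow, max_self, Real.zero_rpow hγ0]
    have h3 : posPow γ 0 = 0 := by
      rw [posPow, max_self, Real.zero_rpow (by linarith)]
    rw [h2, mul_zero, hasDerivAt_iff_isLittleO_nhds_zero]
    simp only [zero_add, h3, sub_zero, smul_zero]
    have h4 : posPow γ = fun y => posPow (γ - 1) y * max y 0 := by
      funext y
      rcases le_or_gt y 0 with hy | hy
      · rw [posPow, max_eq_right hy, Real.zero_rpow (by linarith), mul_zero]
      · rw [posPow, posPow, max_eq_left hy.le]
        nth_rewrite 3 [← Real.rpow_one y]
        rw [← Real.rpow_add hy]; ring_nf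
    rw [h4]
    have h5 : (fun y : ℝ => posPow (γ - 1) y) =o[𝓝 0] fun _ => (1 : ℝ) := by
      rw [Asymptotics.isLittleO_one_iff]
      simpa [h2] using (continuous_posPow (by linarith : 0 ≤ γ - 1)).tendsto 0
    have h6 : (fun y : ℝ => max y 0) =O[𝓝 0] fun y => y :=
      Asymptotics.isBigO_of_le _ fun y => by
        rw [Real.norm_eq_abs, Real.norm_eq_abs, abs_of_nonneg (le_max_right _ _)]
        exact max_le (le_abs_self y) (abs_nonneg y)
    simpa using h5.mul_isBigO h6
  · have h1 : posPow γ =ᶠ[𝓝 x] fun y => y ^ γ := by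
      filter_upwards [eventually_gt_nhds hx] with y hy
      rw [posPow, max_eq_left hy.le]
    have h2 : posPow (γ - 1) x = x ^ (γ - 1) := by rw [posPow, max_eq_left hx.le]
    rw [h2]
    exact (Real.hasDerivAt_rpow_const (Or.inl hx.ne')).congr_of_eventuallyEq h1

theorem contDiff_posPow {γ : ℝ} (hγ : 1 < γ) : ContDiff ℝ 1 (posPow γ) := by
  rw [contDiff_one_iff_deriv]
  refine ⟨fun x => (hasDerivAt_posPow hγ x).differentiableAt, ?_⟩
  have : deriv (posPow γ) = fun x => γ * posPow (γ - 1) x := by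
    funext x; exact (hasDerivAt_posPow hγ x).deriv
  rw [this]
  exact continuous_const.mul (continuous_posPow (by linarith))

variable {N : ℕ}

/-- The weight `ρ_+^γ`. -/
noncomputable def rhoPow (γ : ℝ) (z : Space N) : ℝ := posPow γ (rho z)

theorem rho_nonneg {z : Space N} (hz : z ∈ ball1 (0 : Space N)) : 0 ≤ rho z := by
  have : ‖z‖ ≤ 1 := by simpa using hz
  simp only [rho]
  nlinarith [norm_nonneg z]

theorem rho_le_one (z : Space N) : rho z ≤ 1 := by
  simp only [rho]; nlinarith [norm_nonneg z]

theorem rhoPow_eq {γ : ℝ} {z : Space N} (hz : z ∈ ball1 (0 : Space N)) :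
    rhoPow γ z = rho z ^ γ := by
  rw [rhoPow, posPow, max_eq_left (rho_nonneg hz)]

theorem rhoPow_nonneg (γ : ℝ) (z : Space N) : 0 ≤ rhoPow γ z :=
  Real.rpow_nonneg (le_max_right _ _) _

theorem rhoPow_le_one {γ : ℝ} (hγ : 0 ≤ γ) (z : Space N) : rhoPow γ z ≤ 1 :=
  Real.rpow_le_one (le_max_right _ _) (max_le (rho_le_one z) zero_le_one) hγ

theorem rhoPow_le_rhoPow {γ γ' : ℝ} (hγ : 0 < γ) (h : γ ≤ γ') (z : Space N) :
    rhoPow γ' z ≤ rhoPow γ z := by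
  rcases (le_max_right (rho z) 0).eq_or_lt with h0 | h0
  · rw [rhoPow, rhoPow, posPow, posPow, ← h0, Real.zero_rpow (by linarith),
      Real.zero_rpow (by linarith)]
  · exact Real.rpow_le_rpow_of_exponent_ge h0 (max_le (rho_le_one z) zero_le_one) h

theorem contDiff_rho : ContDiff ℝ 1 (rho : Space N → ℝ) :=
  contDiff_const.sub (contDiff_norm_sq ℝ)

theorem continuous_rhoPow {γ : ℝ} (hγ : 0 ≤ γ) : Continuous (rhoPow γ : Space N → ℝ) :=
  (continuous_posPow hγ).comp contDiff_rho.continuous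

/-- An exponent above one makes the zero extension continuously differentiable across the unit
sphere. The weights with exponents α and α - 1 both have to be differentiated, which is where α > 2
enters. -/
theorem contDiff_rhoPow {γ : ℝ} (hγ : 1 < γ) : ContDiff ℝ 1 (rhoPow γ : Space N → ℝ) :=
  (contDiff_posPow hγ).comp contDiff_rho

theorem rhoPow_eq_zero {γ : ℝ} (hγ : 0 < γ) {z : Space N} (hz : z ∉ ball1 (0 : Space N)) :
    rhoPow γ z = 0 := by
  have : 1 < ‖z‖ := by simpa using hz
  have h : rho z ≤ 0 := by simp only [rho]; nlinarith
  rw [rhoPow, posPow, max_eq_right h, Real.zero_rpow hγ.ne']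

theorem hasFDerivAt_rhoPow {γ : ℝ} (hγ : 1 < γ) (z : Space N) (i : Fin N) :
    fderiv ℝ (rhoPow γ) z (EuclideanSpace.single i 1) = -(2 * γ) * (z i * rhoPow (γ - 1) z) := by
  have h1 : HasFDerivAt (rho : Space N → ℝ) (-(2 • innerSL ℝ z)) z :=
    ((hasStrictFDerivAt_norm_sq z).hasFDerivAt).const_sub 1
  have h2 := (hasDerivAt_posPow hγ (rho z)).hasFDerivAt.comp z h1
  have h3 : posPow γ ∘ (rho : Space N → ℝ) = rhoPow γ := rfl
  rw [h3] at h2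
  rw [h2.fderiv]
  simp [rhoPow, EuclideanSpace.inner_single_right]
  ring

theorem fderiv_coord_mul_rhoPow {γ : ℝ} (hγ : 1 < γ) (z : Space N) (i : Fin N) :
    fderiv ℝ (fun z : Space N => z i * rhoPow γ z) z (EuclideanSpace.single i 1)
      = rhoPow γ z - (2 * γ) * (z i ^ 2 * rhoPow (γ - 1) z) := by
  have hd : DifferentiableAt ℝ (fun z : Space N => z i) z := by fun_prop
  have hi : fderiv ℝ (fun z : Space N => z i) z (EuclideanSpace.single i 1) = 1 := by
    have : HasFDerivAt (fun z : Space N => z i) (EuclideanSpace.proj i : Space N →L[ℝ] ℝ) z :=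
      (EuclideanSpace.proj i : Space N →L[ℝ] ℝ).hasFDerivAt
    rw [this.fderiv]
    simp
  rw [fderiv_fun_mul hd ((contDiff_rhoPow hγ).differentiable one_ne_zero z)]
  simp only [add_apply, smul_apply, hasFDerivAt_rhoPow hγ, hi, smul_eq_mul, mul_one]
  ring

end Weights

/-! ### Sobolev embeddings in every dimension, and their interior form. -/

section Sobolev

theorem support_fderiv_subset_closure {E : Type*} [NormedAddCommGroup E] [NormedSpace ℝ E]
    {u : E → ℝ} {s : Set E} (hu : Function.support u ⊆ s) :
    Function.support (fderiv ℝ u) ⊆ closure s :=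
  (support_fderiv_subset ℝ).trans (closure_mono hu)

theorem eLpNorm_le_mul_of_support_subset {E F : Type*} [MeasurableSpace E]
    [NormedAddCommGroup F] {μ : Measure E} {f : E → F} (hf : AEStronglyMeasurable f μ) {s : Set E}
    (hs : Function.support f ⊆ s) {p q : ℝ≥0∞} (hpq : p ≤ q) :
    eLpNorm f p μ ≤ eLpNorm f q μ * μ s ^ (1 / p.toReal - 1 / q.toReal) := by
  rw [← eLpNorm_restrict_eq_of_support_subset hs,
    ← eLpNorm_restrict_eq_of_support_subset (p := q) hs]
  simpa using eLpNorm_le_eLpNorm_mul_rpow_measure_univ (μ := μ.restrict s) hpq hf.restrict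

/-- The Gagliardo-Nirenberg-Sobolev inequality from the `L²` norm of the gradient. -/
theorem exists_gagliardoNirenbergSobolev {E : Type*} [NormedAddCommGroup E] [NormedSpace ℝ E]
    [MeasurableSpace E] [BorelSpace E] [FiniteDimensional ℝ E] (μ : Measure E) [μ.IsAddHaarMeasure]
    (hn : 2 ≤ Module.finrank ℝ E) {s : Set E} (hs : Bornology.IsBounded s) {q : ℝ≥0} (hq : 1 ≤ q)
    (hqn : 3 ≤ Module.finrank ℝ E →
      (1 / 2 : ℝ) - (Module.finrank ℝ E : ℝ)⁻¹ ≤ (q : ℝ)⁻¹) :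
    ∃ C : ℝ≥0, ∀ u : E → ℝ, ContDiff ℝ 1 u → Function.support u ⊆ s →
      eLpNorm u q μ ≤ C * eLpNorm (fderiv ℝ u) 2 μ := by
  rcases hn.eq_or_lt with h2 | h3
  -- In dimension two the exponent 2 is critical. The exponent p = 2m/(m+2) is below 2 and has
  -- Sobolev conjugate m ≥ q, and p ≥ 1 because m ≥ 2. Hölder on the bounded support then replaces p
  -- by 2.
  · set m : ℝ≥0 := max q 2 with hm
    have hm2 : (2 : ℝ) ≤ m := by exact_mod_cast le_max_right q 2
    have hmq : (q : ℝ) ≤ m := by exact_mod_cast le_max_left q 2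
    have hq0 : (0 : ℝ) < q := by exact_mod_cast lt_of_lt_of_le one_pos hq
    set p : ℝ≥0 := 2 * m / (m + 2) with hp
    have hpr : (p : ℝ) = 2 * m / (m + 2) := by rw [hp]; push_cast; rfl
    have hp1 : 1 ≤ p := by
      rw [← NNReal.coe_le_coe, hpr, NNReal.coe_one, le_div_iff₀ (by linarith)]
      linarith
    have hp2 : (p : ℝ) < 2 := by
      rw [hpr, div_lt_iff₀ (by linarith)]
      linarith
    have hμ : μ (closure s) ≠ ⊤ := hs.closure.measure_lt_top.ne
    refine ⟨eLpNormLESNormFDerivOfLeConst ℝ μ s p q *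
      (μ (closure s) ^ (1 / (p : ℝ≥0∞).toReal - 1 / (2 : ℝ≥0∞).toReal)).toNNReal,
      fun u hu hus => ?_⟩
    have key := eLpNorm_le_eLpNorm_fderiv_of_le (F := ℝ) μ hu hus (p := p) (q := q) hp1
      (by rw [← h2]; exact_mod_cast hp2) (by
        rw [← h2, NNReal.coe_inv, hpr]
        have h1 : (m : ℝ)⁻¹ ≤ (q : ℝ)⁻¹ := inv_anti₀ hq0 hmq
        have h3 : (2 * (m : ℝ) / (m + 2))⁻¹ - ((2 : ℕ) : ℝ)⁻¹ = (m : ℝ)⁻¹ := by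
          have : (m : ℝ) ≠ 0 := by linarith
          have : (m : ℝ) + 2 ≠ 0 := by linarith
          push_cast
          field_simp
          ring
        rw [h3]; exact h1) hs
    have hold := eLpNorm_le_mul_of_support_subset (μ := μ) (p := (p : ℝ≥0∞)) (q := 2)
      ((hu.continuous_fderiv one_ne_zero).aestronglyMeasurable)
      (support_fderiv_subset_closure hus) (by
        have : p ≤ 2 := by exact_mod_cast hp2.le
        exact_mod_cast this)
    have hexp : (0 : ℝ) ≤ 1 / (p : ℝ≥0∞).toReal - 1 / (2 : ℝ≥0∞).toReal := by
      simp only [ENNReal.coe_toReal, ENNReal.toReal_ofNat, sub_nonneg]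
      have hp0 : (0 : ℝ) < p := lt_of_lt_of_le one_pos (by exact_mod_cast hp1)
      exact one_div_le_one_div_of_le hp0 hp2.le
    rw [ENNReal.coe_mul, ENNReal.coe_toNNReal (ENNReal.rpow_ne_top_of_nonneg hexp hμ), mul_assoc]
    refine key.trans (mul_le_mul_right (hold.trans_eq (mul_comm _ _)) _)
  · refine ⟨eLpNormLESNormFDerivOfLeConst ℝ μ s 2 q, fun u hu hus => ?_⟩
    refine eLpNorm_le_eLpNorm_fderiv_of_le (F := ℝ) μ hu hus (p := 2) (q := q) one_le_two
      (by exact_mod_cast h3) ?_ hs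
    have := hqn h3
    simpa using this

/-- The fundamental theorem of calculus on a half-line, transported along a linear isometry from ℝ.
-/
theorem enorm_le_lintegral_fderiv_of_dim_one {u : Space 1 → ℝ} (hu : ContDiff ℝ 1 u)
    (hc : HasCompactSupport u) (x : Space 1) : ‖u x‖ₑ ≤ ∫⁻ y, ‖fderiv ℝ u y‖ₑ := by
  let ℓ : ℝ ≃ₗᵢ[ℝ] Space 1 := (stdOrthonormalBasis ℝ ℝ).equiv (stdOrthonormalBasis ℝ (Space 1))
    (finCongr (by simp))
  have h1 : ContDiff ℝ 1 (u ∘ ℓ) := hu.comp ℓ.contDiff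
  have h2 : HasCompactSupport (u ∘ ℓ) := hc.comp_homeomorph ℓ.toHomeomorph
  have h3 := h2.enorm_le_lintegral_Ici_deriv h1 (ℓ.symm x)
  simp only [Function.comp_apply, LinearIsometryEquiv.apply_symm_apply] at h3
  have hd : ∀ y, ‖deriv (u ∘ ℓ) y‖ₑ ≤ ‖fderiv ℝ u (ℓ y)‖ₑ := by
    intro y
    have h4 : HasDerivAt (u ∘ ℓ) (fderiv ℝ u (ℓ y) (ℓ 1)) y := by
      have h5 := (hu.differentiable one_ne_zero (ℓ y)).hasFDerivAt.comp_hasDerivAt y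
        (ℓ.toContinuousLinearEquiv.hasFDerivAt.hasDerivAt)
      simpa using h5
    rw [h4.deriv, enorm_le_iff_norm_le]
    refine ((fderiv ℝ u (ℓ y)).le_opNorm _).trans (le_of_eq ?_)
    rw [ℓ.norm_map]; simp
  refine h3.trans ((lintegral_mono hd).trans ((setLIntegral_le_lintegral _ _).trans ?_))
  rw [ℓ.measurePreserving.lintegral_comp_emb ℓ.toHomeomorph.measurableEmbedding
    (fun y => ‖fderiv ℝ u y‖ₑ)]

/-- In one dimension the supremum is bounded by the L¹ norm of the derivative. The bounded support
lets Hölder pass from L^∞ to L^q on one side and from L² to L¹ on the other. -/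
theorem exists_sobolev_of_dim_one {s : Set (Space 1)} (hs : Bornology.IsBounded s) (q : ℝ≥0) :
    ∃ C : ℝ≥0, ∀ u : Space 1 → ℝ, ContDiff ℝ 1 u → Function.support u ⊆ s →
      eLpNorm u q volume ≤ C * eLpNorm (fderiv ℝ u) 2 volume := by
  have hm : volume (closure s) ≠ ⊤ := hs.closure.measure_lt_top.ne
  have hm' : volume s ≠ ⊤ := hs.measure_lt_top.ne
  refine ⟨(volume (closure s) ^ (1 / 2 : ℝ)).toNNReal * (volume s ^ (1 / (q : ℝ))).toNNReal,
    fun u hu hus => ?_⟩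
  have hc : HasCompactSupport u := HasCompactSupport.of_support_subset_isCompact
    hs.isCompact_closure (hus.trans subset_closure)
  have h1 := eLpNorm_le_mul_of_support_subset (μ := volume) (p := (q : ℝ≥0∞)) (q := ⊤)
    hu.continuous.aestronglyMeasurable hus le_top
  have h2 := eLpNorm_le_mul_of_support_subset (μ := volume) (p := 1) (q := 2)
    (hu.continuous_fderiv one_ne_zero).aestronglyMeasurable
    (support_fderiv_subset_closure hus) (by norm_num)
  have h3 : eLpNorm u ⊤ volume ≤ eLpNorm (fderiv ℝ u) 1 volume := by
    rw [eLpNorm_exponent_top, eLpNorm_one_eq_lintegral_enorm]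
    exact essSup_le_of_ae_le _ (.of_forall fun x => enorm_le_lintegral_fderiv_of_dim_one hu hc x)
  norm_num at h1 h2
  rw [ENNReal.coe_mul, ENNReal.coe_toNNReal (ENNReal.rpow_ne_top_of_nonneg (by norm_num) hm),
    ENNReal.coe_toNNReal (ENNReal.rpow_ne_top_of_nonneg (by positivity) hm')]
  calc _ ≤ _ := h1
    _ ≤ (eLpNorm (fderiv ℝ u) 2 volume * volume (closure s) ^ (1 / 2 : ℝ))
          * volume s ^ ((q : ℝ)⁻¹) := by
        gcongr
        exact h3.trans h2
    _ = _ := by rw [one_div (q : ℝ)]; ring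

variable {N : ℕ}

theorem finrank_space : Module.finrank ℝ (Space N) = N := by simp

theorem exists_sobolev (hN : 1 ≤ N) {s : Set (Space N)} (hs : Bornology.IsBounded s) {q : ℝ≥0}
    (hq : 1 ≤ q) (hqn : 3 ≤ N → (q : ℝ) ≤ 2 * (N : ℝ) / ((N : ℝ) - 2)) :
    ∃ C : ℝ≥0, ∀ u : Space N → ℝ, ContDiff ℝ 1 u → Function.support u ⊆ s →
      eLpNorm u q volume ≤ C * eLpNorm (fderiv ℝ u) 2 volume := by
  rcases hN.eq_or_lt with rfl | hN2
  · exact exists_sobolev_of_dim_one hs q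
  · refine exists_gagliardoNirenbergSobolev volume (by rwa [finrank_space]) hs hq ?_
    rw [finrank_space]
    intro h3
    have h3' : (3 : ℝ) ≤ N := by exact_mod_cast h3
    have hq0 : (0 : ℝ) < q := by exact_mod_cast lt_of_lt_of_le one_pos hq
    have := inv_anti₀ hq0 (hqn h3)
    refine le_trans (le_of_eq ?_) this
    field_simp

theorem norm_le_sum_apply_single (L : Space N →L[ℝ] ℝ) :
    ‖L‖ ≤ ∑ i, |L (EuclideanSpace.single i 1)| := by
  refine L.opNorm_le_bound (Finset.sum_nonneg fun _ _ => abs_nonneg _) fun x => ?_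
  have hx : x = ∑ i, x i • EuclideanSpace.single i (1 : ℝ) := by
    ext j
    simp [Finset.sum_apply, Pi.single_apply]
  conv_lhs => rw [hx]
  rw [map_sum, Finset.sum_mul]
  refine (norm_sum_le _ _).trans (Finset.sum_le_sum fun i _ => ?_)
  rw [map_smul, smul_eq_mul, norm_mul, mul_comm]
  exact mul_le_mul_of_nonneg_left (PiLp.norm_apply_le x i) (abs_nonneg _)

/-- A smooth cutoff equal to one near the origin. -/
noncomputable def cutoff (N : ℕ) : ContDiffBump (0 : Space N) :=
  ⟨1 / 4, 3 / 8, by norm_num, by norm_num⟩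

theorem cutoff_eq_one {x : Space N} (hx : x ∈ Metric.closedBall (0 : Space N) (1 / 4)) :
    cutoff N x = 1 :=
  (cutoff N).one_of_mem_closedBall hx

theorem cutoff_eq_zero {x : Space N} (hx : x ∉ Metric.closedBall (0 : Space N) (3 / 8)) :
    cutoff N x = 0 := by
  refine (cutoff N).zero_of_le_dist ?_
  simp only [Metric.mem_closedBall, not_le] at hx
  exact hx.le

theorem exists_bound_fderiv_cutoff (N : ℕ) : ∃ K : ℝ≥0, ∀ x, ‖fderiv ℝ (cutoff N) x‖ ≤ K := by
  have hc : Continuous fun x => fderiv ℝ (cutoff N) x :=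
    ((cutoff N).contDiff (n := 1)).continuous_fderiv one_ne_zero
  obtain ⟨C, hC⟩ := hc.bounded_above_of_compact_support ((cutoff N).hasCompactSupport.fderiv ℝ)
  exact ⟨C.toNNReal, fun x => (hC x).trans (Real.le_coe_toNNReal C)⟩

theorem eLpNorm_fderiv_cutoff_mul_le {K : ℝ≥0} (hK : ∀ x, ‖fderiv ℝ (cutoff N) x‖ ≤ K)
    {f : Space N → ℝ} (hf : ContDiff ℝ ∞ f) :
    eLpNorm (fderiv ℝ fun x => cutoff N x * f x) 2 volume
      ≤ K * eLpNorm f 2 (volume.restrict (Metric.closedBall 0 (3 / 8)))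
        + ∑ i, eLpNorm (fun x => fderiv ℝ f x (EuclideanSpace.single i 1)) 2
          (volume.restrict (Metric.closedBall 0 (3 / 8))) := by
  have hsupp : Function.support (fderiv ℝ fun x => cutoff N x * f x)
      ⊆ Metric.closedBall 0 (3 / 8) := by
    have h0 : Function.support (fun x => cutoff N x * f x) ⊆ Metric.closedBall 0 (3 / 8) := by
      intro x hx
      by_contra h
      exact hx (by simp [cutoff_eq_zero h])
    refine (support_fderiv_subset_closure h0).trans ?_
    rw [Metric.isClosed_closedBall.closure_eq]
  have cf : ∀ i, Continuous fun x => fderiv ℝ f x (EuclideanSpace.single i 1) := fun i =>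
    continuous_fderiv_single hf _
  have hres := eLpNorm_restrict_eq_of_support_subset (p := 2) (μ := volume)
    (f := fderiv ℝ fun x => cutoff N x * f x) hsupp
  rw [← hres]
  clear hres
  set μ := (volume : Measure (Space N)).restrict (Metric.closedBall 0 (3 / 8))
  have hpt : ∀ x, ‖fderiv ℝ (fun x => cutoff N x * f x) x‖
      ≤ ‖(K : ℝ) * |f x| + ∑ i, |fderiv ℝ f x (EuclideanSpace.single i 1)|‖ := by
    intro x
    have hnn : 0 ≤ (K : ℝ) * |f x| + ∑ i, |fderiv ℝ f x (EuclideanSpace.single i 1)| := by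
      positivity
    rw [Real.norm_of_nonneg hnn,
      fderiv_fun_mul ((cutoff N).contDiffAt (n := 1) |>.differentiableAt one_ne_zero)
      (hf.differentiable (by simp) x)]
    refine (norm_add_le _ _).trans ?_
    rw [norm_smul, norm_smul, add_comm]
    refine add_le_add ?_ ?_
    · rw [mul_comm]
      exact mul_le_mul_of_nonneg_right (hK x) (norm_nonneg _)
    · rw [Real.norm_of_nonneg (cutoff N).nonneg]
      refine le_trans ?_ (norm_le_sum_apply_single _)
      exact mul_le_of_le_one_left (norm_nonneg _) (cutoff N).le_one
  refine (eLpNorm_mono hpt).trans ((eLpNorm_add_le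
    ((continuous_const.mul hf.continuous.abs).aestronglyMeasurable)
    (continuous_finsetSum _ fun i _ => (cf i).abs).aestronglyMeasurable (by norm_num)).trans ?_)
  refine add_le_add ?_ ?_
  · refine (eLpNorm_const_smul_le (c := (K : ℝ)) (f := fun x => |f x|)).trans (le_of_eq ?_)
    have : eLpNorm (fun x => |f x|) 2 μ = eLpNorm f 2 μ := eLpNorm_norm f
    rw [this]
    simp
  · have e : (fun x => ∑ i, |fderiv ℝ f x (EuclideanSpace.single i 1)|)
        = ∑ i, fun x => |fderiv ℝ f x (EuclideanSpace.single i 1)| := by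
      funext x; simp
    rw [e]
    refine (eLpNorm_sum_le (fun i _ => (cf i).abs.aestronglyMeasurable) (by norm_num)).trans ?_
    exact Finset.sum_le_sum fun i _ =>
      (eLpNorm_norm (fun x => fderiv ℝ f x (EuclideanSpace.single i 1))).le

/-- Interior Sobolev embedding on balls for weakly differentiable functions. -/
theorem exists_sobolev_local (hN : 1 ≤ N) {q : ℝ≥0} (hq : 1 ≤ q)
    (hqn : 3 ≤ N → (q : ℝ) ≤ 2 * (N : ℝ) / ((N : ℝ) - 2)) :
    ∃ C : ℝ≥0, ∀ (f : Space N → ℝ) (g : Fin N → Space N → ℝ), (∀ i, HasWeakPartial i f (g i)) →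
      eLpNorm f q (volume.restrict (Metric.closedBall 0 (1 / 4))) ≤
        C * (eLpNorm f 2 (volume.restrict (Metric.closedBall 0 (1 / 2)))
          + ∑ i, eLpNorm (g i) 2 (volume.restrict (Metric.closedBall 0 (1 / 2)))) := by
  obtain ⟨C, hC⟩ := exists_sobolev hN (s := Metric.closedBall (0 : Space N) (3 / 8))
    Metric.isBounded_closedBall hq hqn
  obtain ⟨K, hK⟩ := exists_bound_fderiv_cutoff N
  obtain ⟨φ, hφ1, hφ2, hφ3⟩ := exists_bumps N
  refine ⟨C * (K + 1), fun f g hfg => ?_⟩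
  have hfl : LocallyIntegrable f := (hfg ⟨0, hN⟩).1
  have hconv : ∀ᵐ x ∂(volume.restrict (Metric.closedBall (0 : Space N) (1 / 4))),
      Tendsto (fun n => moll (φ n) f x) atTop (𝓝 (f x)) :=
    ae_restrict_of_ae (ContDiffBump.ae_convolution_tendsto_right_of_locallyIntegrable hφ3
      (.of_forall hφ1) hfl)
  -- Norms are lower semicontinuous along the almost everywhere convergent mollifications, so a
  -- bound uniform in n for the smooth approximants suffices.
  refine (Lp.eLpNorm_lim_le_liminf_eLpNorm
    (fun n => (contDiff_moll (φ n) hfl).continuous.aestronglyMeasurable) f hconv).trans ?_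
  refine liminf_le_of_le (by isBoundedDefault) fun b hb => ?_
  obtain ⟨n, hn⟩ := hb.exists
  refine hn.trans ?_
  have hm := contDiff_moll (φ n) hfl
  -- The cutoff lives in radius 3/8 and mollification widens this by at most 1/8, whence the half
  -- ball in the estimate.
  have hrad : (3 / 8 : ℝ) + (φ n).rOut ≤ 1 / 2 := by linarith [hφ2 n]
  have h1 : eLpNorm (moll (φ n) f) q (volume.restrict (Metric.closedBall 0 (1 / 4)))
      ≤ eLpNorm (fun x => cutoff N x * moll (φ n) f x) q volume := by
    refine le_trans (le_of_eq (eLpNorm_congr_ae ?_)) (eLpNorm_mono_measure _ Measure.restrict_le_self)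
    refine (ae_restrict_iff' Metric.isClosed_closedBall.measurableSet).2 (.of_forall fun x hx => ?_)
    simp [cutoff_eq_one hx]
  have h2 := hC (fun x => cutoff N x * moll (φ n) f x)
    (((cutoff N).contDiff).mul (hm.of_le (by simp))) (by
      intro x hx
      by_contra h
      exact hx (by simp [cutoff_eq_zero h]))
  refine h1.trans (h2.trans ?_)
  have h3 := eLpNorm_fderiv_cutoff_mul_le hK hm
  have h4 : ∀ i, (fun x => fderiv ℝ (moll (φ n) f) x (EuclideanSpace.single i 1))
      = moll (φ n) (g i) := fun i => funext fun x => fderiv_moll (φ n) (hfg i) x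
  simp only [h4] at h3
  have h5 := eLpNorm_moll_le (φ n) hfl.aestronglyMeasurable _ _ hrad 0
  have h6 := fun i => eLpNorm_moll_le (φ n) (hfg i).2.1.aestronglyMeasurable _ _ hrad 0
  rw [ENNReal.coe_mul, mul_assoc]
  refine mul_le_mul_right (h3.trans ?_) _
  calc _ ≤ (K : ℝ≥0∞) * eLpNorm f 2 (volume.restrict (Metric.closedBall 0 (1 / 2)))
        + 1 * ∑ i, eLpNorm (g i) 2 (volume.restrict (Metric.closedBall 0 (1 / 2))) := by
        rw [one_mul]
        exact add_le_add (mul_le_mul_right h5 _) (Finset.sum_le_sum fun i _ => h6 i)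
    _ ≤ _ := by
        push_cast
        rw [mul_add]
        exact add_le_add (mul_le_mul_left (by simp) _) (mul_le_mul_left (by simp) _)

end Sobolev

/-! ### Passing from small balls to the unit ball by finite covers. -/

section Covering

variable {N : ℕ}

theorem exists_finset_cover (R : ℝ) {r : ℝ} (hr : 0 < r) : ∃ F : Finset (Space N),
    (∀ y ∈ F, y ∈ Metric.closedBall (0 : Space N) R) ∧
      Metric.closedBall (0 : Space N) R ⊆ ⋃ y ∈ F, Metric.closedBall y r := by
  obtain ⟨t, ht, hc⟩ := (isCompact_closedBall (0 : Space N) R).elim_nhds_subcover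
    (fun y => Metric.closedBall y r) (fun y _ => Metric.closedBall_mem_nhds y hr)
  exact ⟨t, ht, hc⟩

theorem eLpNorm_restrict_le_sum {f : Space N → ℝ} (hf : AEStronglyMeasurable f volume)
    {q : ℝ≥0∞} (hq : 1 ≤ q) {K : Set (Space N)} (hK : MeasurableSet K) {F : Finset (Space N)}
    {r : ℝ} (hc : K ⊆ ⋃ y ∈ F, Metric.closedBall y r) :
    eLpNorm f q (volume.restrict K)
      ≤ ∑ y ∈ F, eLpNorm f q (volume.restrict (Metric.closedBall y r)) := by
  have hm : ∀ y : Space N, MeasurableSet (Metric.closedBall y r) := fun y =>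
    Metric.isClosed_closedBall.measurableSet
  rw [← eLpNorm_indicator_eq_eLpNorm_restrict hK]
  simp only [← eLpNorm_indicator_eq_eLpNorm_restrict (hm _)]
  have h1 : eLpNorm (K.indicator f) q volume
      ≤ eLpNorm (∑ y ∈ F, fun x => ‖(Metric.closedBall y r).indicator f x‖) q volume := by
    refine eLpNorm_mono fun x => ?_
    rw [Finset.sum_apply, Real.norm_of_nonneg (Finset.sum_nonneg fun _ _ => norm_nonneg _)]
    by_cases hx : x ∈ K
    · obtain ⟨y, hy, hxy⟩ := mem_iUnion₂.1 (hc hx)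
      rw [indicator_of_mem hx]
      refine le_trans (le_of_eq ?_) (Finset.single_le_sum
        (f := fun y => ‖(Metric.closedBall y r).indicator f x‖) (fun _ _ => norm_nonneg _) hy)
      rw [indicator_of_mem hxy]
    · rw [indicator_of_notMem hx, norm_zero]
      exact Finset.sum_nonneg fun _ _ => norm_nonneg _
  refine h1.trans ((eLpNorm_sum_le (fun y _ => (hf.indicator (hm y)).norm) hq).trans ?_)
  exact Finset.sum_le_sum fun y _ => (eLpNorm_norm _).le

theorem memLp_of_forall_ball {f : Space N → ℝ} (hf : AEStronglyMeasurable f volume)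
    {q : ℝ≥0∞} (hq : 1 ≤ q) (h : ∀ x, eLpNorm f q (volume.restrict (ball1 x)) < ⊤) (R : ℝ) :
    MemLp f q (volume.restrict (Metric.closedBall (0 : Space N) R)) := by
  obtain ⟨F, -, hF⟩ := exists_finset_cover (N := N) R one_pos
  refine ⟨hf.restrict, (eLpNorm_restrict_le_sum hf hq
    Metric.isClosed_closedBall.measurableSet hF).trans_lt ?_⟩
  exact ENNReal.sum_lt_top.2 fun y _ => h y

theorem WeaklyDiff.aesm {k : ℕ} {f : Space N → ℝ} (h : WeaklyDiff k f) :
    AEStronglyMeasurable f volume := by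
  cases k with
  | zero => exact h
  | succ k => exact h.1

theorem eLpNorm_le_sobolevNorm (q : ℝ≥0∞) (s : Set (Space N)) (k : ℕ) (f : Space N → ℝ) :
    eLpNorm f q (volume.restrict s) ≤ sobolevNorm q s k f := by
  cases k with
  | zero => exact le_rfl
  | succ k => exact le_self_add

theorem sobolevNorm_weakPartial_le (q : ℝ≥0∞) (s : Set (Space N)) (k : ℕ) (f : Space N → ℝ)
    (i : Fin N) : sobolevNorm q s k (weakPartial i f) ≤ sobolevNorm q s (k + 1) f :=
  (Finset.single_le_sum (f := fun i => sobolevNorm q s k (weakPartial i f)) (fun _ _ => zero_le)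
    (Finset.mem_univ i)).trans le_add_self

theorem MemUloc.weakPartial {q : ℝ≥0∞} {k : ℕ} {f : Space N → ℝ} (h : MemUloc q (k + 1) f)
    (i : Fin N) : MemUloc q k (weakPartial i f) :=
  ⟨(h.1.2 i).2, (iSup_mono fun _ => sobolevNorm_weakPartial_le _ _ _ _ _).trans_lt h.2⟩

theorem MemUloc.hasWeakPartial {q : ℝ≥0∞} {k : ℕ} {f : Space N → ℝ} (h : MemUloc q (k + 1) f)
    (i : Fin N) : HasWeakPartial i f (VelocityWave.weakPartial i f) :=
  (h.1.2 i).1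

theorem MemUloc.memLp {q : ℝ≥0∞} (hq : 1 ≤ q) {k : ℕ} {f : Space N → ℝ} (h : MemUloc q k f)
    (R : ℝ) : MemLp f q (volume.restrict (Metric.closedBall (0 : Space N) R)) :=
  memLp_of_forall_ball h.1.aesm hq (fun x => ((eLpNorm_le_sobolevNorm q _ k f).trans
    (le_iSup (fun x => sobolevNorm q (ball1 x) k f) x)).trans_lt h.2) R

theorem MemUloc.weakLaplacian_memLp {f : Space N → ℝ} (h : MemUloc 2 2 f) :
    MemLp (weakLaplacian f) 2 (ballMeasure N) := by
  have : weakLaplacian f = ∑ i, VelocityWave.weakPartial i (VelocityWave.weakPartial i f) := by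
    funext x; simp [weakLaplacian]
  rw [this]
  exact memLp_finsetSum' _ fun i _ => ((h.weakPartial i).weakPartial i).memLp one_le_two 1

/-- Sobolev embedding on the unit ball by covering with small balls. -/
theorem exists_sobolev_ball (hN : 1 ≤ N) {q : ℝ≥0} (hq : 1 ≤ q)
    (hqn : 3 ≤ N → (q : ℝ) ≤ 2 * (N : ℝ) / ((N : ℝ) - 2)) :
    ∃ (C : ℝ≥0) (F : Finset (Space N)), ∀ f : Space N → ℝ, WeaklyDiff 1 f →
      eLpNorm f q (ballMeasure N) ≤ C * ∑ y ∈ F, sobolevNorm 2 (ball1 y) 1 f := by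
  obtain ⟨C, hC⟩ := exists_sobolev_local hN hq hqn
  obtain ⟨F, -, hF⟩ := exists_finset_cover (N := N) 1 (r := 1 / 4) (by norm_num)
  refine ⟨C, F, fun f hf => ?_⟩
  refine (eLpNorm_restrict_le_sum hf.1 (by exact_mod_cast hq)
    Metric.isClosed_closedBall.measurableSet hF).trans ?_
  rw [Finset.mul_sum]
  refine Finset.sum_le_sum fun y _ => ?_
  have h1 := hC (shift y f) (fun i => weakPartial i (shift y f))
    (fun i => ((hf.shift y).2 i).1)
  rw [eLpNorm_shift, add_zero] at h1
  refine h1.trans (mul_le_mul_right ?_ _)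
  have h2 : sobolevNorm 2 (Metric.closedBall 0 1) 1 (shift y f) = sobolevNorm 2 (ball1 y) 1 f := by
    rw [sobolevNorm_shift, add_zero]
  rw [← h2]
  have hle : (volume : Measure (Space N)).restrict (Metric.closedBall 0 (1 / 2))
      ≤ volume.restrict (Metric.closedBall 0 1) :=
    Measure.restrict_mono (Metric.closedBall_subset_closedBall (by norm_num)) le_rfl
  exact add_le_add (eLpNorm_mono_measure _ hle)
    (Finset.sum_le_sum fun i _ => eLpNorm_mono_measure _ hle)

end Covering

/-! ### Curves in L²(B): from distributional to strong time derivatives. -/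

section Curves

variable {N : ℕ}

theorem inner_toL2 {f g : Space N → ℝ} (hf : MemLp f 2 (ballMeasure N))
    (hg : MemLp g 2 (ballMeasure N)) :
    inner ℝ (toL2 f) (toL2 g) = ∫ z in ball1 (0 : Space N), f z * g z := by
  rw [L2.inner_def]
  refine integral_congr_ae ?_
  filter_upwards [coeFn_toL2 hf, coeFn_toL2 hg] with z h1 h2
  rw [h1, h2]
  simp [mul_comm]

theorem inner_toL2_test {f φ : Space N → ℝ} (hf : MemLp f 2 (ballMeasure N)) (hφ : Continuous φ)
    (hs : tsupport φ ⊆ Metric.ball 0 1) :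
    inner ℝ (toL2 f) (toL2 φ) = ∫ z, f z * φ z := by
  rw [inner_toL2 hf (memLp_ball_of_continuous hφ)]
  refine setIntegral_eq_integral_of_forall_compl_eq_zero fun x hx => ?_
  have : φ x = 0 := by
    by_contra h
    exact hx (Metric.ball_subset_closedBall (hs (subset_tsupport φ h)))
  rw [this, mul_zero]

instance : IsFiniteMeasure (ballMeasure N) :=
  ⟨by rw [Measure.restrict_apply_univ]; exact measure_closedBall_lt_top⟩

/-- Test functions supported in the open ball detect f up to a null set there, and the boundary
sphere has measure zero. -/
theorem eq_zero_of_inner_test_eq_zero {f : BallL2 N}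
    (h : ∀ φ : Space N → ℝ, ContDiff ℝ ∞ φ → HasCompactSupport φ → tsupport φ ⊆ Metric.ball 0 1 →
      inner ℝ f (toL2 φ) = 0) : f = 0 := by
  have hint : IntegrableOn f (ball1 (0 : Space N)) := (Lp.memLp f).integrable one_le_two
  have key := Metric.isOpen_ball.ae_eq_zero_of_integral_contDiff_smul_eq_zero
    (U := Metric.ball (0 : Space N) 1) (f := f) (μ := volume)
    ((hint.mono_set Metric.ball_subset_closedBall).locallyIntegrableOn) (by
      intro φ hφ hc hs
      rw [← h φ hφ hc hs]
      have hff : toL2 f = f := by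
        rw [toL2, dif_pos (Lp.memLp f)]
        exact Lp.toLp_coeFn f _
      conv_rhs => rw [← hff]
      rw [inner_toL2_test (Lp.memLp f) hφ.continuous hs]
      simp [mul_comm])
  refine Lp.ext ?_
  have hsph : ∀ᵐ x : Space N, x ∉ Metric.sphere (0 : Space N) 1 :=
    measure_eq_zero_iff_ae_notMem.1 (Measure.addHaar_sphere_of_ne_zero volume 0 one_ne_zero)
  have h2 : ∀ᵐ x ∂(ballMeasure N), f x = 0 := by
    rw [ae_restrict_iff' Metric.isClosed_closedBall.measurableSet]
    filter_upwards [key, hsph] with x h1 h2 h3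
    refine h1 ?_
    simp only [Metric.mem_sphere, Metric.mem_ball, Metric.mem_closedBall] at *
    exact lt_of_le_of_ne h3 h2
  filter_upwards [h2, Lp.coeFn_zero ℝ 2 (ballMeasure N)] with x h1 h2
  rw [h1, h2]
  rfl

/-- A continuous curve in `L²(B)` whose distributional time derivative is continuous is
differentiable. -/
theorem hasDerivAt_of_weak {X Y : ℝ → BallL2 N} {T : ℝ} (hX : ContinuousOn X (Ico 0 T))
    (hY : ContinuousOn Y (Ico 0 T))
    (h : ∀ φ : Space N → ℝ, ContDiff ℝ ∞ φ → HasCompactSupport φ → tsupport φ ⊆ Metric.ball 0 1 →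
      ∀ t ∈ Ico 0 T, HasDerivWithinAt (fun τ => inner ℝ (X τ) (toL2 φ)) (inner ℝ (Y t) (toL2 φ))
        (Ico 0 T) t) {t : ℝ} (ht : t ∈ Ioo 0 T) : HasDerivAt X (Y t) t := by
  obtain ⟨τ, htτ, hτT⟩ := exists_between ht.2
  have hτ0 : 0 ≤ τ := (ht.1.trans htτ).le
  have hsub : Icc 0 τ ⊆ Ico 0 T := fun x hx => ⟨hx.1, hx.2.trans_lt hτT⟩
  -- Extending the derivative by constants outside [0, τ] gives a continuous curve on ℝ, whose
  -- primitive is differentiable everywhere.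
  set Y' : ℝ → BallL2 N := IccExtend hτ0 ((Icc 0 τ).domRestrict Y) with hY'
  have hYc : Continuous Y' := (hY.mono hsub).domRestrict.Icc_extend'
  have hYe : ∀ x ∈ Icc 0 τ, Y' x = Y x := fun x hx => by
    rw [hY', IccExtend_of_mem _ _ hx]; rfl
  set Z : ℝ → BallL2 N := fun x => X 0 + ∫ y in (0 : ℝ)..x, Y' y with hZ
  have hZd : ∀ x, HasDerivAt Z (Y' x) x := fun x =>
    (intervalIntegral.integral_hasDerivAt_right (hYc.intervalIntegrable _ _)
      (hYc.stronglyMeasurableAtFilter _ _) hYc.continuousAt).const_add _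
  -- Against each test function X - Z has vanishing right derivative and starts at zero, so X agrees
  -- with the primitive Z on [0, τ].
  have hXZ : ∀ x ∈ Icc 0 τ, X x = Z x := by
    intro x hx
    rw [← sub_eq_zero]
    refine eq_zero_of_inner_test_eq_zero fun φ hφ hc hs => ?_
    have hd : ∀ y ∈ Ico 0 τ, HasDerivWithinAt (fun y => inner ℝ (X y - Z y) (toL2 φ)) 0
        (Ici y) y := by
      intro y hy
      have hy' : y ∈ Icc 0 τ := ⟨hy.1, hy.2.le⟩
      have hmem : Ico 0 T ∈ 𝓝[Ici y] y :=
        mem_of_superset (Ico_mem_nhdsGE (hsub hy').2) (Ico_subset_Ico_left hy.1)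
      have h1 : HasDerivWithinAt (fun τ => inner ℝ (X τ) (toL2 φ)) (inner ℝ (Y y) (toL2 φ))
          (Ici y) y := (h φ hφ hc hs y (hsub hy')).mono_of_mem_nhdsWithin hmem
      have h2 : HasDerivAt (fun y => inner ℝ (Z y) (toL2 φ)) (inner ℝ (Y' y) (toL2 φ)) y := by
        simpa using (hZd y).inner ℝ (hasDerivAt_const y (toL2 φ))
      have h3 := h1.sub h2.hasDerivWithinAt
      rw [hYe y hy', sub_self] at h3
      refine h3.congr_of_mem (fun z _ => ?_) self_mem_Ici
      simp [inner_sub_left]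
    have hcont : ContinuousOn (fun y => inner ℝ (X y - Z y) (toL2 φ)) (Icc 0 τ) :=
      ((hX.mono hsub).sub fun y _ => (hZd y).continuousAt.continuousWithinAt).inner
        continuousOn_const
    have := constant_of_has_deriv_right_zero hcont hd x hx
    rw [this]
    simp [hZ]
  have hev : X =ᶠ[𝓝 t] Z := by
    filter_upwards [Icc_mem_nhds ht.1 htτ] with x hx using hXZ x hx
  have := (hZd t).congr_of_eventuallyEq hev
  rwa [hYe t ⟨ht.1.le, htτ.le⟩] at this

end Curves

/-! ### The nonlinearity: convexity, and continuity from L^{2p} to L². -/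

section Nonlinearity

/-- The nonlinearity `y ↦ y|y|^{p-1}`. -/
noncomputable def nl (p y : ℝ) : ℝ := y * |y| ^ (p - 1)

theorem nl_eq_posPow {p : ℝ} (hp : 1 < p) (y : ℝ) : nl p y = posPow p y - posPow p (-y) := by
  have hm : ∀ x : ℝ, 0 < x → x * x ^ (p - 1) = x ^ p := fun x hx => by
    rw [← Real.rpow_one_add' hx.le (by linarith)]
    ring_nf
  have h0 : (0 : ℝ) ^ p = 0 := Real.zero_rpow (by linarith)
  rcases lt_trichotomy y 0 with hy | rfl | hy
  · rw [nl, posPow, posPow, max_eq_right hy.le, max_eq_left (by linarith), abs_of_neg hy, h0,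
      ← hm (-y) (by linarith)]
    ring
  · simp [nl, posPow]
  · rw [nl, posPow, posPow, max_eq_left hy.le, max_eq_right (by linarith), abs_of_pos hy, h0,
      hm y hy]
    ring

theorem hasDerivAt_nl {p : ℝ} (hp : 1 < p) (y : ℝ) :
    HasDerivAt (nl p) (p * (posPow (p - 1) y + posPow (p - 1) (-y))) y := by
  have e : nl p = fun y => posPow p y - posPow p (-y) := funext (nl_eq_posPow hp)
  rw [e]
  have h2 : HasDerivAt (fun y => posPow p (-y)) (p * posPow (p - 1) (-y) * -1) y :=
    (hasDerivAt_posPow hp (-y)).comp y (hasDerivAt_neg y)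
  have h3 := (hasDerivAt_posPow hp y).sub h2
  rw [mul_neg_one, sub_neg_eq_add, ← mul_add] at h3
  exact h3

theorem continuous_nl {p : ℝ} (hp : 1 < p) : Continuous (nl p) :=
  continuous_iff_continuousAt.2 fun y => (hasDerivAt_nl hp y).continuousAt

theorem abs_nl_sub_le {p : ℝ} (hp : 1 < p) (a b : ℝ) :
    |nl p a - nl p b| ≤ p * ((|a| + |b|) ^ (p - 1) * |a - b|) := by
  set m := |a| + |b| with hm
  have hm0 : 0 ≤ m := by positivity
  have key := (convex_Icc (-m) m).norm_image_sub_le_of_norm_hasDerivWithin_le (f := nl p)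
    (C := p * m ^ (p - 1)) (x := b) (y := a)
    (fun y _ => (hasDerivAt_nl hp y).hasDerivWithinAt) (fun y hy => ?_)
    (abs_le.1 (by simp [hm])) (abs_le.1 (by simp [hm]))
  · simpa [mul_assoc] using key
  · have h0 : (0 : ℝ) ^ (p - 1) = 0 := Real.zero_rpow (by linarith)
    have h1 : posPow (p - 1) y + posPow (p - 1) (-y) ≤ m ^ (p - 1) := by
      rcases le_total y 0 with h | h
      · rw [posPow, posPow, max_eq_right h, max_eq_left (by linarith), h0, zero_add]
        exact Real.rpow_le_rpow (by linarith) (by linarith [hy.1]) (by linarith)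
      · rw [posPow, posPow, max_eq_left h, max_eq_right (by linarith), h0, add_zero]
        exact Real.rpow_le_rpow h hy.2 (by linarith)
    have h2 : 0 ≤ posPow (p - 1) y + posPow (p - 1) (-y) :=
      add_nonneg (Real.rpow_nonneg (le_max_right _ _) _) (Real.rpow_nonneg (le_max_right _ _) _)
    rw [Real.norm_of_nonneg (by positivity)]
    exact mul_le_mul_of_nonneg_left h1 (by linarith)

theorem nl_mul_self {p : ℝ} (hp : 1 < p) (a : ℝ) : nl p a * a = |a| ^ (p + 1) := by
  have h : |a| ^ (p + 1) = |a| ^ (p - 1) * |a| ^ (2 : ℕ) := by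
    rw [← Real.rpow_natCast, ← Real.rpow_add_of_nonneg (abs_nonneg a) (by linarith) (by norm_num)]
    norm_num
    ring_nf
  rw [h, sq_abs, nl]
  ring

theorem abs_nl {p : ℝ} (hp : 1 < p) (a : ℝ) : |nl p a| = |a| ^ p := by
  rw [nl, abs_mul, abs_of_nonneg (Real.rpow_nonneg (abs_nonneg a) _),
    ← Real.rpow_one_add' (abs_nonneg a) (by linarith)]
  ring_nf

/-- The tangent-line inequality for the convex function |·|^{p+1}, deduced from Young's inequality
with exponents (p+1)/p and p+1. It replaces a chain rule when the potential energy is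
differentiated. -/
theorem nl_mul_sub_le {p : ℝ} (hp : 1 < p) (a b : ℝ) :
    (p + 1) * (nl p a * (b - a)) ≤ nl p b * b - nl p a * a := by
  have hp0 : p ≠ 0 := by linarith
  have hp1 : p + 1 ≠ 0 := by linarith
  have hconj : ((p + 1) / p).HolderConjugate (p + 1) := by
    rw [Real.holderConjugate_iff]
    refine ⟨by rw [lt_div_iff₀ (by linarith)]; linarith, ?_⟩
    field_simp
  have hy := Real.young_inequality_of_nonneg (Real.rpow_nonneg (abs_nonneg a) p) (abs_nonneg b)
    hconj
  rw [← Real.rpow_mul (abs_nonneg a), mul_div_cancel₀ _ hp0] at hy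
  have h1 : nl p a * b ≤ |a| ^ p * |b| := by
    rw [← abs_nl hp, ← abs_mul]; exact le_abs_self _
  have h2 := h1.trans hy
  have h3 : (p + 1) * (nl p a * b) ≤ p * |a| ^ (p + 1) + |b| ^ (p + 1) := by
    have := mul_le_mul_of_nonneg_left h2 (by linarith : 0 ≤ p + 1)
    refine this.trans (le_of_eq ?_)
    field_simp
  have e : (p + 1) * (nl p a * (b - a)) = (p + 1) * (nl p a * b) - (p + 1) * (nl p a * a) := by ring
  rw [e, nl_mul_self hp, nl_mul_self hp]
  linarith

theorem nl_const_mul {p c : ℝ} (hp : 1 < p) (hc : 0 < c) (y : ℝ) : nl p (c * y) = c ^ p * nl p y := by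
  rw [nl, nl, abs_mul, abs_of_pos hc, Real.mul_rpow hc.le (abs_nonneg y)]
  have : c ^ p = c * c ^ (p - 1) := by
    rw [← Real.rpow_one_add' hc.le (by linarith)]; ring_nf
  rw [this]; ring

variable {Ω : Type*} [MeasurableSpace Ω] {μ : Measure Ω}

/-- The mean value bound is combined with Hölder for 1/2 = (p-1)/(2p) + 1/(2p). This singles out
L^{2p} as the space where the solution must be continuous in time. -/
theorem eLpNorm_nl_sub_le {p : ℝ} (hp : 1 < p) {f g : Ω → ℝ} (hf : AEStronglyMeasurable f μ)
    (hg : AEStronglyMeasurable g μ) :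
    eLpNorm (fun x => nl p (f x) - nl p (g x)) 2 μ ≤
      ENNReal.ofReal p * ((eLpNorm f (ENNReal.ofReal (2 * p)) μ
        + eLpNorm g (ENNReal.ofReal (2 * p)) μ) ^ (p - 1)
          * eLpNorm (f - g) (ENNReal.ofReal (2 * p)) μ) := by
  have hp1 : 0 < p - 1 := by linarith
  set A : Ω → ℝ := fun x => |f x| + |g x| with hA
  have hAm : AEStronglyMeasurable A μ := hf.norm.add hg.norm
  have h1 : eLpNorm (fun x => nl p (f x) - nl p (g x)) 2 μ
      ≤ ENNReal.ofReal p * eLpNorm (fun x => ‖A x‖ ^ (p - 1) * ‖(f - g) x‖) 2 μ := by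
    have := eLpNorm_le_mul_eLpNorm_of_ae_le_mul (μ := μ) (p := 2)
      (f := fun x => nl p (f x) - nl p (g x)) (g := fun x => ‖A x‖ ^ (p - 1) * ‖(f - g) x‖)
      (c := p) (.of_forall fun x => by
        have := abs_nl_sub_le hp (f x) (g x)
        have hA0 : 0 ≤ A x := by positivity
        rw [Real.norm_of_nonneg (by positivity : (0:ℝ) ≤ ‖A x‖ ^ (p - 1) * ‖(f - g) x‖),
          Real.norm_of_nonneg hA0]
        exact this)
    exact this
  refine h1.trans (mul_le_mul_right ?_ _)
  have htri : Real.HolderTriple (2 * p / (p - 1)) (2 * p) 2 :=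
    ⟨by field_simp; ring, by positivity, by linarith⟩
  have htri' : ENNReal.HolderTriple (ENNReal.ofReal (2 * p / (p - 1))) (ENNReal.ofReal (2 * p)) 2 := by
    have := htri.toNNReal.coe_ennreal (by simp)
    have e : ((Real.toNNReal 2 : ℝ≥0) : ℝ≥0∞) = 2 := by simp
    rw [e] at this
    exact this
  have h2 := eLpNorm_smul_le_mul_eLpNorm (μ := μ) (p := ENNReal.ofReal (2 * p / (p - 1)))
    (q := ENNReal.ofReal (2 * p)) (r := 2) (f := fun x => ‖(f - g) x‖)
    (φ := fun x => ‖A x‖ ^ (p - 1)) (hf.sub hg).norm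
    ((Real.continuous_rpow_const hp1.le).comp_aestronglyMeasurable hAm.norm)
  refine le_trans (le_of_eq ?_) (h2.trans ?_)
  · rfl
  · rw [eLpNorm_norm_rpow _ hp1, eLpNorm_norm,
      ← ENNReal.ofReal_mul (by positivity), div_mul_cancel₀ _ hp1.ne']
    refine mul_le_mul_left (ENNReal.rpow_le_rpow ?_ hp1.le) _
    refine (eLpNorm_add_le hf.norm hg.norm ?_).trans (le_of_eq ?_)
    · rw [← ENNReal.ofReal_one]
      exact ENNReal.ofReal_le_ofReal (by linarith)
    · rw [eLpNorm_norm, eLpNorm_norm]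

theorem memLp_nl {p : ℝ} (hp : 1 < p) {f : Ω → ℝ} (hf : MemLp f (ENNReal.ofReal (2 * p)) μ) :
    MemLp (fun x => nl p (f x)) 2 μ := by
  refine ⟨(continuous_nl hp).comp_aestronglyMeasurable hf.1, ?_⟩
  have := eLpNorm_nl_sub_le (μ := μ) hp hf.1 (g := fun _ => 0) aestronglyMeasurable_const
  have e : nl p 0 = 0 := by simp [nl]
  have e2 : (f - fun _ => (0 : ℝ)) = f := by funext x; simp
  simp only [e, sub_zero, e2] at this
  refine this.trans_lt ?_
  rw [eLpNorm_zero', add_zero]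
  exact ENNReal.mul_lt_top ENNReal.ofReal_lt_top (ENNReal.mul_lt_top
    (ENNReal.rpow_lt_top_of_nonneg (by linarith) hf.2.ne) hf.2)

theorem tendsto_eLpNorm_nl_sub {p : ℝ} (hp : 1 < p) {ι : Type*} {l : Filter ι} {F : ι → Ω → ℝ}
    {f : Ω → ℝ} (hF : ∀ᶠ n in l, MemLp (F n) (ENNReal.ofReal (2 * p)) μ)
    (hf : MemLp f (ENNReal.ofReal (2 * p)) μ)
    (h : Tendsto (fun n => eLpNorm (F n - f) (ENNReal.ofReal (2 * p)) μ) l (𝓝 0)) :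
    Tendsto (fun n => eLpNorm ((fun x => nl p (F n x)) - fun x => nl p (f x)) 2 μ) l (𝓝 0) := by
  set q := ENNReal.ofReal (2 * p) with hq
  have hq1 : 1 ≤ q := by
    rw [hq, ← ENNReal.ofReal_one]
    exact ENNReal.ofReal_le_ofReal (by linarith)
  have hbd : ∀ᶠ n in l, eLpNorm ((fun x => nl p (F n x)) - fun x => nl p (f x)) 2 μ ≤
      ENNReal.ofReal p * ((1 + eLpNorm f q μ + eLpNorm f q μ) ^ (p - 1)
        * eLpNorm (F n - f) q μ) := by
    filter_upwards [hF, h.eventually (eventually_lt_nhds one_pos)] with n hn h1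
    refine (eLpNorm_nl_sub_le hp hn.1 hf.1).trans (mul_le_mul_right (mul_le_mul_left
      (ENNReal.rpow_le_rpow (add_le_add_left ?_ _) (by linarith)) _) _)
    have e : F n = (F n - f) + f := by abel
    rw [e]
    exact (eLpNorm_add_le (hn.1.sub hf.1) hf.1 hq1).trans (add_le_add_left h1.le _)
  refine tendsto_of_tendsto_of_tendsto_of_le_of_le' tendsto_const_nhds ?_
    (.of_forall fun _ => zero_le) hbd
  have hne : (1 + eLpNorm f q μ + eLpNorm f q μ) ^ (p - 1) ≠ ⊤ :=
    ENNReal.rpow_ne_top_of_nonneg (by linarith)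
      (ENNReal.add_ne_top.2 ⟨ENNReal.add_ne_top.2 ⟨by simp, hf.2.ne⟩, hf.2.ne⟩)
  simpa using ENNReal.Tendsto.const_mul (a := ENNReal.ofReal p)
    (ENNReal.Tendsto.const_mul h (Or.inr hne)) (Or.inr ENNReal.ofReal_ne_top)

/-- Interpolation between `L^∞` and `L²`. -/
theorem eLpNorm_le_of_bound {p : ℝ} (hp : 1 < p) {f : Ω → ℝ} {K : ℝ}
    (hf : ∀ᵐ x ∂μ, |f x| ≤ K) :
    eLpNorm f (ENNReal.ofReal (2 * p)) μ
      ≤ ENNReal.ofReal (K ^ (1 - 1 / p)) * eLpNorm f 2 μ ^ (1 / p) := by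
  have hp0 : 0 < 1 / p := by positivity
  have hp1 : 0 ≤ 1 - 1 / p := by
    rw [sub_nonneg, div_le_one (by linarith)]; exact hp.le
  have h1 := eLpNorm_le_mul_eLpNorm_of_ae_le_mul (μ := μ) (p := ENNReal.ofReal (2 * p))
    (f := f) (g := fun x => ‖f x‖ ^ (1 / p)) (c := K ^ (1 - 1 / p)) (by
      filter_upwards [hf] with x hx
      rw [Real.norm_of_nonneg (Real.rpow_nonneg (norm_nonneg _) _)]
      calc ‖f x‖ = ‖f x‖ ^ (1 - 1 / p) * ‖f x‖ ^ (1 / p) := by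
            rw [← Real.rpow_add_of_nonneg (norm_nonneg _) hp1 hp0.le]; simp
        _ ≤ _ := mul_le_mul_of_nonneg_right (Real.rpow_le_rpow (norm_nonneg _) hx hp1)
            (Real.rpow_nonneg (norm_nonneg _) _))
  rw [eLpNorm_norm_rpow _ hp0, ← ENNReal.ofReal_mul (by positivity)] at h1
  have e : 2 * p * (1 / p) = 2 := by field_simp
  rw [e] at h1
  simpa using h1

end Nonlinearity

/-! ### Time regularity of the solution, of its gradient and of its potential energy. -/

section SolutionCurves

variable {N : ℕ}

theorem weakPartial_sub {i : Fin N} {f g : Space N → ℝ}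
    (hf : HasWeakPartial i f (weakPartial i f)) (hg : HasWeakPartial i g (weakPartial i g)) :
    weakPartial i (f - g) =ᵐ[volume] weakPartial i f - weakPartial i g :=
  (hf.sub hg).weakPartial_ae_eq

theorem WeaklyDiff.sub {k : ℕ} {f g : Space N → ℝ} (hf : WeaklyDiff k f) (hg : WeaklyDiff k g) :
    WeaklyDiff k (f - g) := by
  induction k generalizing f g with
  | zero => exact AEStronglyMeasurable.sub hf hg
  | succ k ih =>
    refine ⟨hf.1.sub hg.1, fun i => ⟨((hf.2 i).1.sub (hg.2 i).1).weakPartial_spec, ?_⟩⟩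
    exact weaklyDiff_congr (weakPartial_sub (hf.2 i).1 (hg.2 i).1).symm
      (ih (hf.2 i).2 (hg.2 i).2)

theorem continuousOn_toL2 {F : ℝ → Space N → ℝ} {S : Set ℝ}
    (hm : ∀ t ∈ S, MemLp (F t) 2 (ballMeasure N))
    (h : ∀ t ∈ S, Tendsto (fun τ => eLpNorm (F τ - F t) 2 (ballMeasure N)) (𝓝[S] t) (𝓝 0)) :
    ContinuousOn (fun t => toL2 (F t)) S := fun t ht =>
  tendsto_toL2 (by filter_upwards [self_mem_nhdsWithin] with τ hτ using hm τ hτ) (hm t ht) (h t ht)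

variable {p T : ℝ} {u₀ u₁ : Space N → ℝ} {u v : ℝ → Space N → ℝ}

theorem IsSolution.tendsto_weakPartial_v (h : IsSolution p T u₀ u₁ u v) (i : Fin N) {t : ℝ}
    (ht : t ∈ Ico 0 T) :
    Tendsto (fun τ => eLpNorm (weakPartial i (v τ) - weakPartial i (v t)) 2 (ballMeasure N))
      (𝓝[Ico 0 T] t) (𝓝 0) := by
  refine tendsto_of_tendsto_of_tendsto_of_le_of_le' tendsto_const_nhds (h.cont_v 0 t ht)
    (.of_forall fun _ => zero_le) ?_
  filter_upwards [self_mem_nhdsWithin] with τ hτ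
  refine le_trans (le_of_eq (eLpNorm_congr_ae (ae_restrict_of_ae ?_)))
    (sobolevNorm_weakPartial_le 2 (ball1 0) 0 (v τ - v t) i)
  exact (weakPartial_sub ((h.mem_v τ hτ).hasWeakPartial i) ((h.mem_v t ht).hasWeakPartial i)).symm

theorem IsSolution.tendsto_v (h : IsSolution p T u₀ u₁ u v) {t : ℝ} (ht : t ∈ Ico 0 T) :
    Tendsto (fun τ => eLpNorm (v τ - v t) 2 (ballMeasure N)) (𝓝[Ico 0 T] t) (𝓝 0) :=
  tendsto_of_tendsto_of_tendsto_of_le_of_le tendsto_const_nhds (h.cont_v 0 t ht)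
    (fun _ => zero_le) fun _ => eLpNorm_le_sobolevNorm 2 (ball1 0) 1 _

theorem IsSolution.tendsto_u (h : IsSolution p T u₀ u₁ u v) {t : ℝ} (ht : t ∈ Ico 0 T) :
    Tendsto (fun τ => eLpNorm (u τ - u t) 2 (ballMeasure N)) (𝓝[Ico 0 T] t) (𝓝 0) :=
  tendsto_of_tendsto_of_tendsto_of_le_of_le tendsto_const_nhds (h.cont_u 0 t ht)
    (fun _ => zero_le) fun _ => eLpNorm_le_sobolevNorm 2 (ball1 0) 2 _

theorem IsSolution.tendsto_weakPartial_u (h : IsSolution p T u₀ u₁ u v) (i : Fin N) {t : ℝ}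
    (ht : t ∈ Ico 0 T) :
    Tendsto (fun τ => eLpNorm (weakPartial i (u τ) - weakPartial i (u t)) 2 (ballMeasure N))
      (𝓝[Ico 0 T] t) (𝓝 0) := by
  refine tendsto_of_tendsto_of_tendsto_of_le_of_le' tendsto_const_nhds (h.cont_u 0 t ht)
    (.of_forall fun _ => zero_le) ?_
  filter_upwards [self_mem_nhdsWithin] with τ hτ
  refine le_trans (le_of_eq (eLpNorm_congr_ae (ae_restrict_of_ae ?_)))
    ((eLpNorm_le_sobolevNorm 2 (ball1 0) 1 _).trans
      (sobolevNorm_weakPartial_le 2 (ball1 0) 1 (u τ - u t) i))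
  exact (weakPartial_sub ((h.mem_u τ hτ).hasWeakPartial i) ((h.mem_u t ht).hasWeakPartial i)).symm

theorem IsSolution.tendsto_weakPartial_weakPartial_u (h : IsSolution p T u₀ u₁ u v) (i : Fin N)
    {t : ℝ} (ht : t ∈ Ico 0 T) :
    Tendsto (fun τ => eLpNorm (weakPartial i (weakPartial i (u τ))
        - weakPartial i (weakPartial i (u t))) 2 (ballMeasure N)) (𝓝[Ico 0 T] t) (𝓝 0) := by
  refine tendsto_of_tendsto_of_tendsto_of_le_of_le' tendsto_const_nhds (h.cont_u 0 t ht)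
    (.of_forall fun _ => zero_le) ?_
  filter_upwards [self_mem_nhdsWithin] with τ hτ
  refine le_trans (le_of_eq (eLpNorm_congr_ae (ae_restrict_of_ae ?_)))
    ((sobolevNorm_weakPartial_le 2 (ball1 0) 0 _ i).trans
      (sobolevNorm_weakPartial_le 2 (ball1 0) 1 (u τ - u t) i))
  rw [weakPartial_congr i (weakPartial_sub ((h.mem_u τ hτ).hasWeakPartial i)
    ((h.mem_u t ht).hasWeakPartial i))]
  exact (weakPartial_sub (((h.mem_u τ hτ).weakPartial i).hasWeakPartial i)
    (((h.mem_u t ht).weakPartial i).hasWeakPartial i)).symm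

theorem IsSolution.memLp_v (h : IsSolution p T u₀ u₁ u v) {t : ℝ} (ht : t ∈ Ico 0 T) :
    MemLp (v t) 2 (ballMeasure N) := (h.mem_v t ht).memLp one_le_two 1

theorem IsSolution.memLp_weakPartial_v (h : IsSolution p T u₀ u₁ u v) (i : Fin N) {t : ℝ}
    (ht : t ∈ Ico 0 T) : MemLp (weakPartial i (v t)) 2 (ballMeasure N) :=
  ((h.mem_v t ht).weakPartial i).memLp one_le_two 1

theorem IsSolution.memLp_u (h : IsSolution p T u₀ u₁ u v) {t : ℝ} (ht : t ∈ Ico 0 T) :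
    MemLp (u t) 2 (ballMeasure N) := (h.mem_u t ht).memLp one_le_two 1

theorem IsSolution.memLp_weakPartial_u (h : IsSolution p T u₀ u₁ u v) (i : Fin N) {t : ℝ}
    (ht : t ∈ Ico 0 T) : MemLp (weakPartial i (u t)) 2 (ballMeasure N) :=
  ((h.mem_u t ht).weakPartial i).memLp one_le_two 1

theorem IsSolution.memLp_weakLaplacian (h : IsSolution p T u₀ u₁ u v) {t : ℝ}
    (ht : t ∈ Ico 0 T) : MemLp (weakLaplacian (u t)) 2 (ballMeasure N) :=
  (h.mem_u t ht).weakLaplacian_memLp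

theorem IsSolution.continuousOn_v (h : IsSolution p T u₀ u₁ u v) :
    ContinuousOn (fun t => toL2 (v t)) (Ico 0 T) :=
  continuousOn_toL2 (fun _ ht => h.memLp_v ht) fun _ ht => h.tendsto_v ht

theorem IsSolution.continuousOn_weakPartial_v (h : IsSolution p T u₀ u₁ u v) (i : Fin N) :
    ContinuousOn (fun t => toL2 (weakPartial i (v t))) (Ico 0 T) :=
  continuousOn_toL2 (fun _ ht => h.memLp_weakPartial_v i ht)
    fun _ ht => h.tendsto_weakPartial_v i ht

theorem IsSolution.continuousOn_u (h : IsSolution p T u₀ u₁ u v) :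
    ContinuousOn (fun t => toL2 (u t)) (Ico 0 T) :=
  continuousOn_toL2 (fun _ ht => h.memLp_u ht) fun _ ht => h.tendsto_u ht

theorem IsSolution.continuousOn_weakPartial_u (h : IsSolution p T u₀ u₁ u v) (i : Fin N) :
    ContinuousOn (fun t => toL2 (weakPartial i (u t))) (Ico 0 T) :=
  continuousOn_toL2 (fun _ ht => h.memLp_weakPartial_u i ht)
    fun _ ht => h.tendsto_weakPartial_u i ht

theorem toL2_sum {ι : Type*} (s : Finset ι) {F : ι → Space N → ℝ}
    (hF : ∀ i ∈ s, MemLp (F i) 2 (ballMeasure N)) :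
    toL2 (∑ i ∈ s, F i) = ∑ i ∈ s, toL2 (F i) := by
  classical
  induction s using Finset.induction_on with
  | empty =>
    rw [Finset.sum_empty, Finset.sum_empty, toL2, dif_pos MemLp.zero]
    rfl
  | insert a s ha ih =>
    rw [Finset.sum_insert ha, Finset.sum_insert ha, toL2_add (hF a (Finset.mem_insert_self a s))
      (memLp_finsetSum' _ fun i hi => hF i (Finset.mem_insert_of_mem hi)),
      ih fun i hi => hF i (Finset.mem_insert_of_mem hi)]

theorem weakLaplacian_eq_sum (f : Space N → ℝ) :
    weakLaplacian f = ∑ i, weakPartial i (weakPartial i f) := by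
  funext x; simp [weakLaplacian]

theorem MemUloc.toL2_weakLaplacian {f : Space N → ℝ} (h : MemUloc 2 2 f) :
    toL2 (weakLaplacian f) = ∑ i, toL2 (VelocityWave.weakPartial i (VelocityWave.weakPartial i f)) := by
  rw [weakLaplacian_eq_sum, toL2_sum]
  exact fun i _ => ((h.weakPartial i).weakPartial i).memLp one_le_two 1

theorem IsSolution.continuousOn_weakLaplacian (h : IsSolution p T u₀ u₁ u v) :
    ContinuousOn (fun t => toL2 (weakLaplacian (u t))) (Ico 0 T) := by
  have : ContinuousOn (fun t => ∑ i, toL2 (weakPartial i (weakPartial i (u t)))) (Ico 0 T) :=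
    continuousOn_finsetSum _ fun i _ => continuousOn_toL2
      (fun t ht => (((h.mem_u t ht).weakPartial i).weakPartial i).memLp one_le_two 1)
      fun t ht => h.tendsto_weakPartial_weakPartial_u i ht
  exact this.congr fun t ht => (h.mem_u t ht).toL2_weakLaplacian

/-- The two settings are used differently here. In the first, 2p is within the range of the H¹
Sobolev embedding, so continuity in H¹ suffices. In the second, a local-in-time L^∞ bound is
interpolated with continuity in L². -/
theorem IsSolution.memLp_high (h : IsSolution p T u₀ u₁ u v) (hN : 1 ≤ N) (hp : 1 < p) {M : ℝ≥0}
    (hadm : Admissible p T M u₀ u₁ v) :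
    (∀ t ∈ Ico 0 T, MemLp (v t) (ENNReal.ofReal (2 * p)) (ballMeasure N)) ∧
    ∀ t ∈ Ico 0 T, Tendsto (fun τ => eLpNorm (v τ - v t) (ENNReal.ofReal (2 * p)) (ballMeasure N))
      (𝓝[Ico 0 T] t) (𝓝 0) := by
  rcases hadm with ⟨-, -, hpN⟩ | ⟨-, -, hb⟩
  · have hq : ((Real.toNNReal (2 * p) : ℝ≥0) : ℝ) = 2 * p := Real.coe_toNNReal _ (by linarith)
    obtain ⟨C, F, hC⟩ := exists_sobolev_ball hN (q := Real.toNNReal (2 * p))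
      (by rw [← NNReal.coe_le_coe, hq, NNReal.coe_one]; linarith)
      (fun h3 => by
        rw [hq, mul_div_assoc]
        linarith [hpN h3])
    refine ⟨fun t ht => ⟨(h.memLp_v ht).1, (hC _ (h.mem_v t ht).1).trans_lt ?_⟩, fun t ht => ?_⟩
    · refine ENNReal.mul_lt_top ENNReal.coe_lt_top (ENNReal.sum_lt_top.2 fun y _ => ?_)
      exact (le_iSup (fun x => sobolevNorm 2 (ball1 x) 1 (v t)) y).trans_lt (h.mem_v t ht).2
    · have hlim : Tendsto (fun τ => (C : ℝ≥0∞) * ∑ y ∈ F, sobolevNorm 2 (ball1 y) 1 (v τ - v t))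
          (𝓝[Ico 0 T] t) (𝓝 0) := by
        have := tendsto_finsetSum F fun y _ => h.cont_v y t ht
        simpa using ENNReal.Tendsto.const_mul (a := (C : ℝ≥0∞)) this (Or.inr ENNReal.coe_ne_top)
      refine tendsto_of_tendsto_of_tendsto_of_le_of_le' tendsto_const_nhds hlim
        (.of_forall fun _ => zero_le) ?_
      filter_upwards [self_mem_nhdsWithin] with τ hτ
      exact hC _ ((h.mem_v τ hτ).1.sub (h.mem_v t ht).1)
  · have bound : ∀ τ ∈ Ico 0 T, ∃ K : ℝ, ∀ t ∈ Icc 0 τ,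
        ∀ᵐ x ∂(ballMeasure N), |v t x| ≤ K := by
      intro τ hτ
      obtain ⟨K, hK⟩ := hb τ hτ
      refine ⟨K, fun t ht => ?_⟩
      have h1 : eLpNorm (v t) ∞ (ballMeasure N) ≤ K :=
        (le_iSup (fun x => sobolevNorm ∞ (ball1 x) 0 (v t)) 0).trans (hK t ht)
      rw [eLpNorm_exponent_top] at h1
      filter_upwards [ae_le_eLpNormEssSup (f := v t) (μ := ballMeasure N)] with x hx
      have h2 := hx.trans h1
      rw [← Real.norm_eq_abs]
      rw [enorm_eq_nnnorm] at h2
      exact_mod_cast h2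
    have hp1 : 0 < 1 / p := by positivity
    refine ⟨fun t ht => ⟨(h.memLp_v ht).1, ?_⟩, fun t ht => ?_⟩
    · obtain ⟨K, hK⟩ := bound t ht
      refine (eLpNorm_le_of_bound hp (hK t ⟨ht.1, le_rfl⟩)).trans_lt ?_
      exact ENNReal.mul_lt_top ENNReal.ofReal_lt_top
        (ENNReal.rpow_lt_top_of_nonneg hp1.le (h.memLp_v ht).2.ne)
    -- An L^∞ bound up to some τ₀ strictly between t and T covers all times near t. The difference
    -- of two values is then at most 2K.
    · obtain ⟨τ₀, h1, h2⟩ := exists_between ht.2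
      obtain ⟨K, hK⟩ := bound τ₀ ⟨ht.1.trans h1.le, h2⟩
      have hlim : Tendsto (fun τ => ENNReal.ofReal ((2 * K) ^ (1 - 1 / p))
          * eLpNorm (v τ - v t) 2 (ballMeasure N) ^ (1 / p)) (𝓝[Ico 0 T] t) (𝓝 0) := by
        have h3 := (h.tendsto_v ht).ennrpow_const (1 / p)
        rw [ENNReal.zero_rpow_of_pos hp1] at h3
        simpa using ENNReal.Tendsto.const_mul (a := ENNReal.ofReal ((2 * K) ^ (1 - 1 / p))) h3
          (Or.inr ENNReal.ofReal_ne_top)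
      refine tendsto_of_tendsto_of_tendsto_of_le_of_le' tendsto_const_nhds hlim
        (.of_forall fun _ => zero_le) ?_
      filter_upwards [self_mem_nhdsWithin, mem_nhdsWithin_of_mem_nhds (Iio_mem_nhds h1)]
        with τ hτ hτ2
      refine eLpNorm_le_of_bound hp ?_
      filter_upwards [hK τ ⟨hτ.1, le_of_lt hτ2⟩, hK t ⟨ht.1, h1.le⟩] with x hx1 hx2
      rw [Pi.sub_apply]
      refine (abs_sub _ _).trans ?_
      linarith

theorem IsSolution.memLp_nl (h : IsSolution p T u₀ u₁ u v) (hN : 1 ≤ N) (hp : 1 < p) {M : ℝ≥0}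
    (hadm : Admissible p T M u₀ u₁ v) {t : ℝ} (ht : t ∈ Ico 0 T) :
    MemLp (fun x => nl p (v t x)) 2 (ballMeasure N) :=
  VelocityWave.memLp_nl hp ((h.memLp_high hN hp hadm).1 t ht)

theorem IsSolution.continuousOn_nl (h : IsSolution p T u₀ u₁ u v) (hN : 1 ≤ N) (hp : 1 < p)
    {M : ℝ≥0} (hadm : Admissible p T M u₀ u₁ v) :
    ContinuousOn (fun t => toL2 fun x => nl p (v t x)) (Ico 0 T) := by
  obtain ⟨h1, h2⟩ := h.memLp_high hN hp hadm
  refine continuousOn_toL2 (fun t ht => h.memLp_nl hN hp hadm ht) fun t ht =>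
    tendsto_eLpNorm_nl_sub hp ?_ (h1 t ht) (h2 t ht)
  filter_upwards [self_mem_nhdsWithin] with τ hτ using h1 τ hτ

theorem HasDerivWithinAt.congr_on {f g : ℝ → ℝ} {f' : ℝ} {s : Set ℝ} {t : ℝ}
    (h : HasDerivWithinAt f f' s t) (hfg : ∀ x ∈ s, g x = f x) (ht : t ∈ s) :
    HasDerivWithinAt g f' s t :=
  h.congr hfg (hfg t ht)

theorem IsSolution.hasDerivAt_v (h : IsSolution p T u₀ u₁ u v) (hN : 1 ≤ N) (hp : 1 < p)
    {M : ℝ≥0} (hadm : Admissible p T M u₀ u₁ v) {t : ℝ} (ht : t ∈ Ioo 0 T) :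
    HasDerivAt (fun t => toL2 (v t))
      (toL2 (weakLaplacian (u t)) + toL2 fun x => nl p (v t x)) t := by
  refine hasDerivAt_of_weak (Y := fun t => toL2 (weakLaplacian (u t)) + toL2 fun x => nl p (v t x))
    h.continuousOn_v (h.continuousOn_weakLaplacian.add (h.continuousOn_nl hN hp hadm)) ?_ ht
  intro φ hφ hc hs t ht
  have m1 := h.memLp_weakLaplacian ht
  have m2 := h.memLp_nl hN hp hadm ht
  rw [← toL2_add m1 m2, inner_toL2_test (m1.add m2) hφ.continuous hs]
  exact HasDerivWithinAt.congr_on (h.deriv_v φ hφ hc t ht)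
    (fun τ hτ => inner_toL2_test (h.memLp_v hτ) hφ.continuous hs) ht

theorem IsSolution.hasDerivAt_u (h : IsSolution p T u₀ u₁ u v) {t : ℝ} (ht : t ∈ Ioo 0 T) :
    HasDerivAt (fun t => toL2 (u t)) (toL2 (v t)) t := by
  refine hasDerivAt_of_weak h.continuousOn_u h.continuousOn_v ?_ ht
  intro φ hφ hc hs t ht
  rw [inner_toL2_test (h.memLp_v ht) hφ.continuous hs]
  exact HasDerivWithinAt.congr_on (h.deriv_u φ hφ hc t ht)
    (fun τ hτ => inner_toL2_test (h.memLp_u hτ) hφ.continuous hs) ht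

theorem contDiff_fderiv_single {φ : Space N → ℝ} (hφ : ContDiff ℝ ∞ φ) (e : Space N) :
    ContDiff ℝ ∞ fun x => fderiv ℝ φ x e :=
  (hφ.fderiv_right (m := ∞) (by simp)).clm_apply contDiff_const

/-- The function ∂_i φ is again a test function, so u_t = v may be tested against it. The resulting
derivative is continuous in L²(B), which makes it strong. -/
theorem IsSolution.hasDerivAt_weakPartial_u (h : IsSolution p T u₀ u₁ u v) (i : Fin N) {t : ℝ}
    (ht : t ∈ Ioo 0 T) :
    HasDerivAt (fun t => toL2 (weakPartial i (u t))) (toL2 (weakPartial i (v t))) t := by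
  refine hasDerivAt_of_weak (h.continuousOn_weakPartial_u i) (h.continuousOn_weakPartial_v i) ?_ ht
  intro φ hφ hc hs t ht
  have hd := h.deriv_u _ (contDiff_fderiv_single hφ (EuclideanSpace.single i 1))
    (hasCompactSupport_fderiv_single hc _) t ht
  rw [((h.mem_v t ht).hasWeakPartial i).2.2 φ hφ hc] at hd
  have hd' := hd.neg
  rw [neg_neg] at hd'
  rw [inner_toL2_test (h.memLp_weakPartial_v i ht) hφ.continuous hs]
  refine HasDerivWithinAt.congr_on hd' (fun τ hτ => ?_) ht
  rw [inner_toL2_test (h.memLp_weakPartial_u i hτ) hφ.continuous hs]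
  simp only [Pi.neg_apply]
  rw [((h.mem_u τ hτ).hasWeakPartial i).2.2 φ hφ hc, neg_neg]

theorem hasDerivAt_wform {w : Space N → ℝ} {X Y : ℝ → BallL2 N} {X' Y' : BallL2 N} {t : ℝ}
    (hX : HasDerivAt X X' t) (hY : HasDerivAt Y Y' t) :
    HasDerivAt (fun s => wform w (X s) (Y s)) (wform w X' (Y t) + wform w (X t) Y') t :=
  ((wform w).hasFDerivAt.comp_hasDerivAt t hX).clm_apply hY

theorem continuousOn_wform {w : Space N → ℝ} {X Y : ℝ → BallL2 N} {S : Set ℝ}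
    (hX : ContinuousOn X S) (hY : ContinuousOn Y S) :
    ContinuousOn (fun s => wform w (X s) (Y s)) S :=
  (wform w).continuous₂.comp_continuousOn (hX.prodMk hY)

/-- A product of a differentiable curve vanishing at a point with a continuous curve is
differentiable there. -/
theorem hasDerivAt_wform_of_continuousAt {w : Space N → ℝ} {X Y : ℝ → BallL2 N} {X' : BallL2 N}
    {t : ℝ} (hX : HasDerivAt X X' t) (hY : ContinuousAt Y t) :
    HasDerivAt (fun s => wform w (X s - X t) (Y s)) (wform w X' (Y t)) t := by
  rw [hasDerivAt_iff_tendsto_slope] at hX ⊢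
  have hY' : Tendsto Y (𝓝[≠] t) (𝓝 (Y t)) := hY.tendsto.mono_left nhdsWithin_le_nhds
  have := ((wform w).continuous₂.tendsto (X', Y t)).comp (hX.prodMk_nhds hY')
  refine this.congr fun s => ?_
  simp [slope, Function.uncurry]

/-- Differentiability of the potential energy `∫ w |v|^{p+1}`. -/
theorem IsSolution.hasDerivAt_potential (h : IsSolution p T u₀ u₁ u v) (hN : 1 ≤ N) (hp : 1 < p)
    {M : ℝ≥0} (hadm : Admissible p T M u₀ u₁ v) {w : Space N → ℝ} (hw : Continuous w)
    (hw0 : ∀ z, 0 ≤ w z) {V' : BallL2 N} {t : ℝ} (ht : t ∈ Ioo 0 T)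
    (hV : HasDerivAt (fun t => toL2 (v t)) V' t) :
    HasDerivAt (fun t => wform w (toL2 fun x => nl p (v t x)) (toL2 (v t)))
      ((p + 1) * wform w (toL2 fun x => nl p (v t x)) V') t := by
  set n : ℝ → BallL2 N := fun t => toL2 fun x => nl p (v t x) with hn
  set V : ℝ → BallL2 N := fun t => toL2 (v t) with hVdef
  have hnc : ContinuousAt n t :=
    (h.continuousOn_nl hN hp hadm).continuousAt (Ico_mem_nhds ht.1 ht.2)
  -- The integrated tangent-line inequality, valid in both orders of the two times.
  have hlow : ∀ τ ∈ Ico 0 T, ∀ τ' ∈ Ico 0 T,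
      (p + 1) * wform w (n τ) (V τ' - V τ) ≤ wform w (n τ') (V τ') - wform w (n τ) (V τ) := by
    intro τ hτ τ' hτ'
    have mn := h.memLp_nl hN hp hadm hτ
    have mn' := h.memLp_nl hN hp hadm hτ'
    have mv := h.memLp_v hτ
    have mv' := h.memLp_v hτ'
    simp only [hn, hVdef]
    rw [← toL2_sub mv' mv, wform_toL2 hw mn (mv'.sub mv), wform_toL2 hw mn mv,
      wform_toL2 hw mn' mv', ← integral_const_mul, ← integral_sub
        (integrable_weight_mul_mul hw mn' mv') (integrable_weight_mul_mul hw mn mv)]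
    refine integral_mono ((integrable_weight_mul_mul hw mn (mv'.sub mv)).const_mul _)
      ((integrable_weight_mul_mul hw mn' mv').sub (integrable_weight_mul_mul hw mn mv)) fun z => ?_
    have := mul_le_mul_of_nonneg_left (nl_mul_sub_le hp (v τ z) (v τ' z)) (hw0 z)
    simp only [Pi.sub_apply]
    linarith
  have hlin : HasDerivAt (fun s => (p + 1) * wform w (n t) (V s)) ((p + 1) * wform w (n t) V') t :=
    (((wform w (n t)).hasFDerivAt.comp_hasDerivAt t hV)).const_mul _
  have herr : HasDerivAt (fun s => (p + 1) * wform w (V s - V t) (n s - n t)) 0 t := by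
    have := (hasDerivAt_wform_of_continuousAt (w := w) hV (Y := fun s => n s - n t)
      (hnc.sub continuousAt_const)).const_mul (p + 1)
    simpa using this
  -- The two orders place the first-order remainder between 0 and (p+1) times the pairing of V s - V
  -- t with n s - n t. That pairing is o(s - t) because V is differentiable and n is continuous at
  -- t.
  have hrem : HasDerivAt (fun s => wform w (n s) (V s) - (p + 1) * wform w (n t) (V s)) 0 t := by
    rw [hasDerivAt_iff_isLittleO] at herr ⊢
    refine (Asymptotics.IsBigO.of_bound 1 ?_).trans_isLittleO herr
    filter_upwards [Ico_mem_nhds ht.1 ht.2] with s hs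
    have h1 := hlow t ⟨ht.1.le, ht.2⟩ s hs
    have h2 := hlow s hs t ⟨ht.1.le, ht.2⟩
    have h3 : wform w (V s - V t) (n s - n t)
        = wform w (n s) (V s - V t) - wform w (n t) (V s - V t) := by
      rw [wform_comm hw]
      simp only [map_sub, sub_apply]
      ring
    have h4 : wform w (n s) (V t - V s) = - wform w (n s) (V s - V t) := by
      rw [← map_neg, neg_sub]
    have h5 : wform w (n t) (V s - V t) = wform w (n t) (V s) - wform w (n t) (V t) := map_sub _ _ _
    simp only [sub_self, map_zero, mul_zero, sub_zero, Real.norm_eq_abs, one_mul,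
      smul_eq_mul]
    rw [h3]
    rw [h4] at h2
    refine abs_le_abs ?_ ?_ <;> nlinarith
  have key := hrem.add hlin
  rw [zero_add] at key
  exact key.congr_of_eventuallyEq (.of_forall fun s => by simp [hn, hVdef])

end SolutionCurves

/-! ### Primitives of functions continuous on a half-line. -/

section Calculus

theorem primitive_of_continuousOn {k : ℝ → ℝ} {a : ℝ} (hk : ContinuousOn k (Ici a)) :
    ContinuousOn (fun s => ∫ τ in a..s, k τ) (Ici a) ∧
      ∀ s, a < s → HasDerivAt (fun s => ∫ τ in a..s, k τ) (k s) s := by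
  -- Freezing k to the left of a yields a function continuous on ℝ with the same integrals from a.
  set k' : ℝ → ℝ := fun s => k (max a s) with hk'
  have hc : Continuous k' :=
    hk.comp_continuous (continuous_const.max continuous_id) fun s => le_max_left a s
  have he : ∀ s ∈ Ici a, ∫ τ in a..s, k τ = ∫ τ in a..s, k' τ := by
    intro s hs
    refine intervalIntegral.integral_congr fun τ hτ => ?_
    rw [uIcc_of_le hs] at hτ
    simp only [hk', max_eq_right hτ.1]
  have hd : ∀ s, HasDerivAt (fun s => ∫ τ in a..s, k' τ) (k' s) s := fun s =>
    intervalIntegral.integral_hasDerivAt_right (hc.intervalIntegrable _ _)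
      (hc.stronglyMeasurableAtFilter _ _) hc.continuousAt
  refine ⟨ContinuousOn.congr (fun s _ => (hd s).continuousAt.continuousWithinAt) he,
    fun s hs => ?_⟩
  have := hd s
  rw [show k' s = k s by simp only [hk', max_eq_right hs.le]] at this
  refine this.congr_of_eventuallyEq ?_
  filter_upwards [Ioi_mem_nhds hs] with x hx using he x (le_of_lt (mem_Ioi.1 hx))

theorem intervalIntegrable_of_continuousOn_Ici {k : ℝ → ℝ} {a s : ℝ} (hk : ContinuousOn k (Ici a))
    (hs : a ≤ s) : IntervalIntegrable k volume a s :=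
  (hk.mono fun x hx => by rw [uIcc_of_le hs] at hx; exact hx.1).intervalIntegrable

end Calculus

/-! ### The energy identity for abstract curves in L²(B). -/

/-- The vector weight `z_i ρ^γ`. -/
noncomputable def coordWeight {N : ℕ} (γ : ℝ) (i : Fin N) (z : Space N) : ℝ := z i * rhoPow γ z

/-- The divergence of `z ρ^γ`. -/
noncomputable def divWeight {N : ℕ} (γ : ℝ) (z : Space N) : ℝ :=
  (N : ℝ) * rhoPow γ z - 2 * γ * ‖z‖ ^ 2 * rhoPow (γ - 1) z

/-- The curves in `L²(B)` entering the energy identity: the unknown, its gradient, the position,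
its gradient and Laplacian, and the nonlinearity, in similarity variables. -/
structure EnergyCurves (N : ℕ) (p β α s₀ : ℝ) where
  θ : ℝ → BallL2 N
  D : Fin N → ℝ → BallL2 N
  P : ℝ → BallL2 N
  Q : Fin N → ℝ → BallL2 N
  L : ℝ → BallL2 N
  n : ℝ → BallL2 N
  contθ : ContinuousOn θ (Ici s₀)
  contD : ∀ i, ContinuousOn (D i) (Ici s₀)
  contP : ContinuousOn P (Ici s₀)
  contQ : ∀ i, ContinuousOn (Q i) (Ici s₀)
  contL : ContinuousOn L (Ici s₀)
  contn : ContinuousOn n (Ici s₀)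
  derivθ : ∀ s, s₀ < s → HasDerivAt θ (Real.exp (-(β + 1) * s) • L s - β • θ s + n s) s
  derivP : ∀ s, s₀ < s → HasDerivAt P (gTwo β s • θ s) s
  derivQ : ∀ i s, s₀ < s → HasDerivAt (Q i) (gTwo β s • D i s) s
  derivn : ∀ s, s₀ < s → HasDerivAt (fun s => wform (rhoPow α) (n s) (θ s))
    ((p + 1) * wform (rhoPow α) (n s) (Real.exp (-(β + 1) * s) • L s - β • θ s + n s)) s
  parts_laplacian : ∀ s s', s₀ ≤ s → s₀ ≤ s' → wform (rhoPow α) (θ s) (L s') =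
    -∑ i, (wform (rhoPow α) (D i s) (Q i s')
      - 2 * α * wform (coordWeight (α - 1) i) (θ s) (Q i s'))
  parts_div : ∀ s s', s₀ ≤ s → s₀ ≤ s' → wform (divWeight (α - 1)) (θ s) (P s') =
    -∑ i, (wform (coordWeight (α - 1) i) (θ s) (Q i s')
      + wform (coordWeight (α - 1) i) (D i s) (P s'))
  parts_self : ∀ s, s₀ ≤ s → wform (divWeight (α - 1)) (θ s) (θ s) =
    -∑ i, 2 * wform (coordWeight (α - 1) i) (θ s) (D i s)

namespace EnergyCurves

variable {N : ℕ} {p β α s₀ : ℝ} (c : EnergyCurves N p β α s₀)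

/-- The `s`-derivative of the unknown. -/
noncomputable def θ' (s : ℝ) : BallL2 N :=
  Real.exp (-(β + 1) * s) • c.L s - β • c.θ s + c.n s

/-- The time density in the reduced energy. -/
noncomputable def density (s : ℝ) : ℝ :=
  gTwo β s * (2 * (∑ i, wform (rhoPow α) (c.D i s) (c.D i s))
      + α * wform (divWeight (α - 1)) (c.θ s) (c.θ s))
    + α * gOne β s * wform (rhoPow (α - 1)) (c.θ s) (c.θ s)

/-- The energy, up to an additive constant, after integration by parts. -/
noncomputable def reducedEnergy (s : ℝ) : ℝ :=
  β / 2 * (gOne β s * wform (rhoPow α) (c.θ s) (c.θ s))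
    - 1 / (p + 1) * (gOne β s * wform (rhoPow α) (c.n s) (c.θ s))
    - wform (rhoPow α) (c.θ s) (c.L s) - ∫ τ in s₀..s, c.density τ

/-- The dissipation rate of the energy. -/
noncomputable def dissipation (s : ℝ) : ℝ :=
  gOne β s * (α * wform (rhoPow (α - 1)) (c.θ s) (c.θ s)
      - β * (β + 1) / 2 * wform (rhoPow α) (c.θ s) (c.θ s))
    + (β + 1) / (p + 1) * (gOne β s * wform (rhoPow α) (c.n s) (c.θ s))
    + gOne β s * wform (rhoPow α) (c.θ' s) (c.θ' s)
    + gTwo β s * ∑ i, wform (rhoPow α) (c.D i s) (c.D i s)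

theorem continuous_gOne : Continuous (gOne β) := by unfold gOne; fun_prop

theorem continuous_gTwo : Continuous (gTwo β) := by unfold gTwo; fun_prop

theorem continuousOn_θ' : ContinuousOn c.θ' (Ici s₀) := by
  have h1 : ContinuousOn (fun s : ℝ => Real.exp (-(β + 1) * s)) (Ici s₀) :=
    Continuous.continuousOn (by fun_prop)
  have h2 : ContinuousOn (fun s => Real.exp (-(β + 1) * s) • c.L s) (Ici s₀) := h1.smul c.contL
  have h3 : ContinuousOn (fun s => β • c.θ s) (Ici s₀) :=
    (continuousOn_const (c := β)).smul c.contθ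
  exact (h2.sub h3).add c.contn

theorem continuousOn_density : ContinuousOn c.density (Ici s₀) :=
  (continuous_gTwo.continuousOn.mul ((continuousOn_const.mul (continuousOn_finsetSum _ fun i _ =>
    continuousOn_wform (c.contD i) (c.contD i))).add (continuousOn_const.mul
      (continuousOn_wform c.contθ c.contθ)))).add
    ((continuousOn_const.mul continuous_gOne.continuousOn).mul (continuousOn_wform c.contθ c.contθ))

theorem continuousOn_dissipation : ContinuousOn c.dissipation (Ici s₀) := by
  have g1 : ContinuousOn (gOne β) (Ici s₀) := continuous_gOne.continuousOn
  have g2 : ContinuousOn (gTwo β) (Ici s₀) := continuous_gTwo.continuousOn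
  have h1 := fun w => continuousOn_wform (w := w) c.contθ c.contθ
  exact (((g1.mul ((continuousOn_const.mul (h1 _)).sub (continuousOn_const.mul (h1 _)))).add
    (continuousOn_const.mul (g1.mul (continuousOn_wform c.contn c.contθ)))).add
    (g1.mul (continuousOn_wform c.continuousOn_θ' c.continuousOn_θ'))).add
    (g2.mul (continuousOn_finsetSum _ fun i _ => continuousOn_wform (c.contD i) (c.contD i)))

theorem continuousOn_reducedEnergy : ContinuousOn c.reducedEnergy (Ici s₀) := by
  have g1 : ContinuousOn (gOne β) (Ici s₀) := continuous_gOne.continuousOn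
  exact (((continuousOn_const.mul (g1.mul (continuousOn_wform c.contθ c.contθ))).sub
    (continuousOn_const.mul (g1.mul (continuousOn_wform c.contn c.contθ)))).sub
    (continuousOn_wform c.contθ c.contL)).sub (primitive_of_continuousOn c.continuousOn_density).1

theorem hasDerivAt_gOne (s : ℝ) : HasDerivAt (gOne β) ((β + 1) * gOne β s) s := by
  have : HasDerivAt (fun s => Real.exp ((β + 1) * s)) (Real.exp ((β + 1) * s) * ((β + 1) * 1)) s :=
    ((hasDerivAt_id s).const_mul (β + 1)).exp
  rw [show (β + 1) * gOne β s = Real.exp ((β + 1) * s) * ((β + 1) * 1) by rw [gOne]; ring]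
  exact this

theorem hasDerivAt_wform_laplacian {s : ℝ} (hs : s₀ < s) :
    HasDerivAt (fun s => wform (rhoPow α) (c.θ s) (c.L s))
      (wform (rhoPow α) (c.θ' s) (c.L s)
        - gTwo β s * ∑ i, (wform (rhoPow α) (c.D i s) (c.D i s)
          - 2 * α * wform (coordWeight (α - 1) i) (c.θ s) (c.D i s))) s := by
  have h1 := hasDerivAt_wform_of_continuousAt (w := rhoPow α) (c.derivθ s hs)
    (c.contL.continuousAt (Ici_mem_nhds hs))
  have h2 : HasDerivAt (fun s' => -∑ i, (wform (rhoPow α) (c.D i s) (c.Q i s')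
      - 2 * α * wform (coordWeight (α - 1) i) (c.θ s) (c.Q i s')))
      (-∑ i, (wform (rhoPow α) (c.D i s) (gTwo β s • c.D i s)
      - 2 * α * wform (coordWeight (α - 1) i) (c.θ s) (gTwo β s • c.D i s))) s := by
    refine (HasDerivAt.fun_sum fun i _ => ?_).neg
    have hQ := c.derivQ i s hs
    exact ((wform (rhoPow α) (c.D i s)).hasFDerivAt.comp_hasDerivAt s hQ).sub
      (((wform (coordWeight (α - 1) i) (c.θ s)).hasFDerivAt.comp_hasDerivAt s hQ).const_mul _)
  have h3 := h1.add h2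
  have e : wform (rhoPow α) (c.θ' s) (c.L s)
        - gTwo β s * ∑ i, (wform (rhoPow α) (c.D i s) (c.D i s)
          - 2 * α * wform (coordWeight (α - 1) i) (c.θ s) (c.D i s))
      = wform (rhoPow α) (Real.exp (-(β + 1) * s) • c.L s - β • c.θ s + c.n s) (c.L s)
        + -∑ i, (wform (rhoPow α) (c.D i s) (gTwo β s • c.D i s)
      - 2 * α * wform (coordWeight (α - 1) i) (c.θ s) (gTwo β s • c.D i s)) := by
    rw [Finset.mul_sum, sub_eq_add_neg, θ']
    congr 2
    refine Finset.sum_congr rfl fun i _ => ?_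
    rw [map_smul, map_smul, smul_eq_mul, smul_eq_mul]
    ring
  rw [e]
  refine h3.congr_of_eventuallyEq ?_
  filter_upwards [Ioi_mem_nhds hs] with s' hs'
  rw [Pi.add_apply, ← c.parts_laplacian s s' hs.le (le_of_lt hs'), map_sub, sub_apply]
  ring

/-- The energy identity. -/
theorem hasDerivAt_reducedEnergy {s : ℝ} (hs : s₀ < s) (hα : 0 ≤ α) (hp : p + 1 ≠ 0) :
    HasDerivAt c.reducedEnergy (-c.dissipation s) s := by
  have hθ : HasDerivAt c.θ (c.θ' s) s := c.derivθ s hs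
  have hg := hasDerivAt_gOne (β := β) s
  have h1 := (hg.mul (hasDerivAt_wform (w := rhoPow α) hθ hθ)).const_mul (β / 2)
  have h2 := (hg.mul (c.derivn s hs)).const_mul (1 / (p + 1))
  have h3 := c.hasDerivAt_wform_laplacian hs
  have h4 := (primitive_of_continuousOn c.continuousOn_density).2 s hs
  have h5 := ((h1.sub h2).sub h3).sub h4
  have e : -c.dissipation s = β / 2 * ((β + 1) * gOne β s * wform (rhoPow α) (c.θ s) (c.θ s)
      + gOne β s * (wform (rhoPow α) (c.θ' s) (c.θ s) + wform (rhoPow α) (c.θ s) (c.θ' s)))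
      - 1 / (p + 1) * ((β + 1) * gOne β s * wform (rhoPow α) (c.n s) (c.θ s)
        + gOne β s * ((p + 1) * wform (rhoPow α) (c.n s) (c.θ' s)))
      - (wform (rhoPow α) (c.θ' s) (c.L s)
        - gTwo β s * ∑ i, (wform (rhoPow α) (c.D i s) (c.D i s)
          - 2 * α * wform (coordWeight (α - 1) i) (c.θ s) (c.D i s))) - c.density s := by
    -- Solving the equation for L makes the pairing of θ' with L produce the term in θ'². Its
    -- remaining terms cancel the derivatives of the quadratic and potential parts, apart from those
    -- of the factor g. The transport terms cancel through `parts_self`.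
    have hL : c.L s = gOne β s • (c.θ' s + β • c.θ s - c.n s) := by
      rw [θ']
      have : gOne β s * Real.exp (-(β + 1) * s) = 1 := by
        rw [gOne, ← Real.exp_add]; ring_nf; exact Real.exp_zero
      rw [show Real.exp (-(β + 1) * s) • c.L s - β • c.θ s + c.n s + β • c.θ s - c.n s
        = Real.exp (-(β + 1) * s) • c.L s by abel, smul_smul, this, one_smul]
    have hcomm := wform_comm (continuous_rhoPow (N := N) hα) (c.θ s) (c.θ' s)
    have hcomm2 := wform_comm (continuous_rhoPow (N := N) hα) (c.n s) (c.θ' s)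
    rw [hL]
    simp only [map_smul, map_add, map_sub, smul_eq_mul, dissipation, density,
      c.parts_self s hs.le, hcomm, hcomm2, Finset.sum_sub_distrib, ← Finset.mul_sum]
    field_simp
    ring
  rw [e]
  exact h5

theorem integral_dissipation (hα : 0 ≤ α) (hp : p + 1 ≠ 0) {s : ℝ} (hs : s₀ ≤ s) :
    ∫ τ in s₀..s, c.dissipation τ = c.reducedEnergy s₀ - c.reducedEnergy s := by
  have h := intervalIntegral.integral_eq_sub_of_hasDerivAt_of_le hs
    (c.continuousOn_reducedEnergy.mono Icc_subset_Ici_self)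
    (fun x hx => c.hasDerivAt_reducedEnergy hx.1 hα hp)
    (intervalIntegrable_of_continuousOn_Ici c.continuousOn_dissipation hs).neg
  rw [intervalIntegral.integral_neg] at h
  linarith

theorem integral_gTwo_wform_D (w : Space N → ℝ) (i : Fin N) (X : BallL2 N) {s : ℝ} (hs : s₀ ≤ s) :
    ∫ τ in s₀..s, gTwo β τ * wform w (c.D i τ) X = wform w (c.Q i s - c.Q i s₀) X := by
  have hc : ContinuousOn (fun τ => gTwo β τ * wform w (c.D i τ) X) (Ici s₀) :=
    continuous_gTwo.continuousOn.mul (continuousOn_wform (c.contD i) continuousOn_const)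
  have hq : ContinuousOn (fun τ => wform w (c.Q i τ) X) (Icc s₀ s) :=
    (continuousOn_wform (c.contQ i) continuousOn_const).mono Icc_subset_Ici_self
  rw [intervalIntegral.integral_eq_sub_of_hasDerivAt_of_le hs hq (fun x hx => ?_)
    (intervalIntegrable_of_continuousOn_Ici hc hs), map_sub, sub_apply]
  have := hasDerivAt_wform (w := w) (c.derivQ i x hx.1) (hasDerivAt_const x X)
  simpa using this

theorem integral_gTwo_wform_θ (w : Space N → ℝ) (X : BallL2 N) {s : ℝ} (hs : s₀ ≤ s) :
    ∫ τ in s₀..s, gTwo β τ * wform w (c.θ τ) X = wform w (c.P s - c.P s₀) X := by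
  have hc : ContinuousOn (fun τ => gTwo β τ * wform w (c.θ τ) X) (Ici s₀) :=
    continuous_gTwo.continuousOn.mul (continuousOn_wform c.contθ continuousOn_const)
  have hq : ContinuousOn (fun τ => wform w (c.P τ) X) (Icc s₀ s) :=
    (continuousOn_wform c.contP continuousOn_const).mono Icc_subset_Ici_self
  rw [intervalIntegral.integral_eq_sub_of_hasDerivAt_of_le hs hq (fun x hx => ?_)
    (intervalIntegrable_of_continuousOn_Ici hc hs), map_sub, sub_apply]
  have := hasDerivAt_wform (w := w) (c.derivP x hx.1) (hasDerivAt_const x X)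
  simpa using this

end EnergyCurves

theorem continuous_coordWeight {N : ℕ} {γ : ℝ} (hγ : 0 ≤ γ) (i : Fin N) :
    Continuous (coordWeight γ i) :=
  Continuous.mul (by fun_prop) (continuous_rhoPow hγ)

theorem continuous_divWeight {N : ℕ} {γ : ℝ} (hγ : 1 ≤ γ) :
    Continuous (divWeight γ : Space N → ℝ) :=
  (continuous_const.mul (continuous_rhoPow (by linarith))).sub
    ((continuous_const.mul (continuous_norm.pow 2)).mul (continuous_rhoPow (by linarith)))

namespace EnergyCurves

variable {N : ℕ} {p β α s₀ : ℝ} (c : EnergyCurves N p β α s₀)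

/-- The quadratic and linear parts of the energy recombine into the reduced energy. -/
theorem expanded_energy_eq (hα : 2 < α) {s : ℝ} (hs : s₀ ≤ s) :
    β / 2 * (gOne β s * wform (rhoPow α) (c.θ s) (c.θ s))
      - 1 / (p + 1) * (gOne β s * wform (rhoPow α) (c.n s) (c.θ s))
      - 1 / 8 * (∫ τ in s₀..s, gTwo β τ * ∑ i, (16 * wform (rhoPow α) (c.D i τ) (c.D i τ)
          - 8 * wform (rhoPow α) (c.D i τ) (c.D i s)))
      - α * (∫ τ in s₀..s, gTwo β τ * (wform (divWeight (α - 1)) (c.θ τ) (c.θ τ)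
          - 2 * wform (divWeight (α - 1)) (c.θ τ) (c.θ s)))
      - α * (∫ τ in s₀..s, (gOne β τ * wform (rhoPow (α - 1)) (c.θ τ) (c.θ τ)
          - 2 * (gTwo β τ * ∑ i, wform (coordWeight (α - 1) i) (c.θ τ) (c.D i s))))
      + ∑ i, wform (rhoPow α) (c.D i s) (c.Q i s₀)
      - 2 * α * ∑ i, wform (coordWeight (α - 1) i) (c.θ s) (c.Q i s₀) = c.reducedEnergy s := by
  have g1 : ContinuousOn (gOne β) (Ici s₀) := continuous_gOne.continuousOn
  have g2 : ContinuousOn (gTwo β) (Ici s₀) := continuous_gTwo.continuousOn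
  have cDD : ∀ i, ContinuousOn (fun τ => gTwo β τ * wform (rhoPow α) (c.D i τ) (c.D i τ)) (Ici s₀) :=
    fun i => g2.mul (continuousOn_wform (c.contD i) (c.contD i))
  have cDs : ∀ i, ContinuousOn (fun τ => gTwo β τ * wform (rhoPow α) (c.D i τ) (c.D i s)) (Ici s₀) :=
    fun i => g2.mul (continuousOn_wform (c.contD i) continuousOn_const)
  have cθθ : ContinuousOn (fun τ => gTwo β τ * wform (divWeight (α - 1)) (c.θ τ) (c.θ τ)) (Ici s₀) :=
    g2.mul (continuousOn_wform c.contθ c.contθ)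
  have cθs : ContinuousOn (fun τ => gTwo β τ * wform (divWeight (α - 1)) (c.θ τ) (c.θ s)) (Ici s₀) :=
    g2.mul (continuousOn_wform c.contθ continuousOn_const)
  have cB : ContinuousOn (fun τ => gOne β τ * wform (rhoPow (α - 1)) (c.θ τ) (c.θ τ)) (Ici s₀) :=
    g1.mul (continuousOn_wform c.contθ c.contθ)
  have cC : ∀ i, ContinuousOn (fun τ => gTwo β τ * wform (coordWeight (α - 1) i) (c.θ τ) (c.D i s))
      (Ici s₀) := fun i => g2.mul (continuousOn_wform c.contθ continuousOn_const)
  have ii : ∀ {k : ℝ → ℝ}, ContinuousOn k (Ici s₀) → IntervalIntegrable k volume s₀ s :=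
    fun hk => intervalIntegrable_of_continuousOn_Ici hk hs
  -- The factors 16 = 4² and 8 = 2·4 come from expanding |4∇θ(τ) - ∇θ(s)|² - |∇θ(s)|².
  have I3 : ∫ τ in s₀..s, gTwo β τ * ∑ i, (16 * wform (rhoPow α) (c.D i τ) (c.D i τ)
          - 8 * wform (rhoPow α) (c.D i τ) (c.D i s))
      = 16 * (∫ τ in s₀..s, gTwo β τ * ∑ i, wform (rhoPow α) (c.D i τ) (c.D i τ))
        - 8 * ∑ i, wform (rhoPow α) (c.Q i s - c.Q i s₀) (c.D i s) := by
    have e : ∀ τ, gTwo β τ * ∑ i, (16 * wform (rhoPow α) (c.D i τ) (c.D i τ)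
          - 8 * wform (rhoPow α) (c.D i τ) (c.D i s))
        = 16 * (gTwo β τ * ∑ i, wform (rhoPow α) (c.D i τ) (c.D i τ))
          - 8 * ∑ i, gTwo β τ * wform (rhoPow α) (c.D i τ) (c.D i s) := by
      intro τ
      rw [Finset.sum_sub_distrib, ← Finset.mul_sum, ← Finset.mul_sum, ← Finset.mul_sum]
      ring
    simp only [e]
    rw [intervalIntegral.integral_sub, intervalIntegral.integral_const_mul,
      intervalIntegral.integral_const_mul, intervalIntegral.integral_finsetSum]
    · simp only [c.integral_gTwo_wform_D _ _ _ hs]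
    · exact fun i _ => ii (cDs i)
    · refine ii (continuousOn_const.mul (g2.mul (continuousOn_finsetSum _ fun i _ =>
        continuousOn_wform (c.contD i) (c.contD i))))
    · exact ii (continuousOn_const.mul (continuousOn_finsetSum _ fun i _ => cDs i))
  have I4 : ∫ τ in s₀..s, gTwo β τ * (wform (divWeight (α - 1)) (c.θ τ) (c.θ τ)
          - 2 * wform (divWeight (α - 1)) (c.θ τ) (c.θ s))
      = (∫ τ in s₀..s, gTwo β τ * wform (divWeight (α - 1)) (c.θ τ) (c.θ τ))
        - 2 * wform (divWeight (α - 1)) (c.P s - c.P s₀) (c.θ s) := by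
    have c2 : ContinuousOn (fun τ => 2 * (gTwo β τ * wform (divWeight (α - 1)) (c.θ τ) (c.θ s)))
      (Ici s₀) := continuousOn_const.mul cθs
    rw [← c.integral_gTwo_wform_θ _ _ hs, ← intervalIntegral.integral_const_mul,
      ← intervalIntegral.integral_sub (ii cθθ) (ii c2)]
    exact intervalIntegral.integral_congr fun τ _ => by ring
  have I5 : ∫ τ in s₀..s, (gOne β τ * wform (rhoPow (α - 1)) (c.θ τ) (c.θ τ)
          - 2 * (gTwo β τ * ∑ i, wform (coordWeight (α - 1) i) (c.θ τ) (c.D i s)))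
      = (∫ τ in s₀..s, gOne β τ * wform (rhoPow (α - 1)) (c.θ τ) (c.θ τ))
        - 2 * ∑ i, wform (coordWeight (α - 1) i) (c.P s - c.P s₀) (c.D i s) := by
    simp only [Finset.mul_sum]
    rw [intervalIntegral.integral_sub (ii cB)]
    · rw [intervalIntegral.integral_finsetSum]
      · simp only [intervalIntegral.integral_const_mul, c.integral_gTwo_wform_θ _ _ hs]
      · exact fun i _ => ii (continuousOn_const.mul (cC i))
    · exact ii (continuousOn_finsetSum _ fun i _ => continuousOn_const.mul (cC i))
  have Iden : ∫ τ in s₀..s, c.density τ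
      = 2 * (∫ τ in s₀..s, gTwo β τ * ∑ i, wform (rhoPow α) (c.D i τ) (c.D i τ))
        + α * (∫ τ in s₀..s, gTwo β τ * wform (divWeight (α - 1)) (c.θ τ) (c.θ τ))
        + α * (∫ τ in s₀..s, gOne β τ * wform (rhoPow (α - 1)) (c.θ τ) (c.θ τ)) := by
    have cS : ContinuousOn (fun τ => gTwo β τ * ∑ i, wform (rhoPow α) (c.D i τ) (c.D i τ))
      (Ici s₀) := g2.mul (continuousOn_finsetSum _ fun i _ =>
        continuousOn_wform (c.contD i) (c.contD i))
    have e : ∀ τ, c.density τ = 2 * (gTwo β τ * ∑ i, wform (rhoPow α) (c.D i τ) (c.D i τ))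
        + α * (gTwo β τ * wform (divWeight (α - 1)) (c.θ τ) (c.θ τ))
        + α * (gOne β τ * wform (rhoPow (α - 1)) (c.θ τ) (c.θ τ)) := fun τ => by
      simp only [density]; ring
    simp only [e]
    rw [intervalIntegral.integral_add, intervalIntegral.integral_add,
      intervalIntegral.integral_const_mul, intervalIntegral.integral_const_mul,
      intervalIntegral.integral_const_mul]
    · exact ii (continuousOn_const.mul cS)
    · exact ii (continuousOn_const.mul cθθ)
    · exact ii ((continuousOn_const.mul cS).add (continuousOn_const.mul cθθ))
    · exact ii (continuousOn_const.mul cB)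
  have hA := continuous_rhoPow (N := N) (by linarith : 0 ≤ α)
  have hCw := fun i => continuous_coordWeight (N := N) (by linarith : 0 ≤ α - 1) i
  have hdiv := continuous_divWeight (N := N) (by linarith : 1 ≤ α - 1)
  -- The divergence and transport terms both leave pairings with P, which `parts_div` at times s and
  -- s₀ eliminates in favour of Q. The pairings with Q s₀ cancel the initial terms, and
  -- `parts_laplacian` turns those with Q s into the pairing with L.
  have p1 := c.parts_div s s hs hs
  have p2 := c.parts_div s s₀ hs le_rfl
  have p3 := c.parts_laplacian s s hs hs
  have k1 : ∀ i, wform (rhoPow α) (c.Q i s - c.Q i s₀) (c.D i s)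
      = wform (rhoPow α) (c.D i s) (c.Q i s) - wform (rhoPow α) (c.D i s) (c.Q i s₀) := fun i => by
    rw [wform_comm hA, map_sub]
  have k2 : wform (divWeight (α - 1)) (c.P s - c.P s₀) (c.θ s)
      = wform (divWeight (α - 1)) (c.θ s) (c.P s)
        - wform (divWeight (α - 1)) (c.θ s) (c.P s₀) := by
    rw [wform_comm hdiv, map_sub]
  have k3 : ∀ i, wform (coordWeight (α - 1) i) (c.P s - c.P s₀) (c.D i s)
      = wform (coordWeight (α - 1) i) (c.D i s) (c.P s)
        - wform (coordWeight (α - 1) i) (c.D i s) (c.P s₀) := fun i => by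
    rw [wform_comm (hCw i), map_sub]
  rw [I3, I4, I5, reducedEnergy, Iden, k2]
  simp only [k1, k3, Finset.sum_sub_distrib, Finset.sum_add_distrib, ← Finset.mul_sum] at p1 p2 p3 ⊢
  rw [p3]
  linear_combination 2 * α * p1 - 2 * α * p2

end EnergyCurves

/-! ### The change between similarity and physical time. -/

section TimeMap

/-- The physical time `t = T - e^{-s}`. -/
noncomputable def physTime (T s : ℝ) : ℝ := T - Real.exp (-s)

theorem continuous_physTime (T : ℝ) : Continuous (physTime T) := by unfold physTime; fun_prop

theorem hasDerivAt_physTime (T s : ℝ) : HasDerivAt (physTime T) (Real.exp (-s)) s := by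
  have : HasDerivAt (fun s => T - Real.exp (-s)) (-(Real.exp (-s) * -1)) s :=
    ((hasDerivAt_neg s).exp).const_sub T
  rw [show Real.exp (-s) = -(Real.exp (-s) * -1) by ring]
  exact this

theorem physTime_lt (T s : ℝ) : physTime T s < T := by
  have := Real.exp_pos (-s)
  rw [physTime]; linarith

theorem physTime_mem_Ico {T s : ℝ} (hT : 0 < T) (hs : -Real.log T ≤ s) :
    physTime T s ∈ Ico 0 T := by
  refine ⟨?_, physTime_lt T s⟩
  have : Real.exp (-s) ≤ Real.exp (Real.log T) := Real.exp_le_exp.2 (by linarith)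
  rw [Real.exp_log hT] at this
  rw [physTime]; linarith

theorem physTime_mem_Ioo {T s : ℝ} (hT : 0 < T) (hs : -Real.log T < s) :
    physTime T s ∈ Ioo 0 T := by
  refine ⟨?_, physTime_lt T s⟩
  have : Real.exp (-s) < Real.exp (Real.log T) := Real.exp_lt_exp.2 (by linarith)
  rw [Real.exp_log hT] at this
  rw [physTime]; linarith

theorem physTime_start {T : ℝ} (hT : 0 < T) : physTime T (-Real.log T) = 0 := by
  rw [physTime, neg_neg, Real.exp_log hT, sub_self]

end TimeMap

/-! ### Spatial integration by parts with the weights ρ^γ and z ρ^γ. -/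

section Parts

variable {N : ℕ}

theorem wform_weight_sum {ι : Type*} (s : Finset ι) {w : ι → Space N → ℝ}
    (hw : ∀ i ∈ s, Continuous (w i)) (f g : BallL2 N) :
    wform (fun z => ∑ i ∈ s, w i z) f g = ∑ i ∈ s, wform (w i) f g := by
  rw [wform_apply (continuous_finsetSum _ hw)]
  simp only [Finset.sum_mul]
  rw [integral_finsetSum _ fun i hi =>
    integrable_weight_mul_mul (hw i hi) (Lp.memLp f) (Lp.memLp g)]
  exact Finset.sum_congr rfl fun i hi => (wform_apply (hw i hi) f g).symm

theorem sum_fderiv_coordWeight {γ : ℝ} (hγ : 1 < γ) (z : Space N) :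
    ∑ i, fderiv ℝ (coordWeight γ i) z (EuclideanSpace.single i 1) = divWeight γ z := by
  have : ∀ i, fderiv ℝ (coordWeight γ i) z (EuclideanSpace.single i 1)
      = rhoPow γ z - (2 * γ) * (z i ^ 2 * rhoPow (γ - 1) z) := fun i =>
    fderiv_coord_mul_rhoPow hγ z i
  simp only [this, Finset.sum_sub_distrib, divWeight, EuclideanSpace.real_norm_sq_eq]
  rw [← Finset.mul_sum, ← Finset.sum_mul]
  simp [mul_assoc]

theorem contDiff_coordWeight {γ : ℝ} (hγ : 1 < γ) (i : Fin N) :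
    ContDiff ℝ 1 (coordWeight γ i) :=
  ContDiff.mul (by fun_prop) (contDiff_rhoPow hγ)

theorem coordWeight_eq_zero {γ : ℝ} (hγ : 0 < γ) (i : Fin N) {z : Space N}
    (hz : z ∉ ball1 (0 : Space N)) : coordWeight γ i z = 0 := by
  rw [coordWeight, rhoPow_eq_zero hγ hz, mul_zero]

theorem wform_divWeight {γ : ℝ} (hγ : 1 < γ) {k l : ℕ} {f h : Space N → ℝ}
    (hf : MemUloc 2 (k + 1) f) (hh : MemUloc 2 (l + 1) h) :
    wform (divWeight γ) (toL2 f) (toL2 h) =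
      -∑ i, (wform (coordWeight γ i) (toL2 f) (toL2 (weakPartial i h))
        + wform (coordWeight γ i) (toL2 (weakPartial i f)) (toL2 h)) := by
  have h1 := fun i => wform_byParts (contDiff_coordWeight hγ i)
    (fun x hx => coordWeight_eq_zero (by linarith) i hx) (hf.hasWeakPartial i)
    (hh.hasWeakPartial i) (hf.memLp one_le_two 2) ((hf.weakPartial i).memLp one_le_two 2)
    (hh.memLp one_le_two 2) ((hh.weakPartial i).memLp one_le_two 2)
  have e : (divWeight γ : Space N → ℝ) = fun z => ∑ i ∈ Finset.univ,
      (fun i z => fderiv ℝ (coordWeight γ i) z (EuclideanSpace.single i 1)) i z :=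
    funext fun z => (sum_fderiv_coordWeight hγ z).symm
  rw [e, wform_weight_sum, eq_neg_iff_add_eq_zero, ← Finset.sum_add_distrib]
  · exact Finset.sum_eq_zero fun i _ => by rw [← h1 i]; ring
  · exact fun i _ => ((contDiff_coordWeight hγ i).continuous_fderiv one_ne_zero).clm_apply
      continuous_const

theorem wform_weakLaplacian {γ : ℝ} (hγ : 1 < γ) {f h : Space N → ℝ}
    (hf : MemUloc 2 1 f) (hh : MemUloc 2 2 h) :
    wform (rhoPow γ) (toL2 f) (toL2 (weakLaplacian h)) =
      -∑ i, (wform (rhoPow γ) (toL2 (weakPartial i f)) (toL2 (weakPartial i h))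
        - 2 * γ * wform (coordWeight (γ - 1) i) (toL2 f) (toL2 (weakPartial i h))) := by
  have h1 := fun i => wform_byParts (contDiff_rhoPow hγ)
    (fun x hx => rhoPow_eq_zero (by linarith) hx) (hf.hasWeakPartial i)
    ((hh.weakPartial i).hasWeakPartial i) (hf.memLp one_le_two 2)
    ((hf.weakPartial i).memLp one_le_two 2)
    ((hh.weakPartial i).memLp one_le_two 2) (((hh.weakPartial i).weakPartial i).memLp one_le_two 2)
  have e : ∀ i : Fin N, (fun z => fderiv ℝ (rhoPow γ : Space N → ℝ) z (EuclideanSpace.single i 1))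
      = fun z => -(2 * γ) * coordWeight (γ - 1) i z := fun i =>
    funext fun z => hasFDerivAt_rhoPow hγ z i
  rw [hh.toL2_weakLaplacian, map_sum, eq_neg_iff_add_eq_zero, ← Finset.sum_add_distrib]
  refine Finset.sum_eq_zero fun i _ => ?_
  have := h1 i
  rw [e i, wform_mul_const _ (continuous_coordWeight (by linarith) i)] at this
  linarith

end Parts

/-! ### The solution in similarity variables as an instance of the abstract curves. -/

section Curves

variable {N : ℕ} {p T : ℝ} {u₀ u₁ : Space N → ℝ} {u v : ℝ → Space N → ℝ}

theorem continuousOn_comp_physTime {X : ℝ → BallL2 N} (hX : ContinuousOn X (Ico 0 T))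
    (hT : 0 < T) : ContinuousOn (fun s => X (physTime T s)) (Ici (-Real.log T)) :=
  hX.comp (continuous_physTime T).continuousOn fun _ hs => physTime_mem_Ico hT hs

theorem exp_smul_continuousOn {X : ℝ → BallL2 N} {S : Set ℝ} (hX : ContinuousOn X S) (b : ℝ) :
    ContinuousOn (fun s => Real.exp (-(b * s)) • X s) S := by
  have h : ContinuousOn (fun s : ℝ => Real.exp (-(b * s))) S := Continuous.continuousOn (by fun_prop)
  exact h.smul hX

theorem hasDerivAt_exp_neg_mul (b s : ℝ) :
    HasDerivAt (fun s => Real.exp (-(b * s))) (-b * Real.exp (-(b * s))) s := by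
  have : HasDerivAt (fun s => Real.exp (-(b * s))) (Real.exp (-(b * s)) * -(b * 1)) s :=
    (((hasDerivAt_id s).const_mul b).neg).exp
  convert this using 1
  ring

/-- The curves attached to a solution in similarity variables centred at the origin. -/
noncomputable def IsSolution.curves (h : IsSolution p T u₀ u₁ u v) (hN : 1 ≤ N) (hp : 1 < p)
    {β α : ℝ} (hβ : β = 1 / (p - 1)) (hα : 2 < α) {M : ℝ≥0} (hadm : Admissible p T M u₀ u₁ v)
    (hT : 0 < T) : EnergyCurves N p β α (-Real.log T) where
  θ s := Real.exp (-(β * s)) • toL2 (v (physTime T s))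
  D i s := Real.exp (-(β * s)) • toL2 (weakPartial i (v (physTime T s)))
  P s := toL2 (u (physTime T s))
  Q i s := toL2 (weakPartial i (u (physTime T s)))
  L s := toL2 (weakLaplacian (u (physTime T s)))
  n s := Real.exp (-((β + 1) * s)) • toL2 (fun x => nl p (v (physTime T s) x))
  contθ := exp_smul_continuousOn (continuousOn_comp_physTime h.continuousOn_v hT) β
  contD i := exp_smul_continuousOn (continuousOn_comp_physTime (h.continuousOn_weakPartial_v i) hT) β
  contP := continuousOn_comp_physTime h.continuousOn_u hT
  contQ i := continuousOn_comp_physTime (h.continuousOn_weakPartial_u i) hT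
  contL := continuousOn_comp_physTime h.continuousOn_weakLaplacian hT
  contn := exp_smul_continuousOn
    (continuousOn_comp_physTime (h.continuousOn_nl hN hp hadm) hT) (β + 1)
  derivθ s hs := by
    have h1 := (h.hasDerivAt_v hN hp hadm (physTime_mem_Ioo hT hs)).scomp s (hasDerivAt_physTime T s)
    have h2 := (hasDerivAt_exp_neg_mul β s).smul h1
    refine h2.congr_deriv ?_
    have e : Real.exp (-((β + 1) * s)) = Real.exp (-(β * s)) * Real.exp (-s) := by
      rw [← Real.exp_add]; ring_nf
    rw [show -(β + 1) * s = -((β + 1) * s) by ring, e, smul_add, smul_add, smul_smul, smul_smul,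
      smul_smul, neg_mul, neg_smul]
    simp only [Function.comp_apply]
    abel
  derivP s hs := by
    refine ((h.hasDerivAt_u (physTime_mem_Ioo hT hs)).scomp s
      (hasDerivAt_physTime T s)).congr_deriv ?_
    rw [smul_smul, gTwo, ← Real.exp_add]
    ring_nf
  derivQ i s hs := by
    refine ((h.hasDerivAt_weakPartial_u i (physTime_mem_Ioo hT hs)).scomp s
      (hasDerivAt_physTime T s)).congr_deriv ?_
    rw [smul_smul, gTwo, ← Real.exp_add]
    ring_nf
  derivn s hs := by
    -- The relation β(p - 1) = 1 identifies (p+1)β with 2β+1. The scaling factor e^{-(2β+1)s} of the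
    -- potential then produces exactly the -βθ contribution.
    have hpβ : (p + 1) * β = 2 * β + 1 := by
      rw [hβ]; field_simp [show p - 1 ≠ 0 by linarith]; ring
    have ht := physTime_mem_Ioo hT hs
    have h1 := h.hasDerivAt_potential hN hp hadm (continuous_rhoPow (by linarith : 0 ≤ α))
      (rhoPow_nonneg α) ht (h.hasDerivAt_v hN hp hadm ht)
    have h2 := h1.comp s (hasDerivAt_physTime T s)
    have h3 := (hasDerivAt_exp_neg_mul (2 * β + 1) s).mul h2
    have e : ∀ s, Real.exp (-((2 * β + 1) * s)) = Real.exp (-((β + 1) * s)) * Real.exp (-(β * s)) :=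
      fun s => by rw [← Real.exp_add]; ring_nf
    have e2 : Real.exp (-(β + 1) * s) = Real.exp (-((β + 1) * s)) := by ring_nf
    have e3 : Real.exp (-((β + 1) * s)) = Real.exp (-(β * s)) * Real.exp (-s) := by
      rw [← Real.exp_add]; ring_nf
    refine (h3.congr_of_eventuallyEq (.of_forall fun s => ?_)).congr_deriv ?_
    · simp only [map_smul, smul_apply, smul_eq_mul, Pi.mul_apply, Function.comp_apply, e]
      ring
    · simp only [map_smul, map_add, map_sub, smul_apply, smul_eq_mul, Function.comp_apply, e,
        e2]
      rw [← hpβ]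
      simp only [e3]
      ring
  parts_laplacian s s' hs hs' := by
    have := wform_weakLaplacian (by linarith : 1 < α) (h.mem_v _ (physTime_mem_Ico hT hs))
      (h.mem_u _ (physTime_mem_Ico hT hs'))
    simp only [map_smul, smul_apply, smul_eq_mul, this]
    rw [mul_neg, Finset.mul_sum]
    exact congrArg _ (Finset.sum_congr rfl fun i _ => by ring)
  parts_div s s' hs hs' := by
    have := wform_divWeight (by linarith : 1 < α - 1) (h.mem_v _ (physTime_mem_Ico hT hs))
      (h.mem_u _ (physTime_mem_Ico hT hs'))
    simp only [map_smul, smul_apply, smul_eq_mul, this]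
    rw [mul_neg, Finset.mul_sum]
    exact congrArg _ (Finset.sum_congr rfl fun i _ => by ring)
  parts_self s hs := by
    have hv := h.mem_v _ (physTime_mem_Ico hT hs)
    have := wform_divWeight (by linarith : 1 < α - 1) hv hv
    simp only [map_smul, smul_apply, smul_eq_mul, this]
    rw [mul_neg, mul_neg, Finset.mul_sum, Finset.mul_sum]
    refine congrArg _ (Finset.sum_congr rfl fun i _ => ?_)
    rw [wform_comm (continuous_coordWeight (by linarith) i) (toL2 (weakPartial i _))]
    ring

end Curves

/-! ### Expansion of the separate terms of the energy. -/

section Terms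

variable {N : ℕ}

theorem ae_ball_of_ae {P : Space N → Prop} (h : ∀ᵐ z, P z) :
    ∀ᵐ z ∂(ballMeasure N), z ∈ ball1 (0 : Space N) ∧ P z := by
  filter_upwards [ae_restrict_mem Metric.isClosed_closedBall.measurableSet, ae_restrict_of_ae h]
    with z h1 h2 using ⟨h1, h2⟩

theorem integral_weight_sum {w : Fin N → Space N → ℝ} (hw : ∀ i, Continuous (w i))
    {A B : Fin N → Space N → ℝ} (hA : ∀ i, MemLp (A i) 2 (ballMeasure N))
    (hB : ∀ i, MemLp (B i) 2 (ballMeasure N)) :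
    ∫ z in ball1 (0 : Space N), ∑ i, w i z * A i z * B i z
      = ∑ i, wform (w i) (toL2 (A i)) (toL2 (B i)) := by
  rw [integral_finsetSum _ fun i _ => integrable_weight_mul_mul (hw i) (hA i) (hB i)]
  exact Finset.sum_congr rfl fun i _ => (wform_toL2 (hw i) (hA i) (hB i)).symm

theorem integrable_weight_sum {w : Fin N → Space N → ℝ} (hw : ∀ i, Continuous (w i))
    {A B : Fin N → Space N → ℝ} (hA : ∀ i, MemLp (A i) 2 (ballMeasure N))
    (hB : ∀ i, MemLp (B i) 2 (ballMeasure N)) :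
    Integrable (fun z => ∑ i, w i z * A i z * B i z) (ballMeasure N) :=
  integrable_finsetSum _ fun i _ => integrable_weight_mul_mul (hw i) (hA i) (hB i)

/-- The subtracted square removes the part quadratic in b. Only terms linear in the value at the
final time remain, and these can be integrated in time. -/
theorem norm_smul_sub_sq (c : ℝ) (a b : Space N) :
    ‖c • a - b‖ ^ 2 - ‖b‖ ^ 2 = ∑ i, (c ^ 2 * (a i * a i) - 2 * c * (a i * b i)) := by
  rw [EuclideanSpace.real_norm_sq_eq, EuclideanSpace.real_norm_sq_eq, ← Finset.sum_sub_distrib]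
  refine Finset.sum_congr rfl fun i _ => ?_
  simp only [PiLp.sub_apply, PiLp.smul_apply, smul_eq_mul]
  ring

theorem inner_eq_sum (z y : Space N) : inner ℝ z y = ∑ i, z i * y i := by
  rw [PiLp.inner_apply]
  exact Finset.sum_congr rfl fun i _ => by simp [mul_comm]

variable {a b : Space N → ℝ} {A B : Fin N → Space N → ℝ} {GA GB : Space N → Space N}

theorem integral_gradient_term {α : ℝ} (hα : 0 ≤ α) (hA : ∀ i, MemLp (A i) 2 (ballMeasure N))
    (hB : ∀ i, MemLp (B i) 2 (ballMeasure N)) (eA : ∀ᵐ z, ∀ i, GA z i = A i z)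
    (eB : ∀ᵐ z, ∀ i, GB z i = B i z) (g c : ℝ) :
    ∫ z in ball1 (0 : Space N), rho z ^ α * g * (‖c • GA z - GB z‖ ^ 2 - ‖GB z‖ ^ 2)
      = g * ∑ i, (c ^ 2 * wform (rhoPow α) (toL2 (A i)) (toL2 (A i))
        - 2 * c * wform (rhoPow α) (toL2 (A i)) (toL2 (B i))) := by
  have hw : ∀ _ : Fin N, Continuous (rhoPow α : Space N → ℝ) := fun _ => continuous_rhoPow hα
  rw [Finset.sum_sub_distrib, ← Finset.mul_sum, ← Finset.mul_sum, ← integral_weight_sum hw hA hA,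
    ← integral_weight_sum hw hA hB, ← integral_const_mul, ← integral_const_mul, ← integral_sub,
    ← integral_const_mul]
  · refine integral_congr_ae ?_
    filter_upwards [ae_ball_of_ae eA, ae_ball_of_ae eB] with z ⟨hz, h1⟩ ⟨_, h2⟩
    rw [norm_smul_sub_sq, rhoPow_eq hz]
    simp only [h1, h2, Finset.sum_sub_distrib, Finset.mul_sum, mul_sub]
    congr 1 <;> exact Finset.sum_congr rfl fun i _ => by ring
  · exact (integrable_weight_sum hw hA hA).const_mul _
  · exact (integrable_weight_sum hw hA hB).const_mul _

theorem rho_mul_rpow {γ : ℝ} (hγ : 0 < γ) {z : Space N} (hz : z ∈ ball1 (0 : Space N)) :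
    rho z * rho z ^ (γ - 1) = rho z ^ γ := by
  rcases (rho_nonneg hz).eq_or_lt with h | h
  · rw [← h, Real.zero_rpow hγ.ne', zero_mul]
  · rw [← Real.rpow_one_add' h.le (by linarith)]
    ring_nf

theorem integral_divergence_term {γ : ℝ} (hγ : 1 ≤ γ) (ha : MemLp a 2 (ballMeasure N))
    (hb : MemLp b 2 (ballMeasure N)) (g : ℝ) :
    ∫ z in ball1 (0 : Space N), g * ((N : ℝ) * rho z - 2 * γ * ‖z‖ ^ 2) * rho z ^ (γ - 1) *
        ((b z - a z) ^ 2 - b z ^ 2)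
      = g * (wform (divWeight γ) (toL2 a) (toL2 a) - 2 * wform (divWeight γ) (toL2 a) (toL2 b)) := by
  have hw := continuous_divWeight (N := N) hγ
  rw [wform_toL2 hw ha ha, wform_toL2 hw ha hb, ← integral_const_mul, ← integral_sub,
    ← integral_const_mul]
  · refine integral_congr_ae ?_
    filter_upwards [ae_restrict_mem Metric.isClosed_closedBall.measurableSet] with z hz
    rw [divWeight, rhoPow_eq hz, rhoPow_eq hz, ← rho_mul_rpow (γ := γ) (by linarith) hz]
    ring
  · exact integrable_weight_mul_mul hw ha ha
  · exact (integrable_weight_mul_mul hw ha hb).const_mul _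

theorem integral_transport_term {γ : ℝ} (hγ : 0 ≤ γ) (ha : MemLp a 2 (ballMeasure N))
    (hB : ∀ i, MemLp (B i) 2 (ballMeasure N)) (eB : ∀ᵐ z, ∀ i, GB z i = B i z) (g c : ℝ) :
    ∫ z in ball1 (0 : Space N), g * rho z ^ γ *
        ((c * inner ℝ z (GB z) - a z) ^ 2 - (c * inner ℝ z (GB z)) ^ 2)
      = g * wform (rhoPow γ) (toL2 a) (toL2 a)
        - 2 * (g * c * ∑ i, wform (coordWeight γ i) (toL2 a) (toL2 (B i))) := by
  have hw := continuous_rhoPow (N := N) hγ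
  have hc := fun i => continuous_coordWeight (N := N) hγ i
  rw [wform_toL2 hw ha ha, ← integral_weight_sum hc (fun _ => ha) hB, ← integral_const_mul,
    ← integral_const_mul, ← integral_const_mul, ← integral_sub]
  · refine integral_congr_ae ?_
    filter_upwards [ae_ball_of_ae eB] with z ⟨hz, h1⟩
    have e : ∑ i, coordWeight γ i z * a z * B i z = rho z ^ γ * a z * inner ℝ z (GB z) := by
      rw [inner_eq_sum, Finset.mul_sum]
      refine Finset.sum_congr rfl fun i _ => ?_
      rw [h1, coordWeight, rhoPow_eq hz]
      ring
    simp only [e, rhoPow_eq hz]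
    ring
  · exact (integrable_weight_mul_mul hw ha ha).const_mul _
  · exact ((integrable_weight_sum hc (fun _ => ha) hB).const_mul _).const_mul _

theorem memLp_inner (hB : ∀ i, MemLp (B i) 2 (ballMeasure N)) :
    MemLp (fun z => ∑ i, z i * B i z) 2 (ballMeasure N) :=
  memLp_finsetSum _ fun i _ => (hB i).mul' (memLp_top_of_continuous (by fun_prop))

theorem integral_initial_transport_term {γ : ℝ} (hγ : 0 ≤ γ) (ha : MemLp a 2 (ballMeasure N))
    (hB : ∀ i, MemLp (B i) 2 (ballMeasure N)) (eB : ∀ᵐ z, ∀ i, GB z i = B i z) :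
    ∫ z in ball1 (0 : Space N), rho z ^ γ * ((a z - inner ℝ z (GB z)) ^ 2 - a z ^ 2)
      = (∫ z in ball1 (0 : Space N), rhoPow γ z * (∑ i, z i * B i z) * (∑ i, z i * B i z))
        - 2 * ∑ i, wform (coordWeight γ i) (toL2 a) (toL2 (B i)) := by
  have hw := continuous_rhoPow (N := N) hγ
  have hc := fun i => continuous_coordWeight (N := N) hγ i
  rw [← integral_weight_sum hc (fun _ => ha) hB, ← integral_const_mul, ← integral_sub]
  · refine integral_congr_ae ?_
    filter_upwards [ae_ball_of_ae eB] with z ⟨hz, h1⟩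
    have e : ∑ i, coordWeight γ i z * a z * B i z = rho z ^ γ * a z * ∑ i, z i * B i z := by
      rw [Finset.mul_sum]
      refine Finset.sum_congr rfl fun i _ => ?_
      rw [coordWeight, rhoPow_eq hz]
      ring
    have e2 : inner ℝ z (GB z) = ∑ i, z i * B i z := by
      rw [inner_eq_sum]; simp only [h1]
    simp only [e, e2, rhoPow_eq hz]
    ring
  · exact integrable_weight_mul_mul hw (memLp_inner hB) (memLp_inner hB)
  · exact (integrable_weight_sum hc (fun _ => ha) hB).const_mul _

theorem integral_inner_sq_le {γ : ℝ} (hγ : 0 ≤ γ) (hB : ∀ i, MemLp (B i) 2 (ballMeasure N)) :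
    ∫ z in ball1 (0 : Space N), rhoPow γ z * (∑ i, z i * B i z) * (∑ i, z i * B i z)
      ≤ ∑ i, ‖toL2 (B i)‖ ^ 2 := by
  have hw := continuous_rhoPow (N := N) hγ
  simp only [← wform_one_self]
  rw [← integral_weight_sum (fun _ => continuous_const) hB hB]
  refine integral_mono_ae (integrable_weight_mul_mul hw (memLp_inner hB) (memLp_inner hB))
    (integrable_weight_sum (fun _ => continuous_const) hB hB) ?_
  filter_upwards [ae_restrict_mem Metric.isClosed_closedBall.measurableSet] with z hz
  have h1 : ‖z‖ ≤ 1 := by simpa using hz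
  have h2 : (∑ i, z i * B i z) ^ 2 ≤ (∑ i, z i ^ 2) * ∑ i, B i z ^ 2 :=
    Finset.sum_mul_sq_le_sq_mul_sq _ _ _
  have h3 : ∑ i, z i ^ 2 ≤ 1 := by
    rw [← EuclideanSpace.real_norm_sq_eq]; exact pow_le_one₀ (norm_nonneg z) h1
  have h4 : 0 ≤ ∑ i, B i z ^ 2 := Finset.sum_nonneg fun i _ => sq_nonneg _
  have h5 : (∑ i, z i * B i z) ^ 2 ≤ ∑ i, B i z ^ 2 := h2.trans (mul_le_of_le_one_left h4 h3)
  calc rhoPow γ z * (∑ i, z i * B i z) * (∑ i, z i * B i z)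
      = rhoPow γ z * (∑ i, z i * B i z) ^ 2 := by ring
    _ ≤ 1 * (∑ i, z i * B i z) ^ 2 :=
        mul_le_mul_of_nonneg_right (rhoPow_le_one hγ z) (sq_nonneg _)
    _ ≤ ∑ i, 1 * B i z * B i z := by
        rw [one_mul]; refine h5.trans (le_of_eq (Finset.sum_congr rfl fun i _ => by ring))

end Terms

/-! ### The energy equals the reduced energy up to a constant. -/

section EnergyFormula

variable {N : ℕ} {p T : ℝ} {u₀ u₁ : Space N → ℝ} {u v : ℝ → Space N → ℝ}

theorem theta_zero (β T : ℝ) (v : ℝ → Space N → ℝ) (s : ℝ) :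
    theta β T v 0 s = fun z => Real.exp (-(β * s)) * v (physTime T s) z := by
  funext z; rw [theta, zero_add, physTime]

theorem theta00_zero (β T : ℝ) (u₀ : Space N → ℝ) :
    theta00 β T u₀ 0 = fun z => T ^ (β + 1) * u₀ z := by
  funext z; rw [theta00, zero_add]

theorem gOne_start {β T : ℝ} (hT : 0 < T) : gOne β (-Real.log T) * T ^ (β + 1) = 1 := by
  rw [gOne, Real.rpow_def_of_pos hT, ← Real.exp_add]
  ring_nf; exact Real.exp_zero

/-- The constant K collects the two terms quadratic in the initial gradient, which do not involve s.
The initial terms linear in θ(s) become the pairings with Q at the initial time, because g(s₀)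
T^{β+1} = 1. -/
theorem IsSolution.energy_eq (h : IsSolution p T u₀ u₁ u v) (hN : 1 ≤ N) (hp : 1 < p)
    {β α : ℝ} (hβ : β = 1 / (p - 1)) (hα : 2 < α) {M : ℝ≥0} (hadm : Admissible p T M u₀ u₁ v)
    (hT : 0 < T) :
    ∃ K ≤ (1 / 2 + α) * T ^ (β + 1) *
        ∑ i, ‖(h.curves hN hp hβ hα hadm hT).Q i (-Real.log T)‖ ^ 2,
      ∀ s, -Real.log T ≤ s →
        energy p β α (-Real.log T) (theta β T v 0) (theta00 β T u₀ 0) s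
          = (h.curves hN hp hβ hα hadm hT).reducedEnergy s + K := by
  set c := h.curves hN hp hβ hα hadm hT with hc
  have hα0 : 0 ≤ α := by linarith
  have ht : ∀ {s}, -Real.log T ≤ s → physTime T s ∈ Ico 0 T := fun hs => physTime_mem_Ico hT hs
  have mθ : ∀ {s}, -Real.log T ≤ s → MemLp (theta β T v 0 s) 2 (ballMeasure N) := fun {s} hs => by
    rw [theta_zero]; exact (h.memLp_v (ht hs)).const_mul _
  have eθ : ∀ {s}, -Real.log T ≤ s → toL2 (theta β T v 0 s) = c.θ s := fun {s} hs => by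
    rw [theta_zero]; exact toL2_const_mul (h.memLp_v (ht hs)) (Real.exp (-(β * s)))
  set G : ℝ → Fin N → Space N → ℝ := fun s i z =>
    Real.exp (-(β * s)) * weakPartial i (v (physTime T s)) z with hG
  have mG : ∀ {s}, -Real.log T ≤ s → ∀ i, MemLp (G s i) 2 (ballMeasure N) := fun {s} hs i =>
    (h.memLp_weakPartial_v i (ht hs)).const_mul _
  have eG : ∀ {s}, -Real.log T ≤ s → ∀ i, toL2 (G s i) = c.D i s := fun {s} hs i =>
    toL2_const_mul (h.memLp_weakPartial_v i (ht hs)) (Real.exp (-(β * s)))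
  have aG : ∀ s, ∀ᵐ z, ∀ i, weakGrad (theta β T v 0 s) z i = G s i z := fun s => by
    refine ae_all_iff.2 fun i => ?_
    rw [theta_zero]
    exact weakPartial_const_mul i _ (Real.exp_pos _).ne'
  have h0 : (0 : ℝ) ∈ Ico 0 T := ⟨le_rfl, hT⟩
  set Z : Fin N → Space N → ℝ := fun i z => T ^ (β + 1) * weakPartial i (u 0) z with hZ
  have mZ : ∀ i, MemLp (Z i) 2 (ballMeasure N) := fun i =>
    (h.memLp_weakPartial_u i h0).const_mul _
  have eZ : ∀ i, toL2 (Z i) = T ^ (β + 1) • c.Q i (-Real.log T) := fun i => by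
    have : c.Q i (-Real.log T) = toL2 (weakPartial i (u 0)) := by
      show toL2 (weakPartial i (u (physTime T (-Real.log T)))) = _
      rw [physTime_start hT]
    rw [this]
    exact toL2_const_mul (h.memLp_weakPartial_u i h0) _
  have aZ : ∀ᵐ z, ∀ i, weakGrad (theta00 β T u₀ 0) z i = Z i z := by
    refine ae_all_iff.2 fun i => ?_
    rw [theta00_zero]
    simp only [hZ, weakPartial_congr i h.init_u]
    exact weakPartial_const_mul i _ (Real.rpow_pos_of_pos hT _).ne'
  have hg0 : gOne β (-Real.log T) * T ^ (β + 1) = 1 := gOne_start hT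
  have hg0' : 0 < gOne β (-Real.log T) := Real.exp_pos _
  have hTβ : 0 < T ^ (β + 1) := Real.rpow_pos_of_pos hT _
  refine ⟨1 / 2 * gOne β (-Real.log T) * ∑ i, wform (rhoPow α) (toL2 (Z i)) (toL2 (Z i))
    + α * gOne β (-Real.log T) * ∫ z in ball1 (0 : Space N),
      rhoPow (α - 1) z * (∑ i, z i * Z i z) * (∑ i, z i * Z i z), ?_, fun s hs => ?_⟩
  · have k1 : ∑ i, wform (rhoPow α) (toL2 (Z i)) (toL2 (Z i)) ≤ ∑ i, ‖toL2 (Z i)‖ ^ 2 :=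
      Finset.sum_le_sum fun i _ => by
        rw [← wform_one_self]
        exact wform_self_mono (continuous_rhoPow hα0) continuous_const
          (fun z _ => rhoPow_le_one hα0 z) _
    have k2 := integral_inner_sq_le (by linarith : 0 ≤ α - 1) mZ
    have k3 : ∑ i, ‖toL2 (Z i)‖ ^ 2 = T ^ (β + 1) * T ^ (β + 1) * ∑ i, ‖c.Q i (-Real.log T)‖ ^ 2 := by
      rw [Finset.mul_sum]
      refine Finset.sum_congr rfl fun i _ => ?_
      rw [eZ, norm_smul, Real.norm_of_nonneg hTβ.le]; ring
    calc _ ≤ 1 / 2 * gOne β (-Real.log T) * ∑ i, ‖toL2 (Z i)‖ ^ 2 + α * gOne β (-Real.log T) * ∑ i, ‖toL2 (Z i)‖ ^ 2 := by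
          gcongr
      _ = (1 / 2 + α) * (gOne β (-Real.log T) * T ^ (β + 1)) * (T ^ (β + 1) * ∑ i, ‖c.Q i (-Real.log T)‖ ^ 2) := by
          rw [k3]; ring
      _ = _ := by rw [hg0]; ring
  have t1 : ∫ z in ball1 (0 : Space N), gOne β s * rho z ^ α * theta β T v 0 s z ^ 2
      = gOne β s * wform (rhoPow α) (c.θ s) (c.θ s) := by
    rw [← eθ hs, wform_toL2 (continuous_rhoPow hα0) (mθ hs) (mθ hs), ← integral_const_mul]
    refine setIntegral_congr_fun Metric.isClosed_closedBall.measurableSet fun z hz => ?_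
    simp only [rhoPow_eq hz]; ring
  have t2 : ∫ z in ball1 (0 : Space N), gOne β s * rho z ^ α * |theta β T v 0 s z| ^ (p + 1)
      = gOne β s * wform (rhoPow α) (c.n s) (c.θ s) := by
    have mn : MemLp (fun z => Real.exp (-((β + 1) * s)) * nl p (v (physTime T s) z)) 2
        (ballMeasure N) := (h.memLp_nl hN hp hadm (ht hs)).const_mul _
    have en : c.n s = toL2 (fun z => Real.exp (-((β + 1) * s)) * nl p (v (physTime T s) z)) :=
      (toL2_const_mul (h.memLp_nl hN hp hadm (ht hs)) (Real.exp (-((β + 1) * s)))).symm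
    rw [← eθ hs, en, wform_toL2 (continuous_rhoPow hα0) mn (mθ hs), ← integral_const_mul]
    refine setIntegral_congr_fun Metric.isClosed_closedBall.measurableSet fun z hz => ?_
    -- The identity β + 1 = βp makes the rescaled nonlinearity equal to the nonlinearity of θ.
    have hβp : (β + 1) = β * p := by
      rw [hβ]; field_simp [show p - 1 ≠ 0 by linarith]; ring
    have e1 : Real.exp (-((β + 1) * s)) * nl p (v (physTime T s) z)
        = nl p (theta β T v 0 s z) := by
      rw [theta_zero, nl_const_mul _ (Real.exp_pos _), ← Real.exp_mul, hβp]
      · ring_nf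
      · exact hp
    simp only [rhoPow_eq hz, e1]
    rw [← nl_mul_self hp]; ring
  have t3 : ∫ τ in (-Real.log T)..s, ∫ z in ball1 (0 : Space N), rho z ^ α * gTwo β τ *
        (‖(4 : ℝ) • weakGrad (theta β T v 0 τ) z - weakGrad (theta β T v 0 s) z‖ ^ 2
          - ‖weakGrad (theta β T v 0 s) z‖ ^ 2)
      = ∫ τ in (-Real.log T)..s, gTwo β τ * ∑ i, (16 * wform (rhoPow α) (c.D i τ) (c.D i τ)
          - 8 * wform (rhoPow α) (c.D i τ) (c.D i s)) := by
    refine intervalIntegral.integral_congr fun τ hτ => ?_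
    rw [uIcc_of_le hs] at hτ
    simp only [integral_gradient_term hα0 (mG hτ.1) (mG hs) (aG τ) (aG s), eG hτ.1, eG hs]
    norm_num
  have t4 : ∫ τ in (-Real.log T)..s, ∫ z in ball1 (0 : Space N),
      gTwo β τ * ((N : ℝ) * rho z - 2 * (α - 1) * ‖z‖ ^ 2) * rho z ^ (α - 2) *
        ((theta β T v 0 s z - theta β T v 0 τ z) ^ 2 - theta β T v 0 s z ^ 2)
      = ∫ τ in (-Real.log T)..s, gTwo β τ * (wform (divWeight (α - 1)) (c.θ τ) (c.θ τ)
          - 2 * wform (divWeight (α - 1)) (c.θ τ) (c.θ s)) := by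
    refine intervalIntegral.integral_congr fun τ hτ => ?_
    rw [uIcc_of_le hs] at hτ
    have := integral_divergence_term (by linarith : 1 ≤ α - 1) (mθ hτ.1) (mθ hs) (gTwo β τ)
    rw [eθ hτ.1, eθ hs, show α - 1 - 1 = α - 2 by ring] at this
    exact this
  have t5 : ∫ τ in (-Real.log T)..s, ∫ z in ball1 (0 : Space N),
      gOne β τ * rho z ^ (α - 1) *
        ((Real.exp (-2 * τ) * inner ℝ z (weakGrad (theta β T v 0 s) z) - theta β T v 0 τ z) ^ 2
          - (Real.exp (-2 * τ) * inner ℝ z (weakGrad (theta β T v 0 s) z)) ^ 2)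
      = ∫ τ in (-Real.log T)..s, (gOne β τ * wform (rhoPow (α - 1)) (c.θ τ) (c.θ τ)
          - 2 * (gTwo β τ * ∑ i, wform (coordWeight (α - 1) i) (c.θ τ) (c.D i s))) := by
    refine intervalIntegral.integral_congr fun τ hτ => ?_
    rw [uIcc_of_le hs] at hτ
    have := integral_transport_term (by linarith : 0 ≤ α - 1) (mθ hτ.1) (mG hs) (aG s) (gOne β τ)
      (Real.exp (-2 * τ))
    have eg : gOne β τ * Real.exp (-2 * τ) = gTwo β τ := by
      rw [gOne, gTwo, ← Real.exp_add]; ring_nf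
    simp only [eθ hτ.1, eG hs, eg] at this
    exact this
  have t6 : ∫ z in ball1 (0 : Space N), rho z ^ α *
      (‖weakGrad (theta β T v 0 s) z + weakGrad (theta00 β T u₀ 0) z‖ ^ 2
        - ‖weakGrad (theta β T v 0 s) z‖ ^ 2)
      = ∑ i, wform (rhoPow α) (toL2 (Z i)) (toL2 (Z i))
        + 2 * ∑ i, wform (rhoPow α) (c.D i s) (toL2 (Z i)) := by
    -- A sum of gradients is, up to sign, -∇θ₀₀ - ∇θ(s), so the expansion applies with scalar -1.
    have := integral_gradient_term hα0 mZ (mG hs) aZ (aG s) 1 (-1)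
    have e : ∀ x y : Space N, ‖(-1 : ℝ) • x - y‖ = ‖y + x‖ := fun x y => by
      rw [← norm_neg]; congr 1; rw [neg_one_smul]; abel
    simp only [e, mul_one, one_mul, eG hs, Finset.sum_sub_distrib] at this
    rw [this, ← Finset.mul_sum, ← Finset.mul_sum]
    simp only [wform_comm (continuous_rhoPow (N := N) hα0) (c.D _ s)]
    ring
  have t7 := integral_initial_transport_term (by linarith : 0 ≤ α - 1) (mθ hs) mZ aZ
  rw [energy, t1, t2, t3, t4, t5, t6, t7, ← c.expanded_energy_eq hα hs]
  simp only [eθ hs]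
  have q1 : ∀ i, wform (rhoPow α) (c.D i s) (c.Q i (-Real.log T))
      = gOne β (-Real.log T) * wform (rhoPow α) (c.D i s) (toL2 (Z i)) := fun i => by
    rw [eZ, map_smul, smul_eq_mul, ← mul_assoc, hg0, one_mul]
  have q2 : ∀ i, wform (coordWeight (α - 1) i) (c.θ s) (c.Q i (-Real.log T))
      = gOne β (-Real.log T) * wform (coordWeight (α - 1) i) (c.θ s) (toL2 (Z i)) := fun i => by
    rw [eZ, map_smul, smul_eq_mul, ← mul_assoc, hg0, one_mul]
  simp only [q1, q2, ← Finset.mul_sum]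
  ring

end EnergyFormula

/-! ### Scalar estimates for the exponential weights. -/

section Scalar

/-- Adding the values at both endpoints handles every sign of γ at once, so later constants depend
on T only through its bounds. -/
theorem rpow_le_add_of_mem {Tmin Tmax T : ℝ} (h0 : 0 < Tmin) (h1 : Tmin ≤ T) (h2 : T ≤ Tmax)
    (γ : ℝ) : T ^ γ ≤ Tmin ^ γ + Tmax ^ γ := by
  have hT : 0 < T := h0.trans_le h1
  have a := (Real.rpow_pos_of_pos h0 γ).le
  have b := (Real.rpow_pos_of_pos (hT.trans_le h2) γ).le
  rcases le_total 0 γ with h | h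
  · linarith [Real.rpow_le_rpow hT.le h2 h]
  · linarith [Real.rpow_le_rpow_of_nonpos h0 h1 h]

/-- The total mass of the kernel `g₂` on `[s₀, s]`. -/
noncomputable def gTwoMass (β s₀ s : ℝ) : ℝ := ∫ τ in s₀..s, gTwo β τ

/-- For τ ≤ s the product e^{-2βs} g₂(τ) is at most e^{-(β+1)τ}, which is integrable at infinity.
The sign of β - 1 plays no role. -/
theorem exp_mul_gTwoMass_le {β T : ℝ} (hβ : 0 < β) (hT : 0 < T) {s : ℝ} (hs : -Real.log T ≤ s) :
    Real.exp (-(2 * β * s)) * gTwoMass β (-Real.log T) s ≤ T ^ (β + 1) / (β + 1) := by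
  have hb : β + 1 ≠ 0 := by linarith
  have hd : ∀ τ, HasDerivAt (fun τ => -(Real.exp (-((β + 1) * τ)) / (β + 1)))
      (Real.exp (-((β + 1) * τ))) τ := fun τ => by
    have := ((hasDerivAt_exp_neg_mul (β + 1) τ).div_const (β + 1)).neg
    refine this.congr_deriv ?_
    field_simp
  have hi := intervalIntegral.integral_eq_sub_of_hasDerivAt (a := -Real.log T) (b := s)
    (fun τ _ => hd τ) (Continuous.intervalIntegrable (by fun_prop) _ _)
  have e : Real.exp (-((β + 1) * (-Real.log T))) = T ^ (β + 1) := by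
    rw [Real.rpow_def_of_pos hT]; ring_nf
  calc Real.exp (-(2 * β * s)) * gTwoMass β (-Real.log T) s
      = ∫ τ in (-Real.log T)..s, Real.exp (-(2 * β * s)) * gTwo β τ := by
        rw [gTwoMass, intervalIntegral.integral_const_mul]
    _ ≤ ∫ τ in (-Real.log T)..s, Real.exp (-((β + 1) * τ)) := by
        refine intervalIntegral.integral_mono_on hs
          ((EnergyCurves.continuous_gTwo.const_mul _).intervalIntegrable _ _)
          (Continuous.intervalIntegrable (by fun_prop) _ _) fun τ hτ => ?_
        rw [gTwo, ← Real.exp_add]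
        refine Real.exp_le_exp.2 ?_
        nlinarith [hτ.2]
    _ ≤ T ^ (β + 1) / (β + 1) := by
        rw [hi, e]
        have : 0 ≤ Real.exp (-((β + 1) * s)) / (β + 1) := by positivity
        linarith

theorem gTwo_le_gOne {β T : ℝ} (hT : 0 < T) {τ : ℝ} (hτ : -Real.log T ≤ τ) :
    gTwo β τ ≤ T ^ 2 * gOne β τ := by
  have e : T ^ 2 = Real.exp (2 * Real.log T) := by
    rw [mul_comm, Real.exp_mul, Real.exp_log hT]; norm_num
  rw [gTwo, gOne, e, ← Real.exp_add]
  exact Real.exp_le_exp.2 (by nlinarith)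

end Scalar

/-! ### A Cauchy-Schwarz estimate for time primitives. -/

section Duality

variable {N : ℕ}

theorem neg_two_mul_wform_le {w : Space N → ℝ} (hw : Continuous w) (h0 : ∀ z, 0 ≤ w z)
    (f g : BallL2 N) : -(2 * wform w f g) ≤ wform w f f + wform w g g := by
  have := wform_self_nonneg hw (fun z _ => h0 z) (f + g)
  simp only [map_add, add_apply] at this
  rw [wform_comm hw g f] at this
  linarith

theorem two_mul_wform_le {w : Space N → ℝ} (hw : Continuous w) (h0 : ∀ z, 0 ≤ w z)
    (f g : BallL2 N) {l : ℝ} (hl : 0 < l) :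
    2 * wform w f g ≤ l * wform w f f + l⁻¹ * wform w g g := by
  have := wform_self_nonneg hw (fun z _ => h0 z) (l • f - g)
  simp only [map_sub, map_smul, sub_apply, smul_apply, smul_eq_mul] at this
  rw [wform_comm hw g f] at this
  have h2 : 0 ≤ l⁻¹ * (l * (l * wform w f f) - l * wform w f g - (l * wform w f g - wform w g g)) := by
    refine mul_nonneg (inv_nonneg.2 hl.le) ?_
    linarith
  have h3 : l⁻¹ * (l * (l * wform w f f) - l * wform w f g - (l * wform w f g - wform w g g))
      = l * wform w f f + l⁻¹ * wform w g g - 2 * wform w f g := by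
    field_simp; ring
  linarith

theorem wform_self_le_norm_sq {w : Space N → ℝ} (hw : Continuous w) (h1 : ∀ z, w z ≤ 1)
    (f : BallL2 N) : wform w f f ≤ ‖f‖ ^ 2 := by
  rw [← wform_one_self]
  exact wform_self_mono hw continuous_const (fun z _ => h1 z) f

/-- Duality estimate for a time primitive. -/
theorem wform_primitive_le {w : Space N → ℝ} (hw : Continuous w) (h0 : ∀ z, 0 ≤ w z)
    {β s₀ s : ℝ} (hs : s₀ ≤ s) {Y : ℝ → BallL2 N} (hY : ContinuousOn Y (Ici s₀)) {X : BallL2 N}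
    (hX : ∫ τ in s₀..s, gTwo β τ * wform w (Y τ) X = wform w X X) :
    wform w X X ≤ gTwoMass β s₀ s * ∫ τ in s₀..s, gTwo β τ * wform w (Y τ) (Y τ) := by
  rcases hs.eq_or_lt with rfl | hlt
  · rw [intervalIntegral.integral_same] at hX
    rw [← hX]; simp
  have hA : 0 < gTwoMass β s₀ s :=
    intervalIntegral.intervalIntegral_pos_of_pos
      (EnergyCurves.continuous_gTwo.intervalIntegrable _ _) (fun x => Real.exp_pos _) hlt
  have g2 : ContinuousOn (gTwo β) (Ici s₀) := EnergyCurves.continuous_gTwo.continuousOn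
  have i1 : IntervalIntegrable (fun τ => gTwo β τ * wform w (Y τ) X) volume s₀ s :=
    intervalIntegrable_of_continuousOn_Ici
      (g2.mul (continuousOn_wform hY continuousOn_const)) hs
  have i2 : IntervalIntegrable (fun τ => gTwo β τ * wform w (Y τ) (Y τ)) volume s₀ s :=
    intervalIntegrable_of_continuousOn_Ici (g2.mul (continuousOn_wform hY hY)) hs
  have i3 : IntervalIntegrable (gTwo β) volume s₀ s :=
    EnergyCurves.continuous_gTwo.intervalIntegrable _ _
  set A := gTwoMass β s₀ s with hAdef
  -- Young's parameter is the total mass A of the kernel. After integration its second term is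
  -- exactly one copy of the form at X, absorbed by the two copies on the left.
  have key : ∫ τ in s₀..s, 2 * (gTwo β τ * wform w (Y τ) X)
      ≤ ∫ τ in s₀..s, (A * (gTwo β τ * wform w (Y τ) (Y τ)) + (A⁻¹ * wform w X X) * gTwo β τ) := by
    refine intervalIntegral.integral_mono_on hs (i1.const_mul 2)
      ((i2.const_mul A).add (i3.const_mul _)) fun τ _ => ?_
    have := mul_le_mul_of_nonneg_left (two_mul_wform_le hw h0 (Y τ) X hA) (Real.exp_pos ((β - 1) * τ)).le
    rw [gTwo]
    linarith
  rw [intervalIntegral.integral_add (i2.const_mul A) (i3.const_mul _),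
    intervalIntegral.integral_const_mul, intervalIntegral.integral_const_mul,
    intervalIntegral.integral_const_mul, hX, ← gTwoMass, ← hAdef] at key
  have : A⁻¹ * wform w X X * A = wform w X X := by field_simp
  linarith

end Duality

/-! ### The integrated dissipation bound. -/

section Dissipation

variable {N : ℕ} {p T : ℝ} {u₀ u₁ : Space N → ℝ} {u v : ℝ → Space N → ℝ}

theorem norm_toL2_le {f : Space N → ℝ} (hf : MemLp f 2 (ballMeasure N)) {M : ℝ≥0}
    (h : eLpNorm f 2 (ballMeasure N) ≤ M) : ‖toL2 f‖ ≤ M := by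
  have : ‖toL2 f‖ₑ ≤ M := by rw [enorm_toL2 hf]; exact h
  exact_mod_cast (enorm_le_coe.1 this)

theorem Admissible.ulocNorm_le {M : ℝ≥0} (hadm : Admissible p T M u₀ u₁ v) :
    ulocNorm 2 2 u₀ ≤ M ∧ ulocNorm 2 1 u₁ ≤ M := by
  rcases hadm with ⟨⟨-, -, h⟩, -⟩ | ⟨⟨-, -, -, -, h⟩, -⟩
  · exact ⟨le_self_add.trans h, le_add_self.trans h⟩
  · exact ⟨(le_add_self.trans (le_self_add.trans le_self_add)).trans h, le_add_self.trans h⟩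

theorem eLpNorm_weakPartial_weakPartial_le (i : Fin N) (f : Space N → ℝ) :
    eLpNorm (weakPartial i (weakPartial i f)) 2 (ballMeasure N) ≤ sobolevNorm 2 (ball1 0) 2 f :=
  (sobolevNorm_weakPartial_le 2 (ball1 0) 0 _ i).trans (sobolevNorm_weakPartial_le 2 (ball1 0) 1 _ i)

theorem IsSolution.initial_norms (h : IsSolution p T u₀ u₁ u v) {M : ℝ≥0}
    (hadm : Admissible p T M u₀ u₁ v) (hT : 0 < T) :
    ‖toL2 (v 0)‖ ≤ M ∧ (∀ i, ‖toL2 (weakPartial i (u 0))‖ ≤ M) ∧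
      ‖toL2 (weakLaplacian (u 0))‖ ≤ N * M := by
  have h0 : (0 : ℝ) ∈ Ico 0 T := ⟨le_rfl, hT⟩
  obtain ⟨hu, hv⟩ := hadm.ulocNorm_le
  have su : sobolevNorm 2 (ball1 0) 2 (u 0) ≤ M := by
    rw [sobolevNorm_congr 2 _ 2 h.init_u]
    exact (le_iSup (fun x => sobolevNorm 2 (ball1 x) 2 u₀) 0).trans hu
  have sv : sobolevNorm 2 (ball1 0) 1 (v 0) ≤ M := by
    rw [sobolevNorm_congr 2 _ 1 h.init_v]
    exact (le_iSup (fun x => sobolevNorm 2 (ball1 x) 1 u₁) 0).trans hv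
  refine ⟨norm_toL2_le (h.memLp_v h0) ((eLpNorm_le_sobolevNorm 2 _ 1 _).trans sv),
    fun i => norm_toL2_le (h.memLp_weakPartial_u i h0)
      ((eLpNorm_le_sobolevNorm 2 _ 1 _).trans ((sobolevNorm_weakPartial_le 2 _ 1 _ i).trans su)), ?_⟩
  rw [(h.mem_u 0 h0).toL2_weakLaplacian]
  refine (norm_sum_le _ _).trans ?_
  have : ∀ i ∈ Finset.univ, ‖toL2 (weakPartial i (weakPartial i (u 0)))‖ ≤ (M : ℝ) := fun i _ =>
    norm_toL2_le ((((h.mem_u 0 h0).weakPartial i).weakPartial i).memLp one_le_two 1)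
      ((eLpNorm_weakPartial_weakPartial_le i _).trans su)
  simpa using Finset.sum_le_card_nsmul _ _ _ this

variable {β α : ℝ} {M : ℝ≥0}

theorem IsSolution.wform_n_nonneg (h : IsSolution p T u₀ u₁ u v) (hN : 1 ≤ N) (hp : 1 < p)
    (hβ : β = 1 / (p - 1)) (hα : 2 < α) (hadm : Admissible p T M u₀ u₁ v) (hT : 0 < T) {s : ℝ}
    (hs : -Real.log T ≤ s) :
    0 ≤ wform (rhoPow α) ((h.curves hN hp hβ hα hadm hT).n s)
      ((h.curves hN hp hβ hα hadm hT).θ s) := by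
  have ht := physTime_mem_Ico hT hs
  show 0 ≤ wform (rhoPow α) (Real.exp (-((β + 1) * s)) • toL2 (fun x => nl p (v (physTime T s) x)))
    (Real.exp (-(β * s)) • toL2 (v (physTime T s)))
  rw [map_smul, map_smul, smul_apply,
    wform_toL2 (continuous_rhoPow (by linarith)) (h.memLp_nl hN hp hadm ht) (h.memLp_v ht),
    smul_eq_mul, smul_eq_mul]
  refine mul_nonneg (Real.exp_pos _).le (mul_nonneg (Real.exp_pos _).le ?_)
  refine setIntegral_nonneg Metric.isClosed_closedBall.measurableSet fun z _ => ?_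
  rw [mul_assoc, nl_mul_self hp]
  exact mul_nonneg (rhoPow_nonneg _ _) (Real.rpow_nonneg (abs_nonneg _) _)

/-- The coercive part of the dissipation. -/
noncomputable def EnergyCurves.coercive {s₀ : ℝ} (c : EnergyCurves N p β α s₀) (s : ℝ) : ℝ :=
  gOne β s * wform (rhoPow α) (c.θ s) (c.θ s) + gOne β s * wform (rhoPow α) (c.θ' s) (c.θ' s)
    + gTwo β s * ∑ i, wform (rhoPow α) (c.D i s) (c.D i s)

theorem EnergyCurves.continuousOn_coercive {s₀ : ℝ} (c : EnergyCurves N p β α s₀) :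
    ContinuousOn c.coercive (Ici s₀) := by
  have g1 : ContinuousOn (gOne β) (Ici s₀) := continuous_gOne.continuousOn
  have g2 : ContinuousOn (gTwo β) (Ici s₀) := continuous_gTwo.continuousOn
  exact ((g1.mul (continuousOn_wform c.contθ c.contθ)).add
    (g1.mul (continuousOn_wform c.continuousOn_θ' c.continuousOn_θ'))).add
    (g2.mul (continuousOn_finsetSum _ fun i _ => continuousOn_wform (c.contD i) (c.contD i)))

/-- As ρ ≤ 1, lowering the exponent from α to α - 1 increases the weight. The zero-order coefficient
is thus at least α - β(β+1)/2 > 0. The potential term is nonnegative and is dropped. -/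
theorem IsSolution.coercive_le (h : IsSolution p T u₀ u₁ u v) (hN : 1 ≤ N) (hp : 1 < p)
    (hβ : β = 1 / (p - 1)) (hα₁ : β * (β + 1) / 2 < α) (hα : 2 < α)
    (hadm : Admissible p T M u₀ u₁ v) (hT : 0 < T) {s : ℝ} (hs : -Real.log T ≤ s) :
    min 1 (α - β * (β + 1) / 2) * (h.curves hN hp hβ hα hadm hT).coercive s
      ≤ (h.curves hN hp hβ hα hadm hT).dissipation s := by
  have hβ0 : 0 < β := by rw [hβ]; exact one_div_pos.2 (by linarith)
  have hn := h.wform_n_nonneg hN hp hβ hα hadm hT hs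
  set c := h.curves hN hp hβ hα hadm hT
  set κ := min 1 (α - β * (β + 1) / 2) with hκ
  have k0 : 0 ≤ κ := le_min zero_le_one (by linarith)
  have k1 : κ ≤ 1 := min_le_left _ _
  have k2 : κ ≤ α - β * (β + 1) / 2 := min_le_right _ _
  have hw : Continuous (rhoPow α : Space N → ℝ) := continuous_rhoPow (by linarith)
  have nn : ∀ f : BallL2 N, 0 ≤ wform (rhoPow α) f f := fun f =>
    wform_self_nonneg hw (fun z _ => rhoPow_nonneg α z) f
  have g1 : 0 < gOne β s := Real.exp_pos _
  have g2 : 0 < gTwo β s := Real.exp_pos _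
  have m1 : wform (rhoPow α) (c.θ s) (c.θ s) ≤ wform (rhoPow (α - 1)) (c.θ s) (c.θ s) :=
    wform_self_mono hw (continuous_rhoPow (by linarith))
      (fun z _ => rhoPow_le_rhoPow (by linarith) (by linarith) z) _
  have a1 : κ * (gOne β s * wform (rhoPow α) (c.θ s) (c.θ s))
      ≤ gOne β s * (α * wform (rhoPow (α - 1)) (c.θ s) (c.θ s)
      - β * (β + 1) / 2 * wform (rhoPow α) (c.θ s) (c.θ s)) := by
    have : κ * wform (rhoPow α) (c.θ s) (c.θ s) ≤ α * wform (rhoPow (α - 1)) (c.θ s) (c.θ s)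
      - β * (β + 1) / 2 * wform (rhoPow α) (c.θ s) (c.θ s) := by
      have x1 := mul_le_mul_of_nonneg_right k2 (nn (c.θ s))
      have x2 := mul_le_mul_of_nonneg_left m1 (by linarith : 0 ≤ α)
      linarith
    calc _ = gOne β s * (κ * wform (rhoPow α) (c.θ s) (c.θ s)) := by ring
      _ ≤ _ := mul_le_mul_of_nonneg_left this g1.le
  have a2 : κ * (gOne β s * wform (rhoPow α) (c.θ' s) (c.θ' s))
      ≤ gOne β s * wform (rhoPow α) (c.θ' s) (c.θ' s) :=
    mul_le_of_le_one_left (mul_nonneg g1.le (nn _)) k1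
  have a3 : κ * (gTwo β s * ∑ i, wform (rhoPow α) (c.D i s) (c.D i s))
      ≤ gTwo β s * ∑ i, wform (rhoPow α) (c.D i s) (c.D i s) :=
    mul_le_of_le_one_left (mul_nonneg g2.le (Finset.sum_nonneg fun i _ => nn _)) k1
  have a4 : 0 ≤ (β + 1) / (p + 1) * (gOne β s * wform (rhoPow α) (c.n s) (c.θ s)) :=
    mul_nonneg (div_nonneg (by linarith) (by linarith)) (mul_nonneg g1.le hn)
  rw [EnergyCurves.coercive, EnergyCurves.dissipation]
  linarith

/-- The lower energy bound at the origin. -/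
def EnergyBoundedBelow (p β α T E₀ : ℝ) (u₀ : Space N → ℝ) (v : ℝ → Space N → ℝ) : Prop :=
  ∀ s, -Real.log T ≤ s →
    E₀ ≤ energy p β α (-Real.log T) (theta β T v 0) (theta00 β T u₀ 0) s

/-- The integral of the dissipation is the drop of the reduced energy. Its final value is bounded
below through E₀ and the upper bound on K, and its initial value is bounded above through M. -/
theorem exists_integral_coercive_le (hN : 1 ≤ N) (hp : 1 < p) (hβ : β = 1 / (p - 1))
    (hα₁ : β * (β + 1) / 2 < α) (hα : 2 < α) {Tmin : ℝ} (Tmax : ℝ) (hTmin : 0 < Tmin) (M : ℝ≥0)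
    (E₀ : ℝ) :
    ∃ C : ℝ, ∀ T, (h1 : Tmin ≤ T) → T ≤ Tmax → ∀ (u₀ u₁ : Space N → ℝ) (u v : ℝ → Space N → ℝ)
      (h : IsSolution p T u₀ u₁ u v) (hadm : Admissible p T M u₀ u₁ v),
      EnergyBoundedBelow p β α T E₀ u₀ v → ∀ s, -Real.log T ≤ s →
        ∫ τ in (-Real.log T)..s,
          (h.curves hN hp hβ hα hadm (hTmin.trans_le h1)).coercive τ ≤ C := by
  have hβ0 : 0 < β := by rw [hβ]; exact one_div_pos.2 (by linarith)
  set κ := min 1 (α - β * (β + 1) / 2) with hκ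
  have k0 : 0 < κ := lt_min one_pos (by linarith)
  set B : ℝ → ℝ := fun γ => Tmin ^ γ + Tmax ^ γ with hB
  refine ⟨κ⁻¹ * (β / 2 * (B (β - 1) * M ^ 2) + (B (2 * β) * M ^ 2 + (N * M) ^ 2)
    + (1 / 2 + α) * B (β + 1) * (N * M ^ 2) - E₀), ?_⟩
  intro T h1 h2 u₀ u₁ u v h hadm hE s hs
  have hT : 0 < T := hTmin.trans_le h1
  have hB' : ∀ γ, T ^ γ ≤ B γ := rpow_le_add_of_mem hTmin h1 h2
  obtain ⟨n1, n2, n3⟩ := h.initial_norms hadm hT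
  obtain ⟨K, hK, hEq⟩ := h.energy_eq hN hp hβ hα hadm hT
  have hn := h.wform_n_nonneg hN hp hβ hα hadm hT (le_refl (-Real.log T))
  have hco := fun τ hτ => h.coercive_le hN hp hβ hα₁ hα hadm hT (s := τ) hτ
  have cθ : (h.curves hN hp hβ hα hadm hT).θ (-Real.log T) = T ^ β • toL2 (v 0) := by
    show Real.exp (-(β * -Real.log T)) • toL2 (v (physTime T (-Real.log T))) = _
    rw [physTime_start hT, Real.rpow_def_of_pos hT]; ring_nf
  have cL : (h.curves hN hp hβ hα hadm hT).L (-Real.log T) = toL2 (weakLaplacian (u 0)) := by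
    show toL2 (weakLaplacian (u (physTime T (-Real.log T)))) = _
    rw [physTime_start hT]
  have cQ : ∀ i, (h.curves hN hp hβ hα hadm hT).Q i (-Real.log T) = toL2 (weakPartial i (u 0)) := by
    intro i
    show toL2 (weakPartial i (u (physTime T (-Real.log T)))) = _
    rw [physTime_start hT]
  set c := h.curves hN hp hβ hα hadm hT with hc
  have hw : Continuous (rhoPow α : Space N → ℝ) := continuous_rhoPow (by linarith)
  have hw1 : ∀ z : Space N, rhoPow α z ≤ 1 := rhoPow_le_one (by linarith)
  have sqle : ∀ {x y : ℝ}, 0 ≤ x → x ≤ y → x ^ 2 ≤ y ^ 2 := fun hx hxy => pow_le_pow_left₀ hx hxy 2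
  have b1 : gOne β (-Real.log T) * wform (rhoPow α) (c.θ (-Real.log T)) (c.θ (-Real.log T))
      ≤ B (β - 1) * M ^ 2 := by
    have e : gOne β (-Real.log T) * (T ^ β * T ^ β) = T ^ (β - 1) := by
      rw [gOne, ← Real.rpow_add hT, Real.rpow_def_of_pos hT, Real.rpow_def_of_pos hT,
        ← Real.exp_add]
      ring_nf
    rw [cθ, map_smul, map_smul, smul_apply, smul_eq_mul, smul_eq_mul]
    calc _ = T ^ (β - 1) * wform (rhoPow α) (toL2 (v 0)) (toL2 (v 0)) := by rw [← e]; ring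
      _ ≤ B (β - 1) * M ^ 2 := mul_le_mul (hB' _)
          ((wform_self_le_norm_sq hw hw1 _).trans (sqle (norm_nonneg _) n1))
          (wform_self_nonneg hw (fun z _ => rhoPow_nonneg α z) _)
          ((Real.rpow_pos_of_pos hT _).le.trans (hB' _))
  have b2 : -wform (rhoPow α) (c.θ (-Real.log T)) (c.L (-Real.log T))
      ≤ B (2 * β) * M ^ 2 + (N * M) ^ 2 := by
    have x0 := neg_two_mul_wform_le hw (rhoPow_nonneg α) (c.θ (-Real.log T)) (c.L (-Real.log T))
    have x1 := wform_self_le_norm_sq hw hw1 (c.θ (-Real.log T))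
    have x2 := wform_self_le_norm_sq hw hw1 (c.L (-Real.log T))
    have x3 : ‖c.θ (-Real.log T)‖ ^ 2 ≤ B (2 * β) * M ^ 2 := by
      rw [cθ, norm_smul, mul_pow, Real.norm_of_nonneg (Real.rpow_pos_of_pos hT _).le,
        ← Real.rpow_natCast, ← Real.rpow_mul hT.le]
      refine mul_le_mul ?_ (sqle (norm_nonneg _) n1) (sq_nonneg _)
        ((Real.rpow_pos_of_pos hT _).le.trans (hB' _))
      rw [show β * ((2 : ℕ) : ℝ) = 2 * β by push_cast; ring]
      exact hB' _
    have x4 : ‖c.L (-Real.log T)‖ ^ 2 ≤ (N * M) ^ 2 := by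
      rw [cL]; exact sqle (norm_nonneg _) n3
    have x5 : 0 ≤ ‖c.θ (-Real.log T)‖ ^ 2 := sq_nonneg _
    have x6 : 0 ≤ ‖c.L (-Real.log T)‖ ^ 2 := sq_nonneg _
    linarith
  have b3 : K ≤ (1 / 2 + α) * B (β + 1) * (N * M ^ 2) := by
    refine hK.trans ?_
    have y1 : ∑ i, ‖c.Q i (-Real.log T)‖ ^ 2 ≤ N * M ^ 2 := by
      have : ∀ i ∈ Finset.univ, ‖c.Q i (-Real.log T)‖ ^ 2 ≤ (M : ℝ) ^ 2 := fun i _ => by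
        rw [cQ]; exact sqle (norm_nonneg _) (n2 i)
      simpa using Finset.sum_le_card_nsmul _ _ _ this
    have y2 : 0 ≤ ∑ i, ‖c.Q i (-Real.log T)‖ ^ 2 := Finset.sum_nonneg fun i _ => sq_nonneg _
    have y3 : (1 / 2 + α) * T ^ (β + 1) ≤ (1 / 2 + α) * B (β + 1) :=
      mul_le_mul_of_nonneg_left (hB' _) (by linarith)
    have y4 : 0 ≤ (1 / 2 + α) * B (β + 1) :=
      mul_nonneg (by linarith) ((Real.rpow_pos_of_pos hT _).le.trans (hB' _))
    exact mul_le_mul y3 y1 y2 y4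
  have b4 : c.reducedEnergy (-Real.log T) ≤ β / 2 * (B (β - 1) * M ^ 2)
      + (B (2 * β) * M ^ 2 + (N * M) ^ 2) := by
    rw [EnergyCurves.reducedEnergy, intervalIntegral.integral_same]
    -- The initial potential energy enters with a favourable sign, so its size is irrelevant.
    have z1 : 0 ≤ 1 / (p + 1) * (gOne β (-Real.log T) *
        wform (rhoPow α) (c.n (-Real.log T)) (c.θ (-Real.log T))) :=
      mul_nonneg (div_nonneg zero_le_one (by linarith)) (mul_nonneg (Real.exp_pos _).le hn)
    have z2 := mul_le_mul_of_nonneg_left b1 (by linarith : 0 ≤ β / 2)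
    linarith
  have hdis := c.integral_dissipation (by linarith) (by linarith) hs
  have hle : κ * ∫ τ in (-Real.log T)..s, c.coercive τ ≤ ∫ τ in (-Real.log T)..s, c.dissipation τ := by
    rw [← intervalIntegral.integral_const_mul]
    exact intervalIntegral.integral_mono_on hs
      ((intervalIntegrable_of_continuousOn_Ici c.continuousOn_coercive hs).const_mul κ)
      (intervalIntegrable_of_continuousOn_Ici c.continuousOn_dissipation hs)
      fun τ hτ => hco τ hτ.1
  have hEs := hE s hs
  rw [hEq s hs] at hEs
  rw [inv_mul_eq_div, le_div_iff₀ k0]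
  linarith

end Dissipation

/-! ### Removing the weight on the half ball. -/

section HalfBall

variable {N : ℕ}

theorem rhoPow_ge_of_half {α : ℝ} (hα : 0 ≤ α) {z : Space N}
    (hz : z ∈ Metric.closedBall (0 : Space N) (1 / 2)) : (3 / 4 : ℝ) ^ α ≤ rhoPow α z := by
  have h1 : ‖z‖ ≤ 1 / 2 := by simpa using hz
  have h2 : 3 / 4 ≤ rho z := by
    rw [rho]; nlinarith [norm_nonneg z]
  exact Real.rpow_le_rpow (by norm_num) (h2.trans (le_max_left _ _)) hα

/-- On the half ball ρ ≥ 3/4, so the factor (4/3)^α compensates for the weight. -/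
theorem eLpNorm_half_le {α : ℝ} (hα : 0 ≤ α) {f : Space N → ℝ} (hf : MemLp f 2 (ballMeasure N)) :
    eLpNorm f 2 (volume.restrict (Metric.closedBall 0 (1 / 2)))
      ≤ ENNReal.ofReal (√((4 / 3 : ℝ) ^ α * wform (rhoPow α) (toL2 f) (toL2 f))) := by
  have hsub : Metric.closedBall (0 : Space N) (1 / 2) ⊆ ball1 0 :=
    Metric.closedBall_subset_closedBall (by norm_num)
  have hf' : MemLp f 2 (volume.restrict (Metric.closedBall (0 : Space N) (1 / 2))) :=
    hf.mono_measure (Measure.restrict_mono hsub le_rfl)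
  have hw := continuous_rhoPow (N := N) hα
  rw [hf'.eLpNorm_eq_integral_rpow_norm (by norm_num) (by norm_num)]
  refine ENNReal.ofReal_le_ofReal ?_
  rw [Real.sqrt_eq_rpow, ENNReal.toReal_ofNat, show (2 : ℝ)⁻¹ = 1 / 2 by norm_num]
  refine Real.rpow_le_rpow (integral_nonneg fun z => by positivity) ?_ (by norm_num)
  have h34 : (4 / 3 : ℝ) ^ α * (3 / 4) ^ α = 1 := by
    rw [← Real.mul_rpow (by norm_num) (by norm_num)]; norm_num
  have hint := (integrable_weight_mul_mul hw hf hf).const_mul ((4 / 3 : ℝ) ^ α)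
  rw [wform_toL2 hw hf hf, ← integral_const_mul]
  refine le_trans ?_ (setIntegral_mono_set hint (.of_forall fun z => ?_)
    (LE.le.eventuallyLE hsub))
  · refine setIntegral_mono_on ?_ (IntegrableOn.mono_set hint hsub)
      Metric.isClosed_closedBall.measurableSet fun z hz => ?_
    · have := hf'.integrable_sq
      refine this.congr (.of_forall fun z => ?_)
      simp
    · have h1 := rhoPow_ge_of_half hα hz
      have h2 : 1 ≤ (4 / 3 : ℝ) ^ α * rhoPow α z := by
        rw [← h34]; exact mul_le_mul_of_nonneg_left h1 (by positivity)
      calc ‖f z‖ ^ (2 : ℝ) = 1 * (f z * f z) := by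
            rw [Real.rpow_ofNat, Real.norm_eq_abs, sq_abs, one_mul, sq]
        _ ≤ ((4 / 3 : ℝ) ^ α * rhoPow α z) * (f z * f z) :=
            mul_le_mul_of_nonneg_right h2 (mul_self_nonneg _)
        _ = _ := by ring
  · simp only [Pi.zero_apply, mul_assoc]
    exact mul_nonneg (by positivity) (mul_nonneg (rhoPow_nonneg _ _) (mul_self_nonneg _))

end HalfBall

/-! ### Growth of the displacement u(t) - u(0). -/

section Displacement

variable {N : ℕ} {p β α : ℝ}

/-- The displacement and its gradient are primitives of g₂ θ and g₂ ∇θ. The duality estimate bounds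
them by the mass of g₂, of order e^{2βs}, times an integral controlled by the dissipation. For θ
itself one first uses g₂ ≤ T² g. -/
theorem exists_wform_displacement_le (hN : 1 ≤ N) (hp : 1 < p) (hβ : β = 1 / (p - 1))
    (hα₁ : β * (β + 1) / 2 < α) (hα : 2 < α) {Tmin : ℝ} (Tmax : ℝ) (hTmin : 0 < Tmin) (M : ℝ≥0)
    (E₀ : ℝ) :
    ∃ C : ℝ, 0 ≤ C ∧ ∀ T, Tmin ≤ T → T ≤ Tmax →
      ∀ (u₀ u₁ : Space N → ℝ) (u v : ℝ → Space N → ℝ),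
      IsSolution p T u₀ u₁ u v → Admissible p T M u₀ u₁ v →
      EnergyBoundedBelow p β α T E₀ u₀ v → ∀ s, -Real.log T ≤ s →
        wform (rhoPow α) (toL2 (u (physTime T s) - u 0)) (toL2 (u (physTime T s) - u 0))
            ≤ Real.exp (2 * β * s) * C ∧
        ∀ i, wform (rhoPow α) (toL2 (weakPartial i (u (physTime T s)) - weakPartial i (u 0)))
          (toL2 (weakPartial i (u (physTime T s)) - weakPartial i (u 0)))
            ≤ Real.exp (2 * β * s) * C := by
  have hβ0 : 0 < β := by rw [hβ]; exact one_div_pos.2 (by linarith)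
  obtain ⟨C₁, hC₁⟩ := exists_integral_coercive_le hN hp hβ hα₁ hα Tmax hTmin M E₀
  set B := (Tmin ^ (β + 1) + Tmax ^ (β + 1)) / (β + 1) with hB
  -- When the interval for T is empty the claim is vacuous. Otherwise Tmax is positive, which the
  -- sign of B requires.
  by_cases hTT : Tmin ≤ Tmax
  swap
  · exact ⟨0, le_rfl, fun T h1 h2 => absurd (h1.trans h2) hTT⟩
  have hB0 : 0 ≤ B := by
    have := Real.rpow_pos_of_pos hTmin (β + 1)
    have := Real.rpow_pos_of_pos (hTmin.trans_le hTT) (β + 1)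
    positivity
  refine ⟨B * ((1 + Tmax ^ 2) * max C₁ 0), by positivity, ?_⟩
  intro T h1 h2 u₀ u₁ u v h hadm hE s hs
  have hT : 0 < T := hTmin.trans_le h1
  have h0 : (0 : ℝ) ∈ Ico 0 T := ⟨le_rfl, hT⟩
  have ht := physTime_mem_Ico hT hs
  have hI := (hC₁ T h1 h2 u₀ u₁ u v h hadm hE s hs).trans (le_max_left C₁ 0)
  have eP : toL2 (u (physTime T s) - u 0) = (h.curves hN hp hβ hα hadm hT).P s
      - (h.curves hN hp hβ hα hadm hT).P (-Real.log T) := by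
    show _ = toL2 (u (physTime T s)) - toL2 (u (physTime T (-Real.log T)))
    rw [physTime_start hT, toL2_sub (h.memLp_u ht) (h.memLp_u h0)]
  have eQ : ∀ i, toL2 (weakPartial i (u (physTime T s)) - weakPartial i (u 0))
      = (h.curves hN hp hβ hα hadm hT).Q i s
        - (h.curves hN hp hβ hα hadm hT).Q i (-Real.log T) := fun i => by
    show _ = toL2 (weakPartial i (u (physTime T s)))
      - toL2 (weakPartial i (u (physTime T (-Real.log T))))
    rw [physTime_start hT, toL2_sub (h.memLp_weakPartial_u i ht) (h.memLp_weakPartial_u i h0)]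
  set c := h.curves hN hp hβ hα hadm hT with hc
  have hw : Continuous (rhoPow α : Space N → ℝ) := continuous_rhoPow (by linarith)
  have nn : ∀ f : BallL2 N, 0 ≤ wform (rhoPow α) f f := fun f =>
    wform_self_nonneg hw (fun z _ => rhoPow_nonneg α z) f
  have g2 : ContinuousOn (gTwo β) (Ici (-Real.log T)) :=
    EnergyCurves.continuous_gTwo.continuousOn
  have hmass : gTwoMass β (-Real.log T) s ≤ Real.exp (2 * β * s) * B := by
    have x1 := exp_mul_gTwoMass_le hβ0 hT hs
    have x2 : T ^ (β + 1) / (β + 1) ≤ B :=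
      div_le_div_of_nonneg_right (rpow_le_add_of_mem hTmin h1 h2 _) (by linarith)
    have x3 := mul_le_mul_of_nonneg_left (x1.trans x2) (Real.exp_pos (2 * β * s)).le
    rwa [← mul_assoc, ← Real.exp_add, add_neg_cancel, Real.exp_zero, one_mul] at x3
  have hmass0 : 0 ≤ gTwoMass β (-Real.log T) s :=
    intervalIntegral.integral_nonneg hs fun τ _ => (Real.exp_pos _).le
  have conclude : ∀ {J W : ℝ}, W ≤ gTwoMass β (-Real.log T) s * J →
      J ≤ (1 + Tmax ^ 2) * max C₁ 0 →
      W ≤ Real.exp (2 * β * s) * (B * ((1 + Tmax ^ 2) * max C₁ 0)) := fun {J W} h3 h4 => by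
    refine h3.trans ?_
    rw [← mul_assoc]
    exact (mul_le_mul_of_nonneg_left h4 hmass0).trans
      (mul_le_mul_of_nonneg_right hmass (by positivity))
  have hcI : IntervalIntegrable c.coercive volume (-Real.log T) s :=
    intervalIntegrable_of_continuousOn_Ici c.continuousOn_coercive hs
  have hT2 : T ^ 2 ≤ Tmax ^ 2 := pow_le_pow_left₀ hT.le h2 2
  have bound : ∀ {k : ℝ → ℝ}, ContinuousOn k (Ici (-Real.log T)) →
      (∀ τ, -Real.log T ≤ τ → k τ ≤ (1 + Tmax ^ 2) * c.coercive τ) →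
      ∫ τ in (-Real.log T)..s, k τ ≤ (1 + Tmax ^ 2) * max C₁ 0 := fun {k} hk hkc => by
    calc ∫ τ in (-Real.log T)..s, k τ
        ≤ ∫ τ in (-Real.log T)..s, (1 + Tmax ^ 2) * c.coercive τ :=
          intervalIntegral.integral_mono_on hs (intervalIntegrable_of_continuousOn_Ici hk hs)
            (hcI.const_mul _) fun τ hτ => hkc τ hτ.1
      _ = (1 + Tmax ^ 2) * ∫ τ in (-Real.log T)..s, c.coercive τ :=
          intervalIntegral.integral_const_mul _ _
      _ ≤ _ := mul_le_mul_of_nonneg_left hI (by positivity)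
  refine ⟨?_, fun i => ?_⟩
  · rw [eP]
    refine conclude (wform_primitive_le hw (rhoPow_nonneg α) hs c.contθ
      (c.integral_gTwo_wform_θ _ _ hs)) (bound (g2.mul (continuousOn_wform c.contθ c.contθ))
        fun τ hτ => ?_)
    have y1 := mul_le_mul_of_nonneg_right (gTwo_le_gOne (β := β) hT hτ) (nn (c.θ τ))
    have y2 : 0 ≤ gOne β τ * wform (rhoPow α) (c.θ τ) (c.θ τ) :=
      mul_nonneg (Real.exp_pos _).le (nn _)
    have y3 : 0 ≤ gOne β τ * wform (rhoPow α) (c.θ' τ) (c.θ' τ) :=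
      mul_nonneg (Real.exp_pos _).le (nn _)
    have y4 : 0 ≤ gTwo β τ * ∑ i, wform (rhoPow α) (c.D i τ) (c.D i τ) :=
      mul_nonneg (Real.exp_pos _).le (Finset.sum_nonneg fun i _ => nn _)
    have y5 := mul_le_mul_of_nonneg_right hT2 y2
    have y6 : gOne β τ * wform (rhoPow α) (c.θ τ) (c.θ τ) ≤ c.coercive τ := by
      rw [EnergyCurves.coercive]; linarith
    have y7 := mul_le_mul_of_nonneg_left y6 (sq_nonneg Tmax)
    have y8 : 0 ≤ c.coercive τ := y2.trans y6
    linarith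
  · rw [eQ]
    refine conclude (wform_primitive_le hw (rhoPow_nonneg α) hs (c.contD i)
      (c.integral_gTwo_wform_D _ _ _ hs)) (bound (g2.mul (continuousOn_wform (c.contD i)
        (c.contD i))) fun τ _ => ?_)
    have y2 : 0 ≤ gOne β τ * wform (rhoPow α) (c.θ τ) (c.θ τ) :=
      mul_nonneg (Real.exp_pos _).le (nn _)
    have y3 : 0 ≤ gOne β τ * wform (rhoPow α) (c.θ' τ) (c.θ' τ) :=
      mul_nonneg (Real.exp_pos _).le (nn _)
    have y4 : gTwo β τ * wform (rhoPow α) (c.D i τ) (c.D i τ)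
        ≤ gTwo β τ * ∑ i, wform (rhoPow α) (c.D i τ) (c.D i τ) :=
      mul_le_mul_of_nonneg_left (Finset.single_le_sum
        (f := fun i => wform (rhoPow α) (c.D i τ) (c.D i τ)) (fun i _ => nn _)
        (Finset.mem_univ i)) (Real.exp_pos _).le
    have y5 : gTwo β τ * wform (rhoPow α) (c.D i τ) (c.D i τ) ≤ c.coercive τ := by
      rw [EnergyCurves.coercive]; linarith
    have y6 : 0 ≤ c.coercive τ := (mul_nonneg (Real.exp_pos _).le (nn _)).trans y5
    have y7 := mul_nonneg (sq_nonneg Tmax) y6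
    linarith

/-- The lower energy bound at every centre. -/
def EnergyBoundedBelowAll (p β α T E₀ : ℝ) (u₀ : Space N → ℝ) (v : ℝ → Space N → ℝ) : Prop :=
  ∀ a s, -Real.log T ≤ s →
    E₀ ≤ energy p β α (-Real.log T) (theta β T v a) (theta00 β T u₀ a) s

theorem theta_shift (β T : ℝ) (v : ℝ → Space N → ℝ) (y a : Space N) :
    theta β T (fun t => shift y (v t)) a = theta β T v (y + a) := by
  funext s z
  simp only [theta, shift, add_assoc]

theorem theta00_shift (β T : ℝ) (u₀ : Space N → ℝ) (y a : Space N) :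
    theta00 β T (shift y u₀) a = theta00 β T u₀ (y + a) := by
  funext z
  simp only [theta00, shift, add_assoc]

theorem EnergyBoundedBelowAll.shift {T E₀ : ℝ} {u₀ : Space N → ℝ} {v : ℝ → Space N → ℝ}
    (h : EnergyBoundedBelowAll p β α T E₀ u₀ v) (y : Space N) :
    EnergyBoundedBelowAll p β α T E₀ (shift y u₀) (fun t => shift y (v t)) := fun a s hs => by
  rw [theta_shift, theta00_shift]
  exact h (y + a) s hs

theorem EnergyBoundedBelowAll.zero {T E₀ : ℝ} {u₀ : Space N → ℝ} {v : ℝ → Space N → ℝ}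
    (h : EnergyBoundedBelowAll p β α T E₀ u₀ v) : EnergyBoundedBelow p β α T E₀ u₀ v :=
  h 0

/-- A bound near the origin for all solutions in a translation invariant class gives a bound on
the unit ball. -/
theorem eLpNorm_ball_le_of_local {q : ℝ≥0∞} (hq : 1 ≤ q) {F : Finset (Space N)}
    (hF : Metric.closedBall (0 : Space N) 1 ⊆ ⋃ y ∈ F, Metric.closedBall y (1 / 4))
    {f : Space N → ℝ} (hf : AEStronglyMeasurable f volume) {K : ℝ≥0∞}
    (h : ∀ y, eLpNorm (shift y f) q (volume.restrict (Metric.closedBall 0 (1 / 4))) ≤ K) :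
    eLpNorm f q (ballMeasure N) ≤ F.card * K := by
  refine (eLpNorm_restrict_le_sum hf hq Metric.isClosed_closedBall.measurableSet hF).trans ?_
  rw [← nsmul_eq_mul]
  refine Finset.sum_le_card_nsmul _ _ _ fun y _ => ?_
  have := h y
  rwa [eLpNorm_shift, add_zero] at this

theorem eLpNorm_half_le_of_wform_le {C₁ b : ℝ} (hα : 0 ≤ α) (hC : 0 ≤ C₁) {f : Space N → ℝ}
    (hf : MemLp f 2 (ballMeasure N))
    (hb : wform (rhoPow α) (toL2 f) (toL2 f) ≤ Real.exp (2 * b) * C₁) :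
    eLpNorm f 2 (volume.restrict (Metric.closedBall 0 (1 / 2)))
      ≤ Real.toNNReal (√((4 / 3 : ℝ) ^ α * C₁)) * ENNReal.ofReal (Real.exp b) := by
  refine (eLpNorm_half_le hα hf).trans ?_
  have e : (Real.toNNReal (√((4 / 3 : ℝ) ^ α * C₁)) : ℝ≥0∞)
    = ENNReal.ofReal (√((4 / 3 : ℝ) ^ α * C₁)) := rfl
  rw [e, ← ENNReal.ofReal_mul (Real.sqrt_nonneg _)]
  have h0 : 0 ≤ (4 / 3 : ℝ) ^ α := by positivity
  refine ENNReal.ofReal_le_ofReal (Real.sqrt_le_iff.2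
    ⟨mul_nonneg (Real.sqrt_nonneg _) (Real.exp_pos _).le, ?_⟩)
  have e2 : Real.exp b ^ 2 = Real.exp (2 * b) := by rw [← Real.exp_nat_mul]; norm_num
  rw [mul_pow, Real.sq_sqrt (mul_nonneg h0 hC), e2]
  exact (mul_le_mul_of_nonneg_left hb h0).trans (le_of_eq (by ring))

/-- On the half ball the weighted bounds become plain H¹ bounds of size e^{βs}, which feed the
interior Sobolev embedding. -/
theorem exists_eLpNorm_local_displacement_le (hN : 1 ≤ N) (hp : 1 < p) (hβ : β = 1 / (p - 1))
    (hα₁ : β * (β + 1) / 2 < α) (hα : 2 < α) {q : ℝ≥0} (hq : 1 ≤ q)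
    (hqn : 3 ≤ N → (q : ℝ) ≤ 2 * (N : ℝ) / ((N : ℝ) - 2)) {Tmin : ℝ} (Tmax : ℝ)
    (hTmin : 0 < Tmin) (M : ℝ≥0) (E₀ : ℝ) :
    ∃ C : ℝ≥0, ∀ T, Tmin ≤ T → T ≤ Tmax →
      ∀ (u₀ u₁ : Space N → ℝ) (u v : ℝ → Space N → ℝ),
      IsSolution p T u₀ u₁ u v → Admissible p T M u₀ u₁ v →
      EnergyBoundedBelow p β α T E₀ u₀ v → ∀ s, -Real.log T ≤ s →
        eLpNorm (u (physTime T s) - u 0) q (volume.restrict (Metric.closedBall 0 (1 / 4)))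
          ≤ C * ENNReal.ofReal (Real.exp (β * s)) := by
  obtain ⟨C₁, hC0, hC₁⟩ := exists_wform_displacement_le hN hp hβ hα₁ hα Tmax hTmin M E₀
  obtain ⟨Cs, hCs⟩ := exists_sobolev_local hN hq hqn
  obtain ⟨R, hR⟩ : ∃ R : ℝ≥0, R = Real.toNNReal (√((4 / 3 : ℝ) ^ α * C₁)) := ⟨_, rfl⟩
  refine ⟨Cs * ((1 + N) * R), ?_⟩
  intro T h1 h2 u₀ u₁ u v h hadm hE s hs
  have hT : 0 < T := hTmin.trans_le h1
  have h0 : (0 : ℝ) ∈ Ico 0 T := ⟨le_rfl, hT⟩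
  have ht := physTime_mem_Ico hT hs
  obtain ⟨b1, b2⟩ := hC₁ T h1 h2 u₀ u₁ u v h hadm hE s hs
  rw [show 2 * β * s = 2 * (β * s) by ring] at b1 b2
  have s1 := hCs (u (physTime T s) - u 0)
    (fun i => weakPartial i (u (physTime T s)) - weakPartial i (u 0))
    (fun i => ((h.mem_u _ ht).hasWeakPartial i).sub ((h.mem_u _ h0).hasWeakPartial i))
  have k1 := eLpNorm_half_le_of_wform_le (by linarith : 0 ≤ α) hC0
    ((h.memLp_u ht).sub (h.memLp_u h0)) b1
  have k2 := fun i => eLpNorm_half_le_of_wform_le (by linarith : 0 ≤ α) hC0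
    ((h.memLp_weakPartial_u i ht).sub (h.memLp_weakPartial_u i h0)) (b2 i)
  rw [← hR] at k1 k2
  have k3 := Finset.sum_le_card_nsmul Finset.univ _ _ fun i _ => k2 i
  rw [Finset.card_univ, Fintype.card_fin, nsmul_eq_mul] at k3
  refine s1.trans ((mul_le_mul_right (add_le_add k1 k3) _).trans (le_of_eq ?_))
  push_cast
  ring

/-- The local bound near the origin is applied to translates of the solution, whose quarter balls
cover B. This is the point where the energy bound is needed at every centre. -/
theorem exists_eLpNorm_displacement_le (hN : 1 ≤ N) (hp : 1 < p) (hβ : β = 1 / (p - 1))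
    (hα₁ : β * (β + 1) / 2 < α) (hα : 2 < α) {q : ℝ≥0} (hq : 1 ≤ q)
    (hqn : 3 ≤ N → (q : ℝ) ≤ 2 * (N : ℝ) / ((N : ℝ) - 2)) {Tmin : ℝ} (Tmax : ℝ)
    (hTmin : 0 < Tmin) (M : ℝ≥0) (E₀ : ℝ) :
    ∃ C : ℝ≥0, ∀ T, Tmin ≤ T → T ≤ Tmax →
      ∀ (u₀ u₁ : Space N → ℝ) (u v : ℝ → Space N → ℝ),
      IsSolution p T u₀ u₁ u v → Admissible p T M u₀ u₁ v →
      EnergyBoundedBelowAll p β α T E₀ u₀ v → ∀ s, -Real.log T ≤ s →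
        eLpNorm (u (physTime T s) - u 0) q (ballMeasure N)
          ≤ C * ENNReal.ofReal (Real.exp (β * s)) := by
  obtain ⟨C, hC⟩ := exists_eLpNorm_local_displacement_le hN hp hβ hα₁ hα hq hqn Tmax hTmin M E₀
  obtain ⟨F, -, hF⟩ := exists_finset_cover (N := N) 1 (r := 1 / 4) (by norm_num)
  refine ⟨F.card * C, ?_⟩
  intro T h1 h2 u₀ u₁ u v h hadm hE s hs
  have hT : 0 < T := hTmin.trans_le h1
  have h0 : (0 : ℝ) ∈ Ico 0 T := ⟨le_rfl, hT⟩
  have ht := physTime_mem_Ico hT hs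
  have := eLpNorm_ball_le_of_local (q := q) (by exact_mod_cast hq) hF
    ((h.mem_u _ ht).1.aesm.sub (h.mem_u _ h0).1.aesm)
    (K := C * ENNReal.ofReal (Real.exp (β * s))) fun y => by
      have := hC T h1 h2 _ _ (fun t => VelocityWave.shift y (u t)) _ (h.shift y) (hadm.shift y)
        (hE.shift y).zero s hs
      exact this
  refine this.trans (le_of_eq ?_)
  push_cast
  ring

end Displacement

/-! ### The convolution with h₂ as a rescaled displacement. -/

section Primitive

variable {N : ℕ} {p T : ℝ} {u₀ u₁ : Space N → ℝ} {u v : ℝ → Space N → ℝ}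

theorem ae_ball_mem_open : ∀ᵐ x ∂(ballMeasure N), x ∈ Metric.ball (0 : Space N) 1 := by
  have hsph : ∀ᵐ x : Space N, x ∉ Metric.sphere (0 : Space N) 1 :=
    measure_eq_zero_iff_ae_notMem.1 (Measure.addHaar_sphere_of_ne_zero volume 0 one_ne_zero)
  filter_upwards [ae_ball_of_ae hsph] with x hx
  have h1 := hx.1
  have h2 := hx.2
  simp only [Metric.mem_sphere, Metric.mem_ball, Metric.mem_closedBall] at *
  exact lt_of_le_of_ne h1 h2

/-- Joint measurability and the bound on the solution, uniform on [0, t], justify Fubini on [0, t] ×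
B. -/
theorem IsSolution.integrable_prod (h : IsSolution p T u₀ u₁ u v) {t : ℝ} (ht : t ∈ Ico 0 T) :
    Integrable (Function.uncurry v) ((volume.restrict (Icc 0 t)).prod (ballMeasure N)) := by
  have hm : AEStronglyMeasurable (Function.uncurry v)
      ((volume.restrict (Icc 0 t)).prod (ballMeasure N)) := by
    rw [Measure.prod_restrict]
    have hsub : Icc 0 t ⊆ Ico 0 T := fun x hx => ⟨hx.1, hx.2.trans_lt ht.2⟩
    exact h.aesm.mono_measure (Measure.restrict_mono
      (Set.prod_mono hsub (subset_univ _)) le_rfl)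
  obtain ⟨K, hK⟩ := h.bdd t ht
  refine ⟨hm, ?_⟩
  rw [hasFiniteIntegral_iff_enorm, lintegral_prod _ hm.enorm]
  have hb : ∀ τ ∈ Icc 0 t, ∫⁻ x, ‖v τ x‖ₑ ∂(ballMeasure N)
      ≤ K * (ballMeasure N univ) ^ (1 / 2 : ℝ) := fun τ hτ => by
    have hτ' : τ ∈ Ico 0 T := ⟨hτ.1, hτ.2.trans_lt ht.2⟩
    rw [← eLpNorm_one_eq_lintegral_enorm]
    refine (eLpNorm_le_eLpNorm_mul_rpow_measure_univ one_le_two (h.memLp_v hτ').1).trans ?_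
    have e : (1 / (1 : ℝ≥0∞).toReal - 1 / (2 : ℝ≥0∞).toReal) = 1 / 2 := by norm_num
    rw [e]
    refine mul_le_mul_left ?_ _
    calc eLpNorm (v τ) 2 (ballMeasure N) ≤ sobolevNorm 2 (ball1 0) 1 (v τ) :=
          eLpNorm_le_sobolevNorm _ _ _ _
      _ ≤ ulocNorm 2 1 (v τ) := le_iSup (fun x => sobolevNorm 2 (ball1 x) 1 (v τ)) 0
      _ ≤ K := le_add_self.trans (hK τ hτ)
  calc ∫⁻ τ in Icc 0 t, ∫⁻ x, ‖v τ x‖ₑ ∂(ballMeasure N)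
      ≤ ∫⁻ _ in Icc 0 t, K * (ballMeasure N univ) ^ (1 / 2 : ℝ) :=
        setLIntegral_mono measurable_const hb
    _ < ⊤ := by
      rw [setLIntegral_const]
      refine ENNReal.mul_lt_top (ENNReal.mul_lt_top ENNReal.coe_lt_top
        (ENNReal.rpow_lt_top_of_nonneg (by norm_num) (measure_lt_top _ _).ne)) ?_
      rw [Real.volume_Icc]; exact ENNReal.ofReal_lt_top

theorem integral_eq_ball_integral {φ f : Space N → ℝ} (hs : tsupport φ ⊆ Metric.ball 0 1) :
    ∫ x, f x * φ x = ∫ x, f x * φ x ∂(ballMeasure N) := by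
  refine (setIntegral_eq_integral_of_forall_compl_eq_zero fun x hx => ?_).symm
  rw [image_eq_zero_of_notMem_tsupport fun h => hx (Metric.ball_subset_closedBall (hs h)), mul_zero]

/-- The position is the time integral of the velocity, almost everywhere in space. -/
theorem IsSolution.ae_integral_eq (h : IsSolution p T u₀ u₁ u v) {t : ℝ} (ht : t ∈ Ico 0 T) :
    ∀ᵐ x ∂(ballMeasure N), IntegrableOn (fun τ => v τ x) (Icc 0 t) ∧
      ∫ τ in Icc 0 t, v τ x = u t x - u 0 x := by
  have hI := h.integrable_prod ht
  have h0 : (0 : ℝ) ∈ Ico 0 T := ⟨le_rfl, ht.1.trans_lt ht.2⟩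
  have hw : Integrable (fun x => ∫ τ in Icc 0 t, v τ x) (ballMeasure N) := hI.integral_prod_right
  have hu : Integrable (fun x => u t x - u 0 x) (ballMeasure N) :=
    ((h.memLp_u ht).sub (h.memLp_u h0)).integrable one_le_two
  have hd : Integrable (fun x => (∫ τ in Icc 0 t, v τ x) - (u t x - u 0 x)) (ballMeasure N) :=
    hw.sub hu
  have key := Metric.isOpen_ball.ae_eq_zero_of_integral_contDiff_smul_eq_zero
    (U := Metric.ball (0 : Space N) 1) (μ := volume)
    (f := fun x => (∫ τ in Icc 0 t, v τ x) - (u t x - u 0 x))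
    ((IntegrableOn.mono_set hd Metric.ball_subset_closedBall).locallyIntegrableOn) (by
      intro φ hφ hc hs
      obtain ⟨B, hB⟩ := hc.exists_bound_of_continuous hφ.continuous
      have hIφ : Integrable (Function.uncurry fun τ x => v τ x * φ x)
          ((volume.restrict (Icc 0 t)).prod (ballMeasure N)) :=
        hI.mul_bdd (c := B) ((hφ.continuous.comp continuous_snd).aestronglyMeasurable)
          (.of_forall fun q => hB q.2)
      have i1 : Integrable (fun x => (∫ τ in Icc 0 t, v τ x) * φ x) (ballMeasure N) :=
        hw.mul_bdd (c := B) hφ.continuous.aestronglyMeasurable (.of_forall hB)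
      have i2 : ∀ τ ∈ Ico 0 T, Integrable (fun x => u τ x * φ x) (ballMeasure N) := fun τ hτ =>
        ((h.memLp_u hτ).integrable one_le_two).mul_bdd (c := B) hφ.continuous.aestronglyMeasurable
          (.of_forall hB)
      -- Fubini reduces the tested identity to the fundamental theorem of calculus for τ ↦ ∫ u(τ) φ.
      have sw : ∫ x, (∫ τ in Icc 0 t, v τ x) * φ x ∂(ballMeasure N)
          = ∫ τ in Icc 0 t, ∫ x, v τ x * φ x := by
        simp only [← integral_mul_const]
        rw [← integral_integral_swap hIφ]
        simp only [integral_eq_ball_integral hs]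
      have ftc : ∫ τ in (0 : ℝ)..t, ∫ x, v τ x * φ x
          = (∫ x, u t x * φ x) - ∫ x, u 0 x * φ x := by
        refine intervalIntegral.integral_eq_sub_of_hasDerivAt_of_le ht.1
          (f := fun τ => ∫ x, u τ x * φ x) ?_ (fun τ hτ => ?_) ?_
        · exact fun τ hτ => ((h.deriv_u φ hφ hc τ ⟨hτ.1, hτ.2.trans_lt ht.2⟩).continuousWithinAt).mono
            fun x hx => ⟨hx.1, hx.2.trans_lt ht.2⟩
        · exact (h.deriv_u φ hφ hc τ ⟨hτ.1.le, hτ.2.trans ht.2⟩).hasDerivAt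
            (Ico_mem_nhds hτ.1 (hτ.2.trans ht.2))
        · rw [intervalIntegrable_iff_integrableOn_Icc_of_le ht.1]
          have := hIφ.integral_prod_left
          refine this.congr (.of_forall fun τ => ?_)
          exact (integral_eq_ball_integral hs).symm
      have e : ∀ x, φ x • ((∫ τ in Icc 0 t, v τ x) - (u t x - u 0 x))
          = ((∫ τ in Icc 0 t, v τ x) - (u t x - u 0 x)) * φ x := fun x => mul_comm _ _
      simp only [e]
      rw [integral_eq_ball_integral hs]
      simp only [sub_mul]
      have i3 : Integrable (fun x => u t x * φ x - u 0 x * φ x) (ballMeasure N) :=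
        (i2 t ht).sub (i2 0 h0)
      rw [integral_sub i1 i3, integral_sub (i2 t ht) (i2 0 h0), sw,
        integral_Icc_eq_integral_Ioc, ← intervalIntegral.integral_of_le ht.1, ftc,
        integral_eq_ball_integral hs, integral_eq_ball_integral hs, sub_self])
  filter_upwards [hI.prod_left_ae, ae_restrict_of_ae key, ae_ball_mem_open] with x h1 h2 h3
  exact ⟨h1, sub_eq_zero.1 (h2 h3)⟩

theorem physTime_image {s₀ s : ℝ} (hs : s₀ ≤ s) :
    physTime T '' Icc s₀ s = Icc (physTime T s₀) (physTime T s) := by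
  have hmono : Monotone (physTime T) := fun a b hab => by
    have : Real.exp (-b) ≤ Real.exp (-a) := Real.exp_le_exp.2 (by linarith)
    rw [physTime, physTime]; linarith
  refine Subset.antisymm ?_ (intermediate_value_Icc hs (continuous_physTime T).continuousOn)
  rintro _ ⟨x, hx, rfl⟩
  exact ⟨hmono hx.1, hmono hx.2⟩

theorem physTime_injective : Function.Injective (physTime T) := fun a b hab => by
  rw [physTime, physTime, sub_right_inj] at hab
  exact neg_injective (Real.exp_injective hab)

theorem hTwo_mul_theta_eq (β : ℝ) (v : ℝ → Space N → ℝ) (s s' : ℝ) (z : Space N) :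
    hTwo β (s - s') * theta β T v 0 s' z
      = Real.exp (-(β - 1) * s) * (|Real.exp (-s')| • v (physTime T s') z) := by
  rw [theta_zero, hTwo, abs_of_pos (Real.exp_pos _), smul_eq_mul, ← mul_assoc, ← mul_assoc,
    ← Real.exp_add, ← Real.exp_add]
  ring_nf

/-- Here h₂(s - s') θ(s') = e^{-(β-1)s} e^{-s'} v, and e^{-s'} is the Jacobian of s' ↦ T - e^{-s'}.
The convolution is therefore a constant multiple of the physical time integral of v. -/
theorem IsSolution.ae_hTwoConv_eq (h : IsSolution p T u₀ u₁ u v) (hT : 0 < T) (β : ℝ) {s : ℝ}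
    (hs : -Real.log T ≤ s) :
    ∀ᵐ z ∂(ballMeasure N),
      IntervalIntegrable (fun s' => hTwo β (s - s') * theta β T v 0 s' z) volume (-Real.log T) s ∧
      hTwoConv β (-Real.log T) (theta β T v 0) s z
        = Real.exp (-(β - 1) * s) * (u (physTime T s) z - u 0 z) := by
  filter_upwards [h.ae_integral_eq (physTime_mem_Ico hT hs)] with z ⟨h1, h2⟩
  have himg := physTime_image (T := T) hs
  rw [physTime_start hT] at himg
  have hd : ∀ x ∈ Icc (-Real.log T) s, HasDerivWithinAt (physTime T) (Real.exp (-x))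
      (Icc (-Real.log T) s) x := fun x _ => (hasDerivAt_physTime T x).hasDerivWithinAt
  have hinj : InjOn (physTime T) (Icc (-Real.log T) s) := physTime_injective.injOn
  rw [← himg] at h1 h2
  rw [integrableOn_image_iff_integrableOn_abs_deriv_smul measurableSet_Icc hd hinj] at h1
  rw [integral_image_eq_integral_abs_deriv_smul measurableSet_Icc hd hinj] at h2
  simp only [hTwoConv, hTwo_mul_theta_eq]
  refine ⟨?_, ?_⟩
  · rw [intervalIntegrable_iff_integrableOn_Icc_of_le hs]
    exact h1.const_mul _
  · rw [intervalIntegral.integral_const_mul, intervalIntegral.integral_of_le hs,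
      ← integral_Icc_eq_integral_Ioc, h2]

theorem integral_abs_rpow_le_of_eLpNorm_le {Ω : Type*} [MeasurableSpace Ω] {μ : Measure Ω}
    {f : Ω → ℝ} (hf : AEStronglyMeasurable f μ) {r K : ℝ} (hr : 1 ≤ r) (hK : 0 ≤ K)
    (h : eLpNorm f (ENNReal.ofReal r) μ ≤ ENNReal.ofReal K) :
    Integrable (fun x => |f x| ^ r) μ ∧ ∫ x, |f x| ^ r ∂μ ≤ K ^ r := by
  have r0 : 0 < r := by linarith
  have hm : MemLp f (ENNReal.ofReal r) μ := ⟨hf, h.trans_lt ENNReal.ofReal_lt_top⟩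
  have hr' : ENNReal.ofReal r ≠ 0 := by simpa using r0
  have hi := hm.integrable_norm_rpow hr' ENNReal.ofReal_ne_top
  rw [ENNReal.toReal_ofReal r0.le] at hi
  refine ⟨hi, ?_⟩
  rw [hm.eLpNorm_eq_integral_rpow_norm hr' ENNReal.ofReal_ne_top, ENNReal.toReal_ofReal r0.le] at h
  have h0 : 0 ≤ ∫ x, ‖f x‖ ^ r ∂μ := integral_nonneg fun x => by positivity
  have h2 := (ENNReal.ofReal_le_ofReal_iff hK).1 h
  have h3 := Real.rpow_le_rpow (Real.rpow_nonneg h0 _) h2 r0.le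
  rwa [← Real.rpow_mul h0, inv_mul_cancel₀ r0.ne', Real.rpow_one] at h3

end Primitive

/-! ### The bound for the convolution. -/

section FirstBound

variable {N : ℕ} {p β α : ℝ}

theorem exists_hTwoConv_bound (hN : 1 ≤ N) (hp : 1 < p) (hβ : β = 1 / (p - 1))
    (hα₁ : β * (β + 1) / 2 < α) (hα : 2 < α) {r : ℝ} (hr : 1 ≤ r)
    (hrn : 3 ≤ N → r ≤ 2 * (N : ℝ) / ((N : ℝ) - 2)) {Tmin : ℝ} (Tmax : ℝ)
    (hTmin : 0 < Tmin) (M : ℝ≥0) (E₀ : ℝ) :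
    ∃ C : ℝ, ∀ T, Tmin ≤ T → T ≤ Tmax →
      ∀ (u₀ u₁ : Space N → ℝ) (u v : ℝ → Space N → ℝ),
      IsSolution p T u₀ u₁ u v → Admissible p T M u₀ u₁ v →
      EnergyBoundedBelowAll p β α T E₀ u₀ v → ∀ s, -Real.log T ≤ s →
        (∀ᵐ z ∂(ballMeasure N),
          IntervalIntegrable (fun s' => hTwo β (s - s') * theta β T v 0 s' z) volume
            (-Real.log T) s) ∧
        Integrable (fun z => |hTwoConv β (-Real.log T) (theta β T v 0) s z| ^ r) (ballMeasure N) ∧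
        Real.exp (-(r * s)) *
          (∫ z, |hTwoConv β (-Real.log T) (theta β T v 0) s z| ^ r ∂(ballMeasure N)) ≤ C := by
  have hq : ((Real.toNNReal r : ℝ≥0) : ℝ) = r := Real.coe_toNNReal _ (by linarith)
  obtain ⟨C, hC⟩ := exists_eLpNorm_displacement_le hN hp hβ hα₁ hα (q := Real.toNNReal r)
    (by rw [← NNReal.coe_le_coe, hq, NNReal.coe_one]; exact hr) (by rw [hq]; exact hrn)
    Tmax hTmin M E₀
  refine ⟨(C : ℝ) ^ r, ?_⟩
  intro T h1 h2 u₀ u₁ u v h hadm hE s hs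
  have hT : 0 < T := hTmin.trans_le h1
  have h0 : (0 : ℝ) ∈ Ico 0 T := ⟨le_rfl, hT⟩
  have ht := physTime_mem_Ico hT hs
  have hae := h.ae_hTwoConv_eq hT β hs
  have hb := hC T h1 h2 u₀ u₁ u v h hadm hE s hs
  have hb' : eLpNorm (u (physTime T s) - u 0) (ENNReal.ofReal r) (ballMeasure N)
      ≤ ENNReal.ofReal (C * Real.exp (β * s)) := by
    rw [ENNReal.ofReal_mul (NNReal.coe_nonneg C), ENNReal.ofReal_coe_nnreal]
    exact hb
  obtain ⟨b1, b2⟩ := integral_abs_rpow_le_of_eLpNorm_le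
    ((h.memLp_u ht).sub (h.memLp_u h0)).1 hr (by positivity) hb'
  have e : (fun z => |hTwoConv β (-Real.log T) (theta β T v 0) s z| ^ r)
      =ᵐ[ballMeasure N] fun z => Real.exp (-(β - 1) * s) ^ r
        * |(u (physTime T s) - u 0) z| ^ r := by
    filter_upwards [hae] with z hz
    rw [hz.2, abs_mul, abs_of_pos (Real.exp_pos _),
      Real.mul_rpow (Real.exp_pos _).le (abs_nonneg _), Pi.sub_apply]
  refine ⟨hae.mono fun z hz => hz.1, (b1.const_mul _).congr e.symm, ?_⟩
  rw [integral_congr_ae e, integral_const_mul]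
  -- The exponents -r, -(β-1)r and βr of e^s add up to zero.
  calc Real.exp (-(r * s)) * (Real.exp (-(β - 1) * s) ^ r
        * ∫ z, |(u (physTime T s) - u 0) z| ^ r ∂(ballMeasure N))
      ≤ Real.exp (-(r * s)) * (Real.exp (-(β - 1) * s) ^ r * (C * Real.exp (β * s)) ^ r) := by
        gcongr
    _ = (C : ℝ) ^ r := by
        rw [Real.mul_rpow (NNReal.coe_nonneg C) (Real.exp_pos _).le, ← Real.exp_mul,
          ← Real.exp_mul]
        calc _ = (C : ℝ) ^ r * (Real.exp (-(r * s)) * Real.exp (-(β - 1) * s * r)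
              * Real.exp (β * s * r)) := by ring
          _ = _ := by
            rw [← Real.exp_add, ← Real.exp_add]
            ring_nf
            rw [Real.exp_zero, mul_one]

end FirstBound

/-! ### The trace inequality on a hyperplane of ℝ × ℝ^N. -/

section Trace

variable {N : ℕ}

/-- One-dimensional trace estimate along a line. -/
theorem enorm_rpow_le_lintegral {f f' : ℝ → ℝ} (hf : ∀ y, HasDerivAt f (f' y) y)
    (hf' : Continuous f') {a : ℝ} (ha : a ≤ 0) (h0 : f a = 0) {r : ℝ} (hr : 1 < r) :
    ‖f 0‖ₑ ^ r ≤ ∫⁻ y, ENNReal.ofReal r * (‖f y‖ₑ ^ (r - 1) * ‖f' y‖ₑ) := by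
  have r0 : 0 < r := by linarith
  have hfc : Continuous f := continuous_iff_continuousAt.2 fun y => (hf y).continuousAt
  have hd : ∀ y, HasDerivAt (fun y => |f y| ^ r) (r * |f y| ^ (r - 2) * f y * f' y) y := fun y =>
    (hasDerivAt_abs_rpow (f y) hr).comp y (hf y)
  have hnorm : ∀ y, ‖r * |f y| ^ (r - 2) * f y * f' y‖ = r * (|f y| ^ (r - 1) * |f' y|) := by
    intro y
    have : |f y| ^ (r - 2) * |f y| = |f y| ^ (r - 1) := by
      rcases (abs_nonneg (f y)).eq_or_lt with h | h
      · rw [← h, mul_zero, Real.zero_rpow (by linarith)]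
      · rw [← Real.rpow_add_one h.ne']; ring_nf
    rw [Real.norm_eq_abs, abs_mul, abs_mul, abs_mul, abs_of_pos r0,
      abs_of_nonneg (Real.rpow_nonneg (abs_nonneg _) _), ← this]
    ring
  have hcont : Continuous fun y => r * (|f y| ^ (r - 1) * |f' y|) :=
    continuous_const.mul ((hfc.abs.rpow_const fun _ => Or.inr (by linarith)).mul hf'.abs)
  have hint : IntervalIntegrable (fun y => r * |f y| ^ (r - 2) * f y * f' y) volume a 0 := by
    -- The integrand is a derivative, hence measurable, and its norm is a continuous function. Its
    -- behaviour at zeros of f need not be examined.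
    have hm : deriv (fun y => |f y| ^ r) = fun y => r * |f y| ^ (r - 2) * f y * f' y :=
      funext fun y => (hd y).deriv
    refine (hcont.intervalIntegrable a 0).mono_fun ?_ (.of_forall fun y => ?_)
    · rw [← hm]; exact (measurable_deriv _).aestronglyMeasurable
    · exact (hnorm y).le.trans (le_abs_self _)
  have hftc := intervalIntegral.integral_eq_sub_of_hasDerivAt (fun y _ => hd y) hint
  have hz : |f a| ^ r = 0 := by rw [h0, abs_zero, Real.zero_rpow r0.ne']
  have hle : |f 0| ^ r ≤ ∫ y in a..0, r * (|f y| ^ (r - 1) * |f' y|) := by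
    have := intervalIntegral.norm_integral_le_integral_norm (μ := volume)
      (f := fun y => r * |f y| ^ (r - 2) * f y * f' y) ha
    rw [hftc, hz, sub_zero, Real.norm_of_nonneg (by positivity)] at this
    simpa only [hnorm] using this
  have e1 : ‖f 0‖ₑ ^ r = ENNReal.ofReal (|f 0| ^ r) := by
    rw [← ENNReal.ofReal_rpow_of_nonneg (abs_nonneg _) r0.le, ← Real.norm_eq_abs,
      ofReal_norm]
  rw [e1]
  refine (ENNReal.ofReal_le_ofReal hle).trans ?_
  rw [intervalIntegral.integral_of_le ha, ofReal_integral_eq_lintegral_ofReal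
    (hcont.integrableOn_Ioc) (.of_forall fun y => by positivity)]
  refine (lintegral_mono fun y => ?_).trans (setLIntegral_le_lintegral _ _)
  rw [ENNReal.ofReal_mul r0.le, ENNReal.ofReal_mul (by positivity),
    ← ENNReal.ofReal_rpow_of_nonneg (abs_nonneg _) (by linarith), ← Real.norm_eq_abs,
    ← Real.norm_eq_abs, ofReal_norm, ofReal_norm]

/-- The one-dimensional estimate is integrated over x. Cauchy-Schwarz in space-time then separates
|F|^{r-1} from the transversal derivative, which produces the exponent 2(r-1). -/
theorem lintegral_trace_le {F : ℝ × Space N → ℝ} (hF : ContDiff ℝ 1 F) {L : ℝ} (hL : 0 ≤ L)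
    (hs : ∀ q : ℝ × Space N, q.1 = -L → F q = 0) {r : ℝ} (hr : 1 < r) :
    ∫⁻ x, ‖F (0, x)‖ₑ ^ r ≤ ENNReal.ofReal r *
      ((∫⁻ q, ‖F q‖ₑ ^ (2 * (r - 1))) ^ (1 / 2 : ℝ)
        * (∫⁻ q, ‖fderiv ℝ F q (1, 0)‖ₑ ^ (2 : ℝ)) ^ (1 / 2 : ℝ)) := by
  have hFd : Continuous fun q => fderiv ℝ F q (1, 0) :=
    (hF.continuous_fderiv one_ne_zero).clm_apply continuous_const
  have hm1 : Measurable fun q => ‖F q‖ₑ ^ (r - 1) := hF.continuous.measurable.enorm.pow_const _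
  have hm2 : Measurable fun q => ‖fderiv ℝ F q (1, 0)‖ₑ := hFd.measurable.enorm
  have hm3 : Measurable fun q => ENNReal.ofReal r * (‖F q‖ₑ ^ (r - 1) * ‖fderiv ℝ F q (1, 0)‖ₑ) :=
    (hm1.mul hm2).const_mul _
  have line : ∀ x, ‖F (0, x)‖ₑ ^ r ≤ ∫⁻ y, ENNReal.ofReal r *
      (‖F (y, x)‖ₑ ^ (r - 1) * ‖fderiv ℝ F (y, x) (1, 0)‖ₑ) := fun x => by
    refine enorm_rpow_le_lintegral (f := fun y => F (y, x))
      (f' := fun y => fderiv ℝ F (y, x) (1, 0)) (fun y => ?_) ?_ (a := -L) (by linarith)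
      (hs _ rfl) hr
    · have h1 := (hF.differentiable one_ne_zero (y, x)).hasFDerivAt
      have h2 : HasDerivAt (fun y : ℝ => (y, x)) ((1 : ℝ), (0 : Space N)) y :=
        (hasDerivAt_id y).prodMk (hasDerivAt_const y x)
      exact h1.comp_hasDerivAt y h2
    · exact hFd.comp (by fun_prop)
  calc ∫⁻ x, ‖F (0, x)‖ₑ ^ r
      ≤ ∫⁻ x, ∫⁻ y, ENNReal.ofReal r *
        (‖F (y, x)‖ₑ ^ (r - 1) * ‖fderiv ℝ F (y, x) (1, 0)‖ₑ) := lintegral_mono line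
    _ = ∫⁻ q, ENNReal.ofReal r * (‖F q‖ₑ ^ (r - 1) * ‖fderiv ℝ F q (1, 0)‖ₑ) := by
        rw [Measure.volume_eq_prod, lintegral_prod_symm _
          hm3.aemeasurable]
    _ = ENNReal.ofReal r * ∫⁻ q, (‖F q‖ₑ ^ (r - 1) * ‖fderiv ℝ F q (1, 0)‖ₑ) :=
        lintegral_const_mul _ (hm1.mul hm2)
    _ ≤ _ := by
        refine mul_le_mul_right ?_ _
        have := ENNReal.lintegral_mul_le_Lp_mul_Lq volume Real.HolderConjugate.two_two
          hm1.aemeasurable hm2.aemeasurable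
        refine this.trans (le_of_eq ?_)
        congr 2
        refine lintegral_congr fun q => ?_
        rw [← ENNReal.rpow_mul]; ring_nf

/-- For N ≥ 2, the number 2(r-1) is within the Sobolev range of dimension N+1 exactly when r ≤
2N/(N-1). The gradient norm occurs with power (r-1) + 1 = r, so the r-th root gives a linear bound.
-/
theorem exists_trace (hN : 1 ≤ N) {S : Set (ℝ × Space N)} (hS : Bornology.IsBounded S) {r : ℝ}
    (hr : 2 ≤ r) (hrN : 2 ≤ N → r ≤ 2 * (N : ℝ) / ((N : ℝ) - 1)) :
    ∃ C : ℝ≥0, ∀ F : ℝ × Space N → ℝ, ContDiff ℝ 1 F → Function.support F ⊆ S →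
      eLpNorm (fun x => F (0, x)) (ENNReal.ofReal r) volume
        ≤ C * eLpNorm (fderiv ℝ F) 2 volume := by
  have hfr : Module.finrank ℝ (ℝ × Space N) = N + 1 := by
    rw [Module.finrank_prod]; simp [add_comm]
  have hq : ((Real.toNNReal (2 * (r - 1)) : ℝ≥0) : ℝ) = 2 * (r - 1) :=
    Real.coe_toNNReal _ (by linarith)
  have : (volume : Measure (ℝ × Space N)).IsAddHaarMeasure := by
    rw [Measure.volume_eq_prod]; infer_instance
  obtain ⟨C, hC⟩ := exists_gagliardoNirenbergSobolev (volume : Measure (ℝ × Space N))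
    (by rw [hfr]; omega) hS (q := Real.toNNReal (2 * (r - 1)))
    (by rw [← NNReal.coe_le_coe, hq, NNReal.coe_one]; linarith) (by
      rw [hfr, hq]
      intro h3
      have h2 : 2 ≤ N := by omega
      have hN2 : (2 : ℝ) ≤ N := by exact_mod_cast h2
      have h4 := hrN h2
      rw [le_div_iff₀ (by linarith)] at h4
      push_cast
      have e : (1 / 2 : ℝ) - ((N : ℝ) + 1)⁻¹ = ((N : ℝ) - 1) / (2 * ((N : ℝ) + 1)) := by
        field_simp; ring
      rw [e, ← one_div, div_le_div_iff₀ (by linarith) (by linarith)]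
      nlinarith)
  -- The hyperplane at height -(|L|+1) misses the support, which supplies the vanishing starting
  -- value on every line.
  obtain ⟨L, hL⟩ := hS.subset_closedBall 0
  refine ⟨(Real.toNNReal r * C ^ (r - 1)) ^ (1 / r), fun F hF hs => ?_⟩
  have r0 : 0 < r := by linarith
  have hvan : ∀ q : ℝ × Space N, q.1 = -(|L| + 1) → F q = 0 := by
    intro q hq
    by_contra h
    have h1 := hL (hs h)
    rw [mem_closedBall_zero_iff, Prod.norm_def] at h1
    have h2 := (le_max_left _ _).trans h1
    rw [hq, norm_neg, Real.norm_of_nonneg (by positivity)] at h2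
    linarith [le_abs_self L]
  have ht := lintegral_trace_le hF (by positivity) hvan (by linarith : 1 < r)
  set G := eLpNorm (fderiv ℝ F) 2 volume with hG
  have hg := hC F hF hs
  have e1 : (∫⁻ q, ‖F q‖ₑ ^ (2 * (r - 1))) ^ (1 / 2 : ℝ)
      = eLpNorm F (Real.toNNReal (2 * (r - 1))) volume ^ (r - 1) := by
    have hp0 : ((Real.toNNReal (2 * (r - 1)) : ℝ≥0) : ℝ≥0∞) ≠ 0 := by
      simp only [ne_eq, ENNReal.coe_eq_zero, Real.toNNReal_eq_zero, not_le]; linarith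
    rw [eLpNorm_eq_lintegral_rpow_enorm_toReal hp0 ENNReal.coe_ne_top, ENNReal.coe_toReal, hq,
      ← ENNReal.rpow_mul]
    congr 1
    have : r - 1 ≠ 0 := by linarith
    field_simp
  have e2 : (∫⁻ q, ‖fderiv ℝ F q (1, 0)‖ₑ ^ (2 : ℝ)) ^ (1 / 2 : ℝ) ≤ G := by
    rw [hG, eLpNorm_eq_lintegral_rpow_enorm_toReal two_ne_zero ENNReal.ofNat_ne_top,
      ENNReal.toReal_ofNat]
    refine ENNReal.rpow_le_rpow (lintegral_mono fun q => ENNReal.rpow_le_rpow ?_ zero_le_two)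
      (by norm_num)
    have h1 := (fderiv ℝ F q).le_opNorm ((1 : ℝ), (0 : Space N))
    have h2 : ‖((1 : ℝ), (0 : Space N))‖ = 1 := by simp [Prod.norm_def]
    rw [h2, mul_one] at h1
    rw [← ofReal_norm, ← ofReal_norm]
    exact ENNReal.ofReal_le_ofReal h1
  have r1 : 0 ≤ r - 1 := by linarith
  have h3 : ∫⁻ x, ‖F (0, x)‖ₑ ^ r ≤ ENNReal.ofReal r * C ^ (r - 1) * G ^ r := by
    refine ht.trans ?_
    rw [e1, mul_assoc]
    refine mul_le_mul_right ?_ _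
    calc _ ≤ (C * G) ^ (r - 1) * G := mul_le_mul' (ENNReal.rpow_le_rpow hg r1) e2
      _ = C ^ (r - 1) * G ^ r := by
        rw [ENNReal.mul_rpow_of_nonneg _ _ r1, mul_assoc]
        congr 1
        conv_lhs => rw [← ENNReal.rpow_one G, ← ENNReal.rpow_mul]
        rw [one_mul, ← ENNReal.rpow_add_of_nonneg _ _ r1 zero_le_one]
        ring_nf
  have hr0 : ENNReal.ofReal r ≠ 0 := by simpa using r0
  rw [eLpNorm_eq_lintegral_rpow_enorm_toReal hr0 ENNReal.ofReal_ne_top,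
    ENNReal.toReal_ofReal r0.le]
  refine (ENNReal.rpow_le_rpow h3 (by positivity)).trans (le_of_eq ?_)
  have hir : 0 ≤ 1 / r := by positivity
  rw [ENNReal.mul_rpow_of_nonneg _ _ hir, ← ENNReal.rpow_mul G, mul_one_div_cancel r0.ne',
    ENNReal.rpow_one, ENNReal.coe_rpow_of_nonneg _ hir, ENNReal.coe_mul,
    ENNReal.coe_rpow_of_nonneg _ r1]
  rfl

end Trace

/-! ### Mollification as a pairing with moving bumps in L²(B). -/

section BumpPairing

variable {N : ℕ}

/-- The translated mollifier `z ↦ φ(x - z)` in `L²(B)`. -/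
noncomputable def bumpAt (φ : ContDiffBump (0 : Space N)) (x : Space N) : BallL2 N :=
  toL2 fun z => φ.normed volume (x - z)

theorem memLp_bump (φ : ContDiffBump (0 : Space N)) (x : Space N) :
    MemLp (fun z => φ.normed volume (x - z)) 2 (ballMeasure N) :=
  memLp_ball_of_continuous (contDiff_normed_reflect φ x).continuous

/-- The kernel is Lipschitz and B has finite measure. Pairing a continuous curve with a bump that
moves continuously then gives joint continuity in time and space. -/
theorem continuous_bumpAt (φ : ContDiffBump (0 : Space N)) : Continuous (bumpAt φ) := by
  obtain ⟨K, hK⟩ := (φ.contDiff_normed (μ := volume) (n := 1)).lipschitzWith_of_hasCompactSupport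
    φ.hasCompactSupport_normed one_ne_zero
  have hmem := memLp_bump φ
  refine (LipschitzWith.of_dist_le_mul (K := measureUnivNNReal (ballMeasure N)
    ^ ((2 : ℝ≥0∞).toReal)⁻¹ * K) fun x y => ?_).continuous
  rw [dist_eq_norm, bumpAt, bumpAt, ← toL2_sub (hmem x) (hmem y)]
  push_cast
  rw [mul_assoc]
  refine Lp.norm_le_of_ae_bound (mul_nonneg (NNReal.coe_nonneg _) dist_nonneg) ?_
  filter_upwards [coeFn_toL2 ((hmem x).sub (hmem y))] with z hz
  rw [hz]
  have := hK.dist_le_mul (x - z) (y - z)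
  rwa [dist_sub_right] at this

theorem tsupport_bump_subset {φ : ContDiffBump (0 : Space N)} (hφ : φ.rOut ≤ 1 / 8) {x : Space N}
    (hx : x ∈ Metric.closedBall (0 : Space N) (1 / 2)) :
    tsupport (fun z => φ.normed volume (x - z)) ⊆ Metric.ball 0 1 := by
  have h1 : tsupport (fun z => φ.normed volume (x - z)) ⊆ Metric.closedBall x (1 / 8) := by
    refine closure_minimal (fun z hz => ?_) Metric.isClosed_closedBall
    have h2 : x - z ∈ Function.support (φ.normed volume) := hz
    rw [φ.support_normed_eq] at h2
    rw [Metric.mem_closedBall, dist_comm, dist_eq_norm]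
    exact (mem_ball_zero_iff.1 h2).le.trans hφ
  refine h1.trans fun z hz => ?_
  rw [mem_closedBall_zero_iff] at hx
  rw [Metric.mem_closedBall, dist_eq_norm] at hz
  rw [mem_ball_zero_iff]
  calc ‖z‖ = ‖(z - x) + x‖ := by rw [sub_add_cancel]
    _ ≤ ‖z - x‖ + ‖x‖ := norm_add_le _ _
    _ < 1 := by linarith

theorem inner_bumpAt {φ : ContDiffBump (0 : Space N)} (hφ : φ.rOut ≤ 1 / 8) {f : Space N → ℝ}
    (hf : MemLp f 2 (ballMeasure N)) {x : Space N}
    (hx : x ∈ Metric.closedBall (0 : Space N) (1 / 2)) :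
    inner ℝ (toL2 f) (bumpAt φ x) = moll φ f x := by
  rw [bumpAt, inner_toL2_test hf (contDiff_normed_reflect φ x).continuous
    (tsupport_bump_subset hφ hx), moll_apply]

/-- Extension of Z by zero makes the pairing a mollification on the smaller ball, so the L² bound
for mollifiers applies. -/
theorem eLpNorm_inner_bumpAt_le {φ : ContDiffBump (0 : Space N)} (hφ : φ.rOut ≤ 1 / 8)
    (Z : BallL2 N) :
    eLpNorm (fun x => inner ℝ Z (bumpAt φ x)) 2 (volume.restrict (Metric.closedBall 0 (3 / 8)))
      ≤ eLpNorm Z 2 (volume.restrict (Metric.closedBall 0 (1 / 2))) := by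
  have hm : MeasurableSet (ball1 (0 : Space N)) := Metric.isClosed_closedBall.measurableSet
  set h : Space N → ℝ := (ball1 (0 : Space N)).indicator Z with hh
  have hZh : h =ᵐ[ballMeasure N] Z := indicator_ae_eq_restrict hm
  have haesm : AEStronglyMeasurable h volume :=
    (aestronglyMeasurable_indicator_iff hm).2 (Lp.aestronglyMeasurable Z)
  have hmem : MemLp h 2 (ballMeasure N) := (memLp_congr_ae hZh).2 (Lp.memLp Z)
  have hZ : toL2 h = Z := by
    rw [toL2_congr hZh, toL2, dif_pos (Lp.memLp Z)]
    exact Lp.toLp_coeFn Z _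
  have e1 : eLpNorm (fun x => inner ℝ Z (bumpAt φ x)) 2
      (volume.restrict (Metric.closedBall 0 (3 / 8)))
      = eLpNorm (moll φ h) 2 (volume.restrict (Metric.closedBall 0 (3 / 8))) := by
    refine eLpNorm_congr_ae ((ae_restrict_iff' Metric.isClosed_closedBall.measurableSet).2
      (.of_forall fun x hx => ?_))
    simp only
    rw [← inner_bumpAt hφ hmem (Metric.closedBall_subset_closedBall (by norm_num) hx), hZ]
  have e2 : eLpNorm h 2 (volume.restrict (Metric.closedBall 0 (1 / 2)))
      = eLpNorm Z 2 (volume.restrict (Metric.closedBall 0 (1 / 2))) := by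
    refine eLpNorm_congr_ae ?_
    exact ae_mono (Measure.restrict_mono (Metric.closedBall_subset_closedBall (by norm_num))
      le_rfl) hZh
  rw [e1, ← e2]
  exact eLpNorm_moll_le φ haesm _ _ (by linarith) 0

theorem hasFDerivAt_inner_bumpAt {φ : ContDiffBump (0 : Space N)} (hφ : φ.rOut ≤ 1 / 8)
    {f : Space N → ℝ} {g : Fin N → Space N → ℝ} (hf : MemLp f 2 (ballMeasure N))
    (hg : ∀ i, MemLp (g i) 2 (ballMeasure N)) (hfl : LocallyIntegrable f)
    (hfg : ∀ i, HasWeakPartial i f (g i))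
    {x : Space N} (hx : x ∈ Metric.ball (0 : Space N) (1 / 2)) :
    HasFDerivAt (fun x => inner ℝ (toL2 f) (bumpAt φ x))
      (∑ i, inner ℝ (toL2 (g i)) (bumpAt φ x) • (EuclideanSpace.proj i : Space N →L[ℝ] ℝ)) x := by
  have h1 : HasFDerivAt (moll φ f) (fderiv ℝ (moll φ f) x) x :=
    ((contDiff_moll φ hfl).differentiable (by simp) x).hasFDerivAt
  have h2 : HasFDerivAt (fun x => inner ℝ (toL2 f) (bumpAt φ x)) (fderiv ℝ (moll φ f) x) x := by
    refine h1.congr_of_eventuallyEq ?_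
    filter_upwards [Metric.isOpen_ball.mem_nhds hx] with y hy
    exact inner_bumpAt hφ hf (Metric.ball_subset_closedBall hy)
  convert h2 using 1
  refine ContinuousLinearMap.ext fun y => ?_
  have hy : y = ∑ i, y i • EuclideanSpace.single i (1 : ℝ) := by
    ext j
    simp [Finset.sum_apply, Pi.single_apply]
  have e : ∀ i, inner ℝ (toL2 (g i)) (bumpAt φ x)
      = fderiv ℝ (moll φ f) x (EuclideanSpace.single i 1) := fun i => by
    rw [fderiv_moll φ (hfg i), inner_bumpAt hφ (hg i) (Metric.ball_subset_closedBall hx)]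
  conv_rhs => rw [hy, map_sum]
  simp only [sum_apply, smul_apply, e, smul_eq_mul, map_smul, PiLp.proj_apply]
  exact Finset.sum_congr rfl fun i _ => mul_comm _ _

end BumpPairing

/-! ### Smoothing of curves with one derivative in time and space. -/

section SobolevCurve

variable {N : ℕ}

/-- A curve of functions, differentiable in time and weakly differentiable in space, with all
first derivatives continuous in `L²(B)`. -/
structure IsSobolevCurve (δ : ℝ) (f : ℝ → Space N → ℝ) (g : Fin N → ℝ → Space N → ℝ)
    (X' : ℝ → BallL2 N) : Prop where
  memLp : ∀ y ∈ Ioo (-δ) δ, MemLp (f y) 2 (ballMeasure N)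
  memLp_grad : ∀ i, ∀ y ∈ Ioo (-δ) δ, MemLp (g i y) 2 (ballMeasure N)
  locallyIntegrable : ∀ y ∈ Ioo (-δ) δ, LocallyIntegrable (f y)
  hasWeakPartial : ∀ i, ∀ y ∈ Ioo (-δ) δ, HasWeakPartial i (f y) (g i y)
  hasDerivAt : ∀ y ∈ Ioo (-δ) δ, HasDerivAt (fun y => toL2 (f y)) (X' y) y
  continuousOn_deriv : ContinuousOn X' (Ioo (-δ) δ)
  continuousOn_grad : ∀ i, ContinuousOn (fun y => toL2 (g i y)) (Ioo (-δ) δ)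

variable {δ : ℝ} {f : ℝ → Space N → ℝ} {g : Fin N → ℝ → Space N → ℝ} {X' : ℝ → BallL2 N}
  {φ : ContDiffBump (0 : Space N)}

/-- The space-time mollified curve. -/
noncomputable def smoothed (φ : ContDiffBump (0 : Space N)) (f : ℝ → Space N → ℝ)
    (q : ℝ × Space N) : ℝ := inner ℝ (toL2 (f q.1)) (bumpAt φ q.2)

/-- Its derivative. -/
noncomputable def smoothedDeriv (φ : ContDiffBump (0 : Space N)) (g : Fin N → ℝ → Space N → ℝ)
    (X' : ℝ → BallL2 N) (q : ℝ × Space N) : ℝ × Space N →L[ℝ] ℝ :=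
  (ContinuousLinearMap.toSpanSingleton ℝ (inner ℝ (X' q.1) (bumpAt φ q.2) : ℝ)).coprod
    (∑ i, inner ℝ (toL2 (g i q.1)) (bumpAt φ q.2) • (EuclideanSpace.proj i : Space N →L[ℝ] ℝ))

theorem continuousOn_inner_bumpAt {Z : ℝ → BallL2 N} {S : Set ℝ} (hZ : ContinuousOn Z S)
    (A : Set (Space N)) :
    ContinuousOn (fun q : ℝ × Space N => (inner ℝ (Z q.1) (bumpAt φ q.2) : ℝ)) (S ×ˢ A) :=
  ContinuousOn.inner (𝕜 := ℝ) (hZ.comp continuousOn_fst fun _ hq => hq.1)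
    ((continuous_bumpAt φ).comp continuous_snd).continuousOn

theorem IsSobolevCurve.continuousOn_smoothedDeriv (h : IsSobolevCurve δ f g X') :
    ContinuousOn (smoothedDeriv φ g X') (Ioo (-δ) δ ×ˢ Metric.ball (0 : Space N) (1 / 2)) := by
  have h1 := continuousOn_inner_bumpAt (φ := φ) h.continuousOn_deriv (Metric.ball 0 (1 / 2))
  have h2 := fun i => continuousOn_inner_bumpAt (φ := φ) (h.continuousOn_grad i)
    (Metric.ball 0 (1 / 2))
  have e : smoothedDeriv φ g X' = fun q : ℝ × Space N =>
      (inner ℝ (X' q.1) (bumpAt φ q.2) : ℝ) • ContinuousLinearMap.fst ℝ ℝ (Space N)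
      + ∑ i, (inner ℝ (toL2 (g i q.1)) (bumpAt φ q.2) : ℝ) •
        ((EuclideanSpace.proj i : Space N →L[ℝ] ℝ).comp (ContinuousLinearMap.snd ℝ ℝ (Space N))) := by
    funext q
    refine ContinuousLinearMap.ext fun w => ?_
    simp [smoothedDeriv, mul_comm]
  rw [e]
  exact (h1.smul continuousOn_const).add
    (continuousOn_finsetSum _ fun i _ => (h2 i).smul continuousOn_const)

/-- Mollification acts in space only, since the curve is already differentiable in time. Both
partial derivatives are jointly continuous, which gives total differentiability. -/
theorem IsSobolevCurve.hasFDerivAt_smoothed (h : IsSobolevCurve δ f g X') (hφ : φ.rOut ≤ 1 / 8)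
    {q : ℝ × Space N} (hq : q ∈ Ioo (-δ) δ ×ˢ Metric.ball (0 : Space N) (1 / 2)) :
    HasFDerivAt (smoothed φ f) (smoothedDeriv φ g X' q) q := by
  have hU : Ioo (-δ) δ ×ˢ Metric.ball (0 : Space N) (1 / 2) ∈ 𝓝 q :=
    (isOpen_Ioo.prod Metric.isOpen_ball).mem_nhds hq
  have hcX := continuousOn_inner_bumpAt (φ := φ) h.continuousOn_deriv (Metric.ball 0 (1 / 2))
  have hcG := fun i => continuousOn_inner_bumpAt (φ := φ) (h.continuousOn_grad i)
    (Metric.ball 0 (1 / 2))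
  have := hasStrictFDerivAt_uncurry_coprod (𝕜 := ℝ) (u := q)
    (f := fun y x => (inner ℝ (toL2 (f y)) (bumpAt φ x) : ℝ))
    (f₁ := fun y x => ContinuousLinearMap.toSpanSingleton ℝ (inner ℝ (X' y) (bumpAt φ x) : ℝ))
    (f₂ := fun y x => ∑ i, (inner ℝ (toL2 (g i y)) (bumpAt φ x) : ℝ) •
      (EuclideanSpace.proj i : Space N →L[ℝ] ℝ)) ?_ ?_ ?_ ?_
  · exact this.hasFDerivAt
  · filter_upwards [hU] with w hw
    have h1 := (h.hasDerivAt w.1 hw.1).inner ℝ (hasDerivAt_const w.1 (bumpAt φ w.2))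
    rw [inner_zero_right, zero_add] at h1
    exact h1.hasFDerivAt
  · filter_upwards [hU] with w hw
    exact hasFDerivAt_inner_bumpAt hφ (h.memLp _ hw.1) (fun i => h.memLp_grad i _ hw.1)
      (h.locallyIntegrable _ hw.1) (fun i => h.hasWeakPartial i _ hw.1) hw.2
  · have e : (fun q : ℝ × Space N => ContinuousLinearMap.toSpanSingleton ℝ
        (inner ℝ (X' q.1) (bumpAt φ q.2) : ℝ)) = fun q : ℝ × Space N =>
        (inner ℝ (X' q.1) (bumpAt φ q.2) : ℝ) • ContinuousLinearMap.id ℝ ℝ := by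
      funext q
      refine ContinuousLinearMap.ext fun w => ?_
      simp [mul_comm]
    show ContinuousAt (fun q : ℝ × Space N => ContinuousLinearMap.toSpanSingleton ℝ
        (inner ℝ (X' q.1) (bumpAt φ q.2) : ℝ)) q
    rw [e]
    exact (hcX.continuousAt hU).smul continuousAt_const
  · show ContinuousAt (fun q : ℝ × Space N => ∑ i, (inner ℝ (toL2 (g i q.1)) (bumpAt φ q.2) : ℝ) •
      (EuclideanSpace.proj i : Space N →L[ℝ] ℝ)) q
    exact (continuousOn_finsetSum _ fun i _ => (hcG i).smul continuousOn_const).continuousAt hU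

theorem norm_smoothedDeriv_le (q : ℝ × Space N) :
    ‖smoothedDeriv φ g X' q‖ ≤ |inner ℝ (X' q.1) (bumpAt φ q.2)|
      + ∑ i, |inner ℝ (toL2 (g i q.1)) (bumpAt φ q.2)| := by
  refine ContinuousLinearMap.opNorm_le_bound _ (by positivity) fun w => ?_
  rw [smoothedDeriv, ContinuousLinearMap.coprod_apply, add_mul]
  have hw1 : ‖w.1‖ ≤ ‖w‖ := norm_fst_le w
  have hw2 : ‖w.2‖ ≤ ‖w‖ := norm_snd_le w
  refine (norm_add_le _ _).trans (add_le_add ?_ ?_)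
  · rw [ContinuousLinearMap.toSpanSingleton_apply, norm_smul, mul_comm, Real.norm_eq_abs]
    exact mul_le_mul_of_nonneg_left hw1 (abs_nonneg _)
  · rw [sum_apply, Finset.sum_mul]
    refine (norm_sum_le _ _).trans (Finset.sum_le_sum fun i _ => ?_)
    rw [smul_apply, norm_smul, Real.norm_eq_abs]
    refine mul_le_mul_of_nonneg_left ?_ (abs_nonneg _)
    exact (PiLp.norm_apply_le w.2 i).trans hw2

/-- The `L²` norm in time of the local `L²` norms. -/
noncomputable def timeNorm (δ : ℝ) (Z : ℝ → BallL2 N) : ℝ≥0∞ :=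
  (∫⁻ y in Ioo (-δ) δ,
    eLpNorm (Z y) 2 (volume.restrict (Metric.closedBall 0 (1 / 2))) ^ (2 : ℝ)) ^ (1 / 2 : ℝ)

theorem eLpNorm_inner_bumpAt_prod_le (hφ : φ.rOut ≤ 1 / 8) {Z : ℝ → BallL2 N}
    (hZ : ContinuousOn Z (Ioo (-δ) δ)) :
    eLpNorm (fun q : ℝ × Space N => (inner ℝ (Z q.1) (bumpAt φ q.2) : ℝ)) 2
      ((volume : Measure (ℝ × Space N)).restrict
        (Ioo (-δ) δ ×ˢ Metric.closedBall (0 : Space N) (3 / 8)))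
      ≤ timeNorm δ Z := by
  have hmeas : MeasurableSet (Ioo (-δ) δ ×ˢ Metric.closedBall (0 : Space N) (3 / 8)) :=
    measurableSet_Ioo.prod Metric.isClosed_closedBall.measurableSet
  have haesm := (continuousOn_inner_bumpAt (φ := φ) hZ
    (Metric.closedBall 0 (3 / 8))).aestronglyMeasurable (μ := volume) hmeas
  rw [eLpNorm_eq_lintegral_rpow_enorm_toReal two_ne_zero ENNReal.ofNat_ne_top,
    ENNReal.toReal_ofNat, timeNorm]
  refine ENNReal.rpow_le_rpow ?_ (by norm_num)
  rw [Measure.volume_eq_prod, ← Measure.prod_restrict] at haesm ⊢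
  rw [lintegral_prod _ (haesm.enorm.pow_const _)]
  refine lintegral_mono fun y => ?_
  have h1 := eLpNorm_inner_bumpAt_le hφ (Z y)
  have h2 := ENNReal.rpow_le_rpow h1 zero_le_two
  refine le_trans (le_of_eq ?_) h2
  rw [eLpNorm_eq_lintegral_rpow_enorm_toReal two_ne_zero ENNReal.ofNat_ne_top,
    ENNReal.toReal_ofNat, ← ENNReal.rpow_mul]
  norm_num

end SobolevCurve

/-! ### Space-time localization and the trace theorem for curves. -/

section TraceCurve

variable {N : ℕ}

/-- A smooth cutoff in time at unit scale. -/
noncomputable def timeCutoff : ContDiffBump (0 : ℝ) := ⟨1 / 2, 3 / 4, by norm_num, by norm_num⟩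

/-- The space-time cutoff, at scale `δ` in time. -/
noncomputable def spaceTimeCutoff (N : ℕ) (δ : ℝ) (q : ℝ × Space N) : ℝ :=
  timeCutoff (q.1 / δ) * cutoff N q.2

theorem contDiff_spaceTimeCutoff (N : ℕ) (δ : ℝ) : ContDiff ℝ 1 (spaceTimeCutoff N δ) :=
  (timeCutoff.contDiff.comp (contDiff_fst.div_const δ)).mul ((cutoff N).contDiff.comp contDiff_snd)

theorem spaceTimeCutoff_nonneg (N : ℕ) (δ : ℝ) (q : ℝ × Space N) : 0 ≤ spaceTimeCutoff N δ q :=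
  mul_nonneg timeCutoff.nonneg (cutoff N).nonneg

theorem spaceTimeCutoff_le_one (N : ℕ) (δ : ℝ) (q : ℝ × Space N) : spaceTimeCutoff N δ q ≤ 1 :=
  mul_le_one₀ timeCutoff.le_one (cutoff N).nonneg (cutoff N).le_one

/-- A closed set carrying the space-time cutoff. -/
def cutoffSupport (N : ℕ) (δ : ℝ) : Set (ℝ × Space N) :=
  Icc (-(3 / 4 * δ)) (3 / 4 * δ) ×ˢ Metric.closedBall (0 : Space N) (3 / 8)

theorem spaceTimeCutoff_eq_zero {δ : ℝ} (hδ : 0 < δ) {q : ℝ × Space N}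
    (hq : q ∉ cutoffSupport N δ) : spaceTimeCutoff N δ q = 0 := by
  rw [spaceTimeCutoff]
  by_cases h : q.2 ∈ Metric.closedBall (0 : Space N) (3 / 8)
  · have h1 : ¬ |q.1| ≤ 3 / 4 * δ := fun h1 => hq ⟨abs_le.1 h1, h⟩
    rw [timeCutoff.zero_of_le_dist, zero_mul]
    rw [dist_zero_right, Real.norm_eq_abs, abs_div, abs_of_pos hδ, le_div_iff₀ hδ]
    exact (not_le.1 h1).le
  · rw [cutoff_eq_zero h, mul_zero]

/-- The cutoff at scale δ is the one at unit scale composed with a linear map of norm at most δ⁻¹ +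
1. The constant is thus uniform in δ. -/
theorem exists_bound_fderiv_spaceTimeCutoff (N : ℕ) : ∃ W : ℝ≥0, ∀ δ : ℝ, 0 < δ → ∀ q,
    ‖fderiv ℝ (spaceTimeCutoff N δ) q‖ ≤ W * (δ⁻¹ + 1) := by
  have hcd := contDiff_spaceTimeCutoff N 1
  have hcs : HasCompactSupport (spaceTimeCutoff N 1) := by
    refine HasCompactSupport.intro (K := cutoffSupport N 1)
      (isCompact_Icc.prod (isCompact_closedBall 0 (3 / 8))) fun q hq =>
        spaceTimeCutoff_eq_zero one_pos hq
  obtain ⟨C, hC⟩ := (hcd.continuous_fderiv one_ne_zero).bounded_above_of_compact_support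
    (hcs.fderiv ℝ)
  refine ⟨C.toNNReal, fun δ hδ q => ?_⟩
  set A : ℝ × Space N →L[ℝ] ℝ × Space N :=
    (δ⁻¹ • ContinuousLinearMap.fst ℝ ℝ (Space N)).prod (ContinuousLinearMap.snd ℝ ℝ (Space N))
    with hA
  have e : spaceTimeCutoff N δ = spaceTimeCutoff N 1 ∘ A := by
    funext w
    simp [spaceTimeCutoff, hA, div_eq_inv_mul]
  have hnA : ‖A‖ ≤ δ⁻¹ + 1 := by
    refine ContinuousLinearMap.opNorm_le_bound _ (by positivity) fun w => ?_
    have hw1 : ‖w.1‖ ≤ ‖w‖ := norm_fst_le w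
    have hw2 : ‖w.2‖ ≤ ‖w‖ := norm_snd_le w
    have hd : 0 < δ⁻¹ := inv_pos.2 hδ
    have hn := norm_nonneg w
    simp only [hA, ContinuousLinearMap.prod_apply, smul_apply, ContinuousLinearMap.coe_fst',
      ContinuousLinearMap.coe_snd', Prod.norm_def, norm_smul, Real.norm_of_nonneg hd.le]
    rw [← Prod.norm_def]
    refine max_le ?_ ?_
    · nlinarith
    · nlinarith [mul_nonneg hd.le hn]
  have hfd : fderiv ℝ (spaceTimeCutoff N δ) q = (fderiv ℝ (spaceTimeCutoff N 1) (A q)).comp A := by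
    rw [e, fderiv_comp q (hcd.differentiable one_ne_zero _) A.differentiableAt, A.fderiv]
  rw [hfd]
  refine (ContinuousLinearMap.opNorm_comp_le _ _).trans ?_
  exact mul_le_mul ((hC _).trans (Real.le_coe_toNNReal C)) hnA (norm_nonneg _) (NNReal.coe_nonneg _)

variable {δ : ℝ} {f : ℝ → Space N → ℝ} {g : Fin N → ℝ → Space N → ℝ} {X' : ℝ → BallL2 N}
  {φ : ContDiffBump (0 : Space N)}

theorem cutoffSupport_subset (hδ : 0 < δ) :
    cutoffSupport N δ ⊆ Ioo (-δ) δ ×ˢ Metric.ball (0 : Space N) (1 / 2) := fun q hq =>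
  ⟨⟨by have := hq.1.1; linarith, by have := hq.1.2; linarith⟩,
    Metric.closedBall_subset_ball (by norm_num) hq.2⟩

theorem isClosed_cutoffSupport : IsClosed (cutoffSupport N δ) :=
  isClosed_Icc.prod Metric.isClosed_closedBall

theorem IsSobolevCurve.contDiffAt_smoothed (h : IsSobolevCurve δ f g X') (hφ : φ.rOut ≤ 1 / 8)
    {q : ℝ × Space N} (hq : q ∈ Ioo (-δ) δ ×ˢ Metric.ball (0 : Space N) (1 / 2)) :
    ContDiffAt ℝ 1 (smoothed φ f) q :=
  contDiffAt_one_iff.2 ⟨smoothedDeriv φ g X', _,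
    (isOpen_Ioo.prod Metric.isOpen_ball).mem_nhds hq, h.continuousOn_smoothedDeriv,
    fun _ hw => h.hasFDerivAt_smoothed hφ hw⟩

/-- The localized smoothed curve. -/
noncomputable def localized (φ : ContDiffBump (0 : Space N)) (δ : ℝ) (f : ℝ → Space N → ℝ)
    (q : ℝ × Space N) : ℝ := spaceTimeCutoff N δ q * smoothed φ f q

theorem localized_eventuallyEq_zero (hδ : 0 < δ) {q : ℝ × Space N} (hq : q ∉ cutoffSupport N δ) :
    localized φ δ f =ᶠ[𝓝 q] fun _ => 0 := by
  filter_upwards [isClosed_cutoffSupport.isOpen_compl.mem_nhds hq] with w hw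
  rw [localized, spaceTimeCutoff_eq_zero hδ hw, zero_mul]

theorem IsSobolevCurve.contDiff_localized (h : IsSobolevCurve δ f g X') (hφ : φ.rOut ≤ 1 / 8)
    (hδ : 0 < δ) : ContDiff ℝ 1 (localized φ δ f) := by
  refine contDiff_iff_contDiffAt.2 fun q => ?_
  by_cases hq : q ∈ cutoffSupport N δ
  · exact (contDiff_spaceTimeCutoff N δ).contDiffAt.mul
      (h.contDiffAt_smoothed hφ (cutoffSupport_subset hδ hq))
  · exact contDiffAt_const.congr_of_eventuallyEq (localized_eventuallyEq_zero hδ hq)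

theorem IsSobolevCurve.norm_fderiv_localized_le (h : IsSobolevCurve δ f g X')
    (hφ : φ.rOut ≤ 1 / 8) (hδ : 0 < δ) {B : ℝ}
    (hB : ∀ q, ‖fderiv ℝ (spaceTimeCutoff N δ) q‖ ≤ B) {q : ℝ × Space N}
    (hq : q ∈ cutoffSupport N δ) :
    ‖fderiv ℝ (localized φ δ f) q‖ ≤ B * |inner ℝ (toL2 (f q.1)) (bumpAt φ q.2)|
      + (|inner ℝ (X' q.1) (bumpAt φ q.2)|
      + ∑ i, |inner ℝ (toL2 (g i q.1)) (bumpAt φ q.2)|) := by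
  have h1 := ((contDiff_spaceTimeCutoff N δ).differentiable one_ne_zero q).hasFDerivAt
  have h2 := h.hasFDerivAt_smoothed hφ (cutoffSupport_subset hδ hq)
  have h3 : HasFDerivAt (localized φ δ f) (spaceTimeCutoff N δ q • smoothedDeriv φ g X' q
      + smoothed φ f q • fderiv ℝ (spaceTimeCutoff N δ) q) q := h1.mul h2
  rw [h3.fderiv, add_comm]
  refine (norm_add_le _ _).trans (add_le_add ?_ ?_)
  · rw [norm_smul, mul_comm, Real.norm_eq_abs, smoothed]
    exact mul_le_mul_of_nonneg_right (hB q) (abs_nonneg _)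
  · rw [norm_smul, Real.norm_of_nonneg (spaceTimeCutoff_nonneg N δ q)]
    exact (mul_le_of_le_one_left (norm_nonneg _) (spaceTimeCutoff_le_one N δ q)).trans
      (norm_smoothedDeriv_le q)

theorem IsSobolevCurve.eLpNorm_fderiv_localized_le (h : IsSobolevCurve δ f g X')
    (hφ : φ.rOut ≤ 1 / 8) (hδ : 0 < δ) {B : ℝ≥0}
    (hB : ∀ q, ‖fderiv ℝ (spaceTimeCutoff N δ) q‖ ≤ B) :
    eLpNorm (fderiv ℝ (localized φ δ f)) 2 volume
      ≤ B * timeNorm δ (fun y => toL2 (f y)) + (timeNorm δ X'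
        + ∑ i, timeNorm δ (fun y => toL2 (g i y))) := by
  set U : Set (ℝ × Space N) := Ioo (-δ) δ ×ˢ Metric.closedBall (0 : Space N) (3 / 8) with hU
  have hUm : MeasurableSet U := measurableSet_Ioo.prod Metric.isClosed_closedBall.measurableSet
  have hKU : cutoffSupport N δ ⊆ U := fun q hq => ⟨(cutoffSupport_subset hδ hq).1, hq.2⟩
  have hcont : ContinuousOn (fun y => toL2 (f y)) (Ioo (-δ) δ) := fun y hy =>
    (h.hasDerivAt y hy).continuousAt.continuousWithinAt
  set ν := (volume : Measure (ℝ × Space N)).restrict U with hν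
  have m : ∀ {Z : ℝ → BallL2 N}, ContinuousOn Z (Ioo (-δ) δ) →
      AEStronglyMeasurable (fun q : ℝ × Space N => (|inner ℝ (Z q.1) (bumpAt φ q.2)| : ℝ)) ν :=
    fun hZ => ((continuousOn_inner_bumpAt hZ _).aestronglyMeasurable hUm).norm
  have n : ∀ {Z : ℝ → BallL2 N}, ContinuousOn Z (Ioo (-δ) δ) →
      eLpNorm (fun q : ℝ × Space N => (|inner ℝ (Z q.1) (bumpAt φ q.2)| : ℝ)) 2 ν
        ≤ timeNorm δ Z := fun hZ =>
    (eLpNorm_norm (fun q : ℝ × Space N => (inner ℝ (_ : BallL2 N) (bumpAt φ q.2) : ℝ))).le.trans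
      (eLpNorm_inner_bumpAt_prod_le hφ hZ)
  have step : eLpNorm (fderiv ℝ (localized φ δ f)) 2 volume
      ≤ eLpNorm ((fun q : ℝ × Space N => (B : ℝ) * |inner ℝ (toL2 (f q.1)) (bumpAt φ q.2)|)
      + ((fun q : ℝ × Space N => |inner ℝ (X' q.1) (bumpAt φ q.2)|)
      + ∑ i, fun q : ℝ × Space N => |inner ℝ (toL2 (g i q.1)) (bumpAt φ q.2)|)) 2 ν := by
    rw [hν, ← eLpNorm_indicator_eq_eLpNorm_restrict hUm]
    refine eLpNorm_mono fun q => ?_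
    have hnn : 0 ≤ (B : ℝ) * |inner ℝ (toL2 (f q.1)) (bumpAt φ q.2)|
      + (|inner ℝ (X' q.1) (bumpAt φ q.2)|
      + ∑ i, |inner ℝ (toL2 (g i q.1)) (bumpAt φ q.2)|) := by positivity
    by_cases hq : q ∈ cutoffSupport N δ
    · rw [indicator_of_mem (hKU hq)]
      simp only [Pi.add_apply, Finset.sum_apply]
      rw [Real.norm_of_nonneg hnn]
      exact h.norm_fderiv_localized_le hφ hδ hB hq
    · have hz : fderiv ℝ (localized φ δ f) q = 0 := by
        rw [(localized_eventuallyEq_zero hδ hq).fderiv_eq]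
        simp
      rw [hz, norm_zero]
      exact norm_nonneg _
  refine step.trans ?_
  have mS : AEStronglyMeasurable
      (∑ i, fun q : ℝ × Space N => (|inner ℝ (toL2 (g i q.1)) (bumpAt φ q.2)| : ℝ)) ν :=
    Finset.aestronglyMeasurable_sum _ fun i _ => m (h.continuousOn_grad i)
  refine (eLpNorm_add_le ((m hcont).const_mul _)
    ((m h.continuousOn_deriv).add mS) one_le_two).trans (add_le_add ?_ ?_)
  · have : eLpNorm (fun q : ℝ × Space N => (B : ℝ) * |inner ℝ (toL2 (f q.1)) (bumpAt φ q.2)|) 2 ν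
        = ‖(B : ℝ)‖ₑ * eLpNorm (fun q : ℝ × Space N =>
          (|inner ℝ (toL2 (f q.1)) (bumpAt φ q.2)| : ℝ)) 2 ν :=
      eLpNorm_const_smul (B : ℝ) _ 2 ν
    rw [this, show ‖(B : ℝ)‖ₑ = (B : ℝ≥0∞) by simp]
    exact mul_le_mul_right (n hcont) _
  · refine (eLpNorm_add_le (m h.continuousOn_deriv) mS one_le_two).trans
      (add_le_add (n h.continuousOn_deriv) ?_)
    refine (eLpNorm_sum_le (fun i _ => m (h.continuousOn_grad i)) one_le_two).trans ?_
    have nG : ∀ i, eLpNorm (fun q : ℝ × Space N =>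
        (|inner ℝ (toL2 (g i q.1)) (bumpAt φ q.2)| : ℝ)) 2 ν
        ≤ timeNorm δ (fun y => toL2 (g i y)) := fun i =>
      n (Z := fun y => toL2 (g i y)) (h.continuousOn_grad i)
    exact Finset.sum_le_sum fun i _ => nG i

/-- Trace theorem for Sobolev curves on a time interval of length comparable to `δ`. -/
theorem exists_trace_curve (hN : 1 ≤ N) (L : ℝ) {r : ℝ} (hr : 2 ≤ r)
    (hrN : 2 ≤ N → r ≤ 2 * (N : ℝ) / ((N : ℝ) - 1)) :
    ∃ C : ℝ≥0, ∀ δ : ℝ, 0 < δ → δ ≤ L → ∀ (f : ℝ → Space N → ℝ) (g : Fin N → ℝ → Space N → ℝ)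
      (X' : ℝ → BallL2 N), IsSobolevCurve δ f g X' →
      eLpNorm (f 0) (ENNReal.ofReal r) (volume.restrict (Metric.closedBall 0 (1 / 4)))
        ≤ C * (ENNReal.ofReal δ⁻¹ * timeNorm δ (fun y => toL2 (f y)) + (timeNorm δ X'
        + ∑ i, timeNorm δ (fun y => toL2 (g i y)))) := by
  -- One bounded set contains the supports for all δ ≤ L, so the trace constant does not depend on
  -- δ.
  set S : Set (ℝ × Space N) := Icc (-|L|) |L| ×ˢ Metric.closedBall (0 : Space N) 1 with hS
  have hSb : Bornology.IsBounded S :=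
    (Metric.isBounded_Icc _ _).prod Metric.isBounded_closedBall
  obtain ⟨C, hC⟩ := exists_trace hN hSb hr hrN
  obtain ⟨W, hW⟩ := exists_bound_fderiv_spaceTimeCutoff N
  obtain ⟨φ, hφ1, hφ2, hφ3⟩ := exists_bumps N
  set D : ℝ≥0 := W * Real.toNNReal (1 + |L|) + 1 with hD
  refine ⟨C * D, fun δ hδ hδL f g X' h => ?_⟩
  have h0 : (0 : ℝ) ∈ Ioo (-δ) δ := ⟨by linarith, hδ⟩
  have hfl := h.locallyIntegrable 0 h0
  have hconv : ∀ᵐ x ∂(volume.restrict (Metric.closedBall (0 : Space N) (1 / 4))),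
      Tendsto (fun n => moll (φ n) (f 0) x) atTop (𝓝 (f 0 x)) :=
    ae_restrict_of_ae (ContDiffBump.ae_convolution_tendsto_right_of_locallyIntegrable hφ3
      (.of_forall hφ1) hfl)
  refine (Lp.eLpNorm_lim_le_liminf_eLpNorm
    (fun n => (contDiff_moll (φ n) hfl).continuous.aestronglyMeasurable) (f 0) hconv).trans ?_
  refine liminf_le_of_le (by isBoundedDefault) fun b hb => ?_
  obtain ⟨n, hn⟩ := hb.exists
  refine hn.trans ?_
  have h1 : eLpNorm (moll (φ n) (f 0)) (ENNReal.ofReal r)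
      (volume.restrict (Metric.closedBall 0 (1 / 4)))
      ≤ eLpNorm (fun x => localized (φ n) δ f (0, x)) (ENNReal.ofReal r) volume := by
    refine le_trans (le_of_eq (eLpNorm_congr_ae ?_)) (eLpNorm_mono_measure _ Measure.restrict_le_self)
    refine (ae_restrict_iff' Metric.isClosed_closedBall.measurableSet).2 (.of_forall fun x hx => ?_)
    have e1 : timeCutoff ((0 : ℝ) / δ) = 1 := by
      rw [zero_div]
      exact timeCutoff.one_of_mem_closedBall
        (Metric.mem_closedBall_self (by norm_num [timeCutoff]))
    simp only [localized, spaceTimeCutoff, smoothed, e1, cutoff_eq_one hx, one_mul]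
    rw [inner_bumpAt (hφ2 n) (h.memLp 0 h0)
      (Metric.closedBall_subset_closedBall (by norm_num) hx)]
  have hsupp : Function.support (localized (φ n) δ f) ⊆ S := by
    intro q hq
    by_contra hc
    refine hq ?_
    rw [localized, spaceTimeCutoff_eq_zero hδ, zero_mul]
    intro hk
    have hL : δ ≤ |L| := hδL.trans (le_abs_self L)
    refine hc ⟨⟨?_, ?_⟩, Metric.closedBall_subset_closedBall (by norm_num) hk.2⟩
    · have := hk.1.1; linarith
    · have := hk.1.2; linarith
  -- As δ ≤ L, the 1 in δ⁻¹ + 1 is absorbed into |L| δ⁻¹.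
  have hB : ∀ q, ‖fderiv ℝ (spaceTimeCutoff N δ) q‖
      ≤ ((W * Real.toNNReal (1 + |L|) * Real.toNNReal δ⁻¹ : ℝ≥0) : ℝ) := fun q => by
    refine (hW δ hδ q).trans ?_
    push_cast
    rw [Real.coe_toNNReal _ (by positivity), Real.coe_toNNReal _ (by positivity), mul_assoc]
    refine mul_le_mul_of_nonneg_left ?_ (NNReal.coe_nonneg W)
    have : 1 ≤ |L| * δ⁻¹ := by
      rw [← div_eq_mul_inv, le_div_iff₀ hδ, one_mul]; exact hδL.trans (le_abs_self L)
    linarith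
  have h2 := hC _ (h.contDiff_localized (hφ2 n) hδ) hsupp
  have h3 := h.eLpNorm_fderiv_localized_le (hφ2 n) hδ hB
  refine h1.trans (h2.trans ?_)
  rw [ENNReal.coe_mul, mul_assoc]
  refine mul_le_mul_right (h3.trans ?_) _
  rw [mul_add (D : ℝ≥0∞)]
  refine add_le_add ?_ ?_
  · rw [ENNReal.coe_mul, mul_assoc, ← ENNReal.ofReal]
    refine mul_le_mul_left ?_ _
    rw [hD]
    push_cast
    exact le_self_add
  · refine le_mul_of_one_le_left zero_le ?_
    rw [hD]
    push_cast
    exact le_add_self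

end TraceCurve

/-! ### Rescaling a window of similarity time. -/

section Window

variable {N : ℕ}

theorem toL2_coeFn (Z : BallL2 N) : toL2 (Z : Space N → ℝ) = Z := by
  rw [toL2, dif_pos (Lp.memLp Z)]
  exact Lp.toLp_coeFn Z _

/-- The substitution τ = s + y/σ maps (-σ, σ) onto the unit window and contributes the factor σ. The
half-ball estimate removes the weight. -/
theorem timeNorm_window_le {α A C₁ σ s : ℝ} (hα : 0 ≤ α) (hσ : 0 < σ) (hA : 0 ≤ A)
    {W : ℝ → BallL2 N} {k : ℝ → ℝ} (hk : ContinuousOn k (Icc (s - 1) (s + 1)))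
    (hW : ∀ τ ∈ Icc (s - 1) (s + 1), wform (rhoPow α) (W τ) (W τ) ≤ A * k τ)
    (hC : ∫ τ in (s - 1)..(s + 1), k τ ≤ C₁) :
    timeNorm σ (fun y => W (s + y / σ)) ≤ ENNReal.ofReal (√((4 / 3 : ℝ) ^ α * (A * (σ * C₁)))) := by
  have nn : ∀ f : BallL2 N, 0 ≤ wform (rhoPow α) f f :=
    wform_self_nonneg (continuous_rhoPow hα) fun z _ => rhoPow_nonneg α z
  have h43 : 0 ≤ (4 / 3 : ℝ) ^ α := by positivity
  have hmaps : MapsTo (fun y => s + y / σ) (Icc (-σ) σ) (Icc (s - 1) (s + 1)) := fun y hy => by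
    have h1 : -1 ≤ y / σ := by rw [le_div_iff₀ hσ]; linarith [hy.1]
    have h2 : y / σ ≤ 1 := by rw [div_le_iff₀ hσ]; linarith [hy.2]
    exact ⟨by linarith, by linarith⟩
  have hcont : ContinuousOn (fun y => (4 / 3 : ℝ) ^ α * (A * k (s + y / σ))) (Icc (-σ) σ) :=
    ((hk.comp (by fun_prop) hmaps).const_mul A).const_mul _
  have hint : IntegrableOn (fun y => (4 / 3 : ℝ) ^ α * (A * k (s + y / σ))) (Ioo (-σ) σ) :=
    (hcont.integrableOn_compact isCompact_Icc).mono_set Ioo_subset_Icc_self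
  have hle : ∀ y ∈ Ioo (-σ) σ, (4 / 3 : ℝ) ^ α * wform (rhoPow α) (W (s + y / σ)) (W (s + y / σ))
      ≤ (4 / 3 : ℝ) ^ α * (A * k (s + y / σ)) := fun y hy =>
    mul_le_mul_of_nonneg_left (hW _ (hmaps (Ioo_subset_Icc_self hy))) h43
  have hnn : 0 ≤ᵐ[volume.restrict (Ioo (-σ) σ)] fun y => (4 / 3 : ℝ) ^ α * (A * k (s + y / σ)) :=
    (ae_restrict_iff' measurableSet_Ioo).2 (.of_forall fun y hy =>
      (mul_nonneg h43 (nn _)).trans (hle y hy))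
  have hval : ∫ y in Ioo (-σ) σ, (4 / 3 : ℝ) ^ α * (A * k (s + y / σ))
      ≤ (4 / 3 : ℝ) ^ α * (A * (σ * C₁)) := by
    rw [← integral_Ioc_eq_integral_Ioo, ← intervalIntegral.integral_of_le (by linarith),
      intervalIntegral.integral_const_mul, intervalIntegral.integral_const_mul,
      intervalIntegral.integral_comp_add_div k hσ.ne', neg_div, div_self hσ.ne', smul_eq_mul,
      ← sub_eq_add_neg]
    gcongr
  have hsq : ∫⁻ y in Ioo (-σ) σ,
      eLpNorm (W (s + y / σ)) 2 (volume.restrict (Metric.closedBall 0 (1 / 2))) ^ (2 : ℝ)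
      ≤ ENNReal.ofReal ((4 / 3 : ℝ) ^ α * (A * (σ * C₁))) := by
    refine le_trans ?_ (ENNReal.ofReal_le_ofReal hval)
    rw [ofReal_integral_eq_lintegral_ofReal hint hnn]
    refine setLIntegral_mono' measurableSet_Ioo fun y hy => ?_
    have h1 := eLpNorm_half_le hα (Lp.memLp (W (s + y / σ)))
    rw [toL2_coeFn] at h1
    refine (ENNReal.rpow_le_rpow h1 zero_le_two).trans ?_
    rw [ENNReal.ofReal_rpow_of_nonneg (Real.sqrt_nonneg _) zero_le_two, Real.rpow_ofNat,
      Real.sq_sqrt (mul_nonneg h43 (nn _))]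
    exact ENNReal.ofReal_le_ofReal (hle y hy)
  have h0 : 0 ≤ (4 / 3 : ℝ) ^ α * (A * (σ * C₁)) := (integral_nonneg_of_ae hnn).trans hval
  rw [timeNorm, Real.sqrt_eq_rpow, ← ENNReal.ofReal_rpow_of_nonneg h0 (by norm_num)]
  exact ENNReal.rpow_le_rpow hsq (by norm_num)

end Window

/-! ### The bound for θ at a fixed time. -/

section VelocityTrace

variable {N : ℕ} {p β α T : ℝ} {M : ℝ≥0} {u₀ u₁ : Space N → ℝ} {u v : ℝ → Space N → ℝ}

theorem timeNorm_congr {δ : ℝ} {Z Z' : ℝ → BallL2 N} (h : ∀ y ∈ Ioo (-δ) δ, Z y = Z' y) :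
    timeNorm δ Z = timeNorm δ Z' := by
  rw [timeNorm, timeNorm, setLIntegral_congr_fun measurableSet_Ioo fun y hy => by rw [h y hy]]

theorem neg_log_lt_window {s σ : ℝ} (hs : -Real.log T + 1 ≤ s) (hσ : 0 < σ) {y : ℝ}
    (hy : y ∈ Ioo (-σ) σ) : -Real.log T < s + y / σ := by
  have h1 : -1 < y / σ := by rw [lt_div_iff₀ hσ]; linarith [hy.1]
  linarith

/-- The rescaled velocity near the similarity time `s`, as a Sobolev curve in physical scale. -/
theorem IsSolution.isSobolevCurve (h : IsSolution p T u₀ u₁ u v) (hN : 1 ≤ N) (hp : 1 < p)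
    (hβ : β = 1 / (p - 1)) (hα : 2 < α) (hadm : Admissible p T M u₀ u₁ v) (hT : 0 < T) {s σ : ℝ}
    (hs : -Real.log T + 1 ≤ s) (hσ : 0 < σ) :
    IsSobolevCurve σ (fun y => theta β T v 0 (s + y / σ))
      (fun i y z => Real.exp (-(β * (s + y / σ))) * weakPartial i (v (physTime T (s + y / σ))) z)
      (fun y => σ⁻¹ • (h.curves hN hp hβ hα hadm hT).θ' (s + y / σ)) := by
  have hmaps : MapsTo (fun y => s + y / σ) (Ioo (-σ) σ) (Ioi (-Real.log T)) := fun y hy =>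
    neg_log_lt_window hs hσ hy
  have ht : ∀ y ∈ Ioo (-σ) σ, physTime T (s + y / σ) ∈ Ico 0 T := fun y hy =>
    physTime_mem_Ico hT (mem_Ioi.1 (hmaps hy)).le
  have hmaps' : MapsTo (fun y => s + y / σ) (Ioo (-σ) σ) (Ici (-Real.log T)) :=
    hmaps.mono_right Ioi_subset_Ici_self
  have hc : ContinuousOn (fun y => s + y / σ) (Ioo (-σ) σ) := by fun_prop
  have eθ : ∀ y ∈ Ioo (-σ) σ, toL2 (theta β T v 0 (s + y / σ))
      = (h.curves hN hp hβ hα hadm hT).θ (s + y / σ) := fun y hy => by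
    rw [theta_zero]; exact toL2_const_mul (h.memLp_v (ht y hy)) _
  have eD : ∀ i, ∀ y ∈ Ioo (-σ) σ, toL2 (fun z => Real.exp (-(β * (s + y / σ)))
      * weakPartial i (v (physTime T (s + y / σ))) z)
      = (h.curves hN hp hβ hα hadm hT).D i (s + y / σ) := fun i y hy =>
    toL2_const_mul (h.memLp_weakPartial_v i (ht y hy)) _
  have wp : ∀ i, ∀ y ∈ Ioo (-σ) σ, HasWeakPartial i (theta β T v 0 (s + y / σ))
      (fun z => Real.exp (-(β * (s + y / σ))) * weakPartial i (v (physTime T (s + y / σ))) z) :=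
    fun i y hy => by
      rw [theta_zero]; exact ((h.mem_v _ (ht y hy)).hasWeakPartial i).const_mul _
  refine ⟨fun y hy => ?_, fun i y hy => (h.memLp_weakPartial_v i (ht y hy)).const_mul _,
    fun y hy => (wp ⟨0, hN⟩ y hy).1, wp, fun y hy => ?_, ?_, fun i => ?_⟩
  · show MemLp (theta β T v 0 (s + y / σ)) 2 (ballMeasure N)
    rw [theta_zero]; exact (h.memLp_v (ht y hy)).const_mul _
  · have h1 := (h.curves hN hp hβ hα hadm hT).derivθ _ (hmaps hy)
    have h2 : HasDerivAt (fun y => s + y / σ) σ⁻¹ y := by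
      simpa using ((hasDerivAt_id y).div_const σ).const_add s
    refine (h1.scomp y h2).congr_of_eventuallyEq ?_
    filter_upwards [isOpen_Ioo.mem_nhds hy] with w hw using eθ w hw
  · exact ((h.curves hN hp hβ hα hadm hT).continuousOn_θ'.comp hc hmaps').const_smul σ⁻¹
  · exact (((h.curves hN hp hβ hα hadm hT).contD i).comp hc hmaps').congr fun y hy => eD i y hy

/-- On the window g and g₂ are comparable to e^{(β+1)s} and e^{(β-1)s}. Scaling θ' by e^s gives it
the same prefactor e^s e^{-βs} as the gradient, up to a constant. -/
theorem IsSolution.wform_window_le (h : IsSolution p T u₀ u₁ u v) (hN : 1 ≤ N) (hp : 1 < p)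
    (hβ : β = 1 / (p - 1)) (hα : 2 < α) (hadm : Admissible p T M u₀ u₁ v) (hT : 0 < T) {s τ : ℝ}
    (hτ : τ ∈ Icc (s - 1) (s + 1)) :
    wform (rhoPow α) ((h.curves hN hp hβ hα hadm hT).θ τ) ((h.curves hN hp hβ hα hadm hT).θ τ)
        ≤ Real.exp (-s) * Real.exp (β + 1 - β * s) * (h.curves hN hp hβ hα hadm hT).coercive τ ∧
      wform (rhoPow α) (Real.exp s • (h.curves hN hp hβ hα hadm hT).θ' τ)
          (Real.exp s • (h.curves hN hp hβ hα hadm hT).θ' τ)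
        ≤ Real.exp s * Real.exp (β + 1 - β * s) * (h.curves hN hp hβ hα hadm hT).coercive τ ∧
      ∀ i, wform (rhoPow α) ((h.curves hN hp hβ hα hadm hT).D i τ)
          ((h.curves hN hp hβ hα hadm hT).D i τ)
        ≤ Real.exp s * Real.exp (β + 1 - β * s) * (h.curves hN hp hβ hα hadm hT).coercive τ := by
  have hβ0 : 0 < β := by rw [hβ]; exact one_div_pos.2 (by linarith)
  set c := h.curves hN hp hβ hα hadm hT
  have nn : ∀ f : BallL2 N, 0 ≤ wform (rhoPow α) f f :=
    wform_self_nonneg (continuous_rhoPow (by linarith)) fun z _ => rhoPow_nonneg α z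
  have g1 : 0 < gOne β τ := Real.exp_pos _
  have g2 : 0 < gTwo β τ := Real.exp_pos _
  have z1 := mul_nonneg g1.le (nn (c.θ τ))
  have z2 := mul_nonneg g1.le (nn (c.θ' τ))
  have z3 := fun i => mul_nonneg g2.le (nn (c.D i τ))
  have z4 : 0 ≤ gTwo β τ * ∑ i, wform (rhoPow α) (c.D i τ) (c.D i τ) :=
    mul_nonneg g2.le (Finset.sum_nonneg fun i _ => nn _)
  have z5 : ∀ i, gTwo β τ * wform (rhoPow α) (c.D i τ) (c.D i τ)
      ≤ gTwo β τ * ∑ i, wform (rhoPow α) (c.D i τ) (c.D i τ) := fun i =>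
    mul_le_mul_of_nonneg_left (Finset.single_le_sum
      (f := fun i => wform (rhoPow α) (c.D i τ) (c.D i τ)) (fun i _ => nn _)
      (Finset.mem_univ i)) g2.le
  have e1 : 1 ≤ Real.exp (-s) * Real.exp (β + 1 - β * s) * gOne β τ := by
    rw [gOne, ← Real.exp_add, ← Real.exp_add]
    exact Real.one_le_exp (by nlinarith [hτ.1])
  -- The sign of β - 1 is unknown, so both ends of the window are needed to control g₂ from below.
  have e2 : 1 ≤ Real.exp s * Real.exp (β + 1 - β * s) * gTwo β τ := by
    rw [gTwo, ← Real.exp_add, ← Real.exp_add]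
    exact Real.one_le_exp (by nlinarith [hτ.1, hτ.2])
  have key : ∀ {x a g X : ℝ}, 0 ≤ x → 0 ≤ a → 1 ≤ a * g → g * x ≤ X → x ≤ a * X :=
    fun {x a g X} hx ha hag hX => calc
      x ≤ a * g * x := le_mul_of_one_le_left hx hag
      _ = a * (g * x) := by ring
      _ ≤ a * X := mul_le_mul_of_nonneg_left hX ha
  have hp1 : 0 ≤ Real.exp (-s) * Real.exp (β + 1 - β * s) := by positivity
  have hp2 : 0 ≤ Real.exp s * Real.exp (β + 1 - β * s) := by positivity
  refine ⟨key (nn _) hp1 e1 (by rw [EnergyCurves.coercive]; linarith), ?_, fun i =>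
    key (nn _) hp2 e2 (by rw [EnergyCurves.coercive]; linarith [z5 i])⟩
  have k2 : wform (rhoPow α) (c.θ' τ) (c.θ' τ)
      ≤ Real.exp (-s) * Real.exp (β + 1 - β * s) * c.coercive τ :=
    key (nn _) hp1 e1 (by rw [EnergyCurves.coercive]; linarith)
  simp only [map_smul, smul_apply, smul_eq_mul]
  calc _ ≤ Real.exp s * (Real.exp s * (Real.exp (-s) * Real.exp (β + 1 - β * s) * c.coercive τ)) := by
        gcongr
    _ = Real.exp s * (Real.exp s * Real.exp (-s)) * Real.exp (β + 1 - β * s) * c.coercive τ := by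
        ring
    _ = _ := by rw [← Real.exp_add, add_neg_cancel, Real.exp_zero, mul_one]

/-- With σ = e^{-s} the quantities θ/σ, ∂_y θ and ∇θ all have space-time L² norm of order e^{-βs/2}.
This stays bounded because e^{-s} ≤ T. -/
theorem exists_eLpNorm_local_theta_le (hN : 1 ≤ N) (hp : 1 < p) (hβ : β = 1 / (p - 1))
    (hα₁ : β * (β + 1) / 2 < α) (hα : 2 < α) {r : ℝ} (hr : 2 ≤ r)
    (hrN : 2 ≤ N → r ≤ 2 * (N : ℝ) / ((N : ℝ) - 1)) {Tmin : ℝ} (Tmax : ℝ)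
    (hTmin : 0 < Tmin) (M : ℝ≥0) (E₀ : ℝ) :
    ∃ C : ℝ≥0, ∀ T, Tmin ≤ T → T ≤ Tmax →
      ∀ (u₀ u₁ : Space N → ℝ) (u v : ℝ → Space N → ℝ),
      IsSolution p T u₀ u₁ u v → Admissible p T M u₀ u₁ v →
      EnergyBoundedBelow p β α T E₀ u₀ v → ∀ s, -Real.log T + 1 ≤ s →
        eLpNorm (theta β T v 0 s) (ENNReal.ofReal r)
          (volume.restrict (Metric.closedBall 0 (1 / 4))) ≤ C := by
  have hβ0 : 0 < β := by rw [hβ]; exact one_div_pos.2 (by linarith)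
  obtain ⟨C₁, hC₁⟩ := exists_integral_coercive_le hN hp hβ hα₁ hα Tmax hTmin M E₀
  obtain ⟨Ct, hCt⟩ := exists_trace_curve hN Tmax hr hrN
  obtain ⟨K, hK⟩ : ∃ K, K = √((4 / 3 : ℝ) ^ α * (Real.exp (β + 1) * Tmax ^ β * |C₁|)) := ⟨_, rfl⟩
  have hK0 : 0 ≤ K := hK ▸ Real.sqrt_nonneg _
  refine ⟨Ct * (Real.toNNReal K + (Real.toNNReal K + N * Real.toNNReal K)), ?_⟩
  intro T h1 h2 u₀ u₁ u v h hadm hE s hs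
  have hT : 0 < T := hTmin.trans_le h1
  have hTs : Real.exp (-s) ≤ Tmax := by
    refine (Real.exp_le_exp.2 (by linarith : -s ≤ Real.log T)).trans ?_
    rw [Real.exp_log hT]; exact h2
  have hσ : 0 < Real.exp (-s) := Real.exp_pos _
  have hwin := fun τ hτ => h.wform_window_le hN hp hβ hα hadm hT (s := s) (τ := τ) hτ
  have hcur := h.isSobolevCurve hN hp hβ hα hadm hT hs hσ
  have hint := hC₁ T h1 h2 u₀ u₁ u v h hadm hE (s + 1) (by linarith)
  set c := h.curves hN hp hβ hα hadm hT
  have nn : ∀ f : BallL2 N, 0 ≤ wform (rhoPow α) f f :=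
    wform_self_nonneg (continuous_rhoPow (by linarith)) fun z _ => rhoPow_nonneg α z
  have hco : ∀ τ, 0 ≤ c.coercive τ := fun τ =>
    add_nonneg (add_nonneg (mul_nonneg (Real.exp_pos _).le (nn _))
      (mul_nonneg (Real.exp_pos _).le (nn _)))
      (mul_nonneg (Real.exp_pos _).le (Finset.sum_nonneg fun i _ => nn _))
  -- The window begins no earlier than -log T because s ≥ -log T + 1, and nonnegativity of the
  -- integrand permits restriction to it.
  have hint' : ∫ τ in (s - 1)..(s + 1), c.coercive τ ≤ |C₁| := by
    refine le_trans ?_ (hint.trans (le_abs_self C₁))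
    exact intervalIntegral.integral_mono_interval (by linarith) (by linarith) le_rfl
      (.of_forall hco)
      (intervalIntegrable_of_continuousOn_Ici c.continuousOn_coercive (by linarith))
  have hcont : ContinuousOn c.coercive (Icc (s - 1) (s + 1)) :=
    c.continuousOn_coercive.mono fun τ hτ => by
      have := hτ.1
      show -Real.log T ≤ τ
      linarith
  have hG : Real.exp (β + 1 - β * s) ≤ Real.exp (β + 1) * Tmax ^ β := by
    rw [sub_eq_add_neg, Real.exp_add]
    refine mul_le_mul_of_nonneg_left ?_ (Real.exp_pos _).le
    rw [show -(β * s) = -s * β by ring, Real.exp_mul]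
    exact Real.rpow_le_rpow hσ.le hTs hβ0.le
  have hee : Real.exp s * Real.exp (-s) = 1 := by rw [← Real.exp_add, add_neg_cancel, Real.exp_zero]
  have hinv : (Real.exp (-s))⁻¹ = Real.exp s := by rw [← Real.exp_neg, neg_neg]
  rw [hinv] at hcur
  have k0 := timeNorm_window_le (W := c.θ) (by linarith : 0 ≤ α) hσ (by positivity) hcont
    (fun τ hτ => (hwin τ hτ).1) hint'
  have k1 := timeNorm_window_le (W := fun τ => Real.exp s • c.θ' τ) (by linarith : 0 ≤ α) hσ
    (by positivity) hcont (fun τ hτ => (hwin τ hτ).2.1) hint'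
  have k2 := fun i => timeNorm_window_le (W := c.D i) (by linarith : 0 ≤ α) hσ (by positivity)
    hcont (fun τ hτ => (hwin τ hτ).2.2 i) hint'
  have b1 : √((4 / 3 : ℝ) ^ α * (Real.exp s * Real.exp (β + 1 - β * s)
      * (Real.exp (-s) * |C₁|))) ≤ K := by
    rw [hK]
    refine Real.sqrt_le_sqrt (mul_le_mul_of_nonneg_left ?_ (by positivity))
    calc _ = (Real.exp s * Real.exp (-s)) * (Real.exp (β + 1 - β * s) * |C₁|) := by ring
      _ ≤ _ := by rw [hee, one_mul]; gcongr
  -- The extra factor e^{-s} is what compensates for the δ⁻¹ in the trace estimate.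
  have b0 : √((4 / 3 : ℝ) ^ α * (Real.exp (-s) * Real.exp (β + 1 - β * s)
      * (Real.exp (-s) * |C₁|))) ≤ Real.exp (-s) * K := by
    refine Real.sqrt_le_iff.2 ⟨by positivity, ?_⟩
    rw [mul_pow, hK, Real.sq_sqrt (by have := hσ.le.trans hTs; positivity)]
    calc _ = Real.exp (-s) ^ 2 * ((4 / 3 : ℝ) ^ α * (Real.exp (β + 1 - β * s) * |C₁|)) := by ring
      _ ≤ _ := by gcongr
  have main := hCt _ hσ hTs _ _ _ hcur
  simp only [zero_div, add_zero] at main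
  have ht : ∀ y ∈ Ioo (-Real.exp (-s)) (Real.exp (-s)),
      physTime T (s + y / Real.exp (-s)) ∈ Ico 0 T := fun y hy =>
    physTime_mem_Ico hT (neg_log_lt_window hs hσ hy).le
  have tθ : timeNorm (Real.exp (-s)) (fun y => toL2 (theta β T v 0 (s + y / Real.exp (-s))))
      ≤ ENNReal.ofReal (Real.exp (-s) * K) := by
    refine le_trans (le_of_eq ?_) (k0.trans (ENNReal.ofReal_le_ofReal b0))
    refine timeNorm_congr fun y hy => ?_
    rw [theta_zero]
    exact toL2_const_mul (h.memLp_v (ht y hy)) _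
  have tD : ∀ i, timeNorm (Real.exp (-s)) (fun y => toL2 (fun z =>
      Real.exp (-(β * (s + y / Real.exp (-s))))
        * weakPartial i (v (physTime T (s + y / Real.exp (-s)))) z)) ≤ ENNReal.ofReal K := fun i => by
    refine le_trans (le_of_eq ?_) ((k2 i).trans (ENNReal.ofReal_le_ofReal b1))
    exact timeNorm_congr fun y hy => toL2_const_mul (h.memLp_weakPartial_v i (ht y hy)) _
  have tX := k1.trans (ENNReal.ofReal_le_ofReal b1)
  have tS := Finset.sum_le_card_nsmul Finset.univ _ _ fun i _ => tD i
  rw [Finset.card_univ, Fintype.card_fin, nsmul_eq_mul] at tS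
  have tθ' : ENNReal.ofReal (Real.exp (-s))⁻¹ * timeNorm (Real.exp (-s))
      (fun y => toL2 (theta β T v 0 (s + y / Real.exp (-s)))) ≤ ENNReal.ofReal K := by
    refine (mul_le_mul_right tθ _).trans (le_of_eq ?_)
    rw [← ENNReal.ofReal_mul (by positivity), inv_mul_cancel_left₀ hσ.ne']
  refine main.trans ?_
  push_cast
  exact mul_le_mul_right (add_le_add tθ' (add_le_add tX tS)) _

theorem exists_eLpNorm_theta_le (hN : 1 ≤ N) (hp : 1 < p) (hβ : β = 1 / (p - 1))
    (hα₁ : β * (β + 1) / 2 < α) (hα : 2 < α) {r : ℝ} (hr : 2 ≤ r)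
    (hrN : 2 ≤ N → r ≤ 2 * (N : ℝ) / ((N : ℝ) - 1)) {Tmin : ℝ} (Tmax : ℝ)
    (hTmin : 0 < Tmin) (M : ℝ≥0) (E₀ : ℝ) :
    ∃ C : ℝ≥0, ∀ T, Tmin ≤ T → T ≤ Tmax →
      ∀ (u₀ u₁ : Space N → ℝ) (u v : ℝ → Space N → ℝ),
      IsSolution p T u₀ u₁ u v → Admissible p T M u₀ u₁ v →
      EnergyBoundedBelowAll p β α T E₀ u₀ v → ∀ s, -Real.log T + 1 ≤ s →
        eLpNorm (theta β T v 0 s) (ENNReal.ofReal r) (ballMeasure N) ≤ C := by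
  obtain ⟨C, hC⟩ := exists_eLpNorm_local_theta_le hN hp hβ hα₁ hα hr hrN Tmax hTmin M E₀
  obtain ⟨F, -, hF⟩ := exists_finset_cover (N := N) 1 (r := 1 / 4) (by norm_num)
  refine ⟨F.card * C, ?_⟩
  intro T h1 h2 u₀ u₁ u v h hadm hE s hs
  have hT : 0 < T := hTmin.trans_le h1
  have ht := physTime_mem_Ico hT (by linarith : -Real.log T ≤ s)
  have hm : AEStronglyMeasurable (theta β T v 0 s) volume := by
    rw [theta_zero]; exact (h.mem_v _ ht).1.aesm.const_mul _
  have := eLpNorm_ball_le_of_local (q := ENNReal.ofReal r)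
    (ENNReal.one_le_ofReal.2 (by linarith)) hF hm (K := C)
    fun y => by
      have e : VelocityWave.shift y (theta β T v 0 s)
          = theta β T (fun t => VelocityWave.shift y (v t)) 0 s := by
        rw [theta_zero, theta_zero]; rfl
      rw [e]
      exact hC T h1 h2 _ _ _ _ (h.shift y) (hadm.shift y) (hE.shift y).zero s hs
  refine this.trans (le_of_eq ?_)
  push_cast
  ring

/-- The trace inequality needs an exponent at least 2. It is used at max(r, 2), still admissible
because 2 ≤ 2N/(N-1), and Hölder on B returns to r. -/
theorem exists_theta_bound (hN : 1 ≤ N) (hp : 1 < p) (hβ : β = 1 / (p - 1))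
    (hα₁ : β * (β + 1) / 2 < α) (hα : 2 < α) {r : ℝ} (hr : 1 ≤ r)
    (hrN : 2 ≤ N → r ≤ 2 * (N : ℝ) / ((N : ℝ) - 1)) {Tmin : ℝ} (Tmax : ℝ)
    (hTmin : 0 < Tmin) (M : ℝ≥0) (E₀ : ℝ) :
    ∃ C : ℝ, ∀ T, Tmin ≤ T → T ≤ Tmax →
      ∀ (u₀ u₁ : Space N → ℝ) (u v : ℝ → Space N → ℝ),
      IsSolution p T u₀ u₁ u v → Admissible p T M u₀ u₁ v →
      EnergyBoundedBelowAll p β α T E₀ u₀ v → ∀ s, -Real.log T + 1 ≤ s →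
        Integrable (fun z => |theta β T v 0 s z| ^ r) (ballMeasure N) ∧
        ∫ z, |theta β T v 0 s z| ^ r ∂(ballMeasure N) ≤ C := by
  have hq : ∀ h2 : 2 ≤ N, max r 2 ≤ 2 * (N : ℝ) / ((N : ℝ) - 1) := fun h2 => by
    refine max_le (hrN h2) ?_
    have : (2 : ℝ) ≤ N := by exact_mod_cast h2
    rw [le_div_iff₀ (by linarith)]
    linarith
  obtain ⟨C, hC⟩ := exists_eLpNorm_theta_le hN hp hβ hα₁ hα (le_max_right r 2) hq Tmax hTmin M E₀
  have hfin : ballMeasure N univ ≠ ⊤ := measure_ne_top _ _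
  have hexp : 0 ≤ 1 / (ENNReal.ofReal r).toReal - 1 / (ENNReal.ofReal (max r 2)).toReal := by
    rw [ENNReal.toReal_ofReal (by linarith), ENNReal.toReal_ofReal (by positivity), sub_nonneg]
    exact one_div_le_one_div_of_le (by linarith) (le_max_left _ _)
  set m := ballMeasure N univ ^
    (1 / (ENNReal.ofReal r).toReal - 1 / (ENNReal.ofReal (max r 2)).toReal) with hm
  have hm' : m ≠ ⊤ := ENNReal.rpow_ne_top_of_nonneg hexp hfin
  refine ⟨((C * m.toReal : ℝ)) ^ r, ?_⟩
  intro T h1 h2 u₀ u₁ u v h hadm hE s hs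
  have hT : 0 < T := hTmin.trans_le h1
  have ht := physTime_mem_Ico hT (by linarith : -Real.log T ≤ s)
  have hmeas : AEStronglyMeasurable (theta β T v 0 s) (ballMeasure N) := by
    rw [theta_zero]; exact (h.memLp_v ht).1.const_mul _
  refine integral_abs_rpow_le_of_eLpNorm_le hmeas hr (by positivity) ?_
  refine (eLpNorm_le_eLpNorm_mul_rpow_measure_univ
    (ENNReal.ofReal_le_ofReal (le_max_left r 2)) hmeas).trans ?_
  rw [ENNReal.ofReal_mul (NNReal.coe_nonneg C), ENNReal.ofReal_toReal hm', ENNReal.ofReal_coe_nnreal]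
  exact mul_le_mul_left (hC T h1 h2 u₀ u₁ u v h hadm hE s hs) _

end VelocityTrace

end VelocityWave

open VelocityWave in
theorem proposition4p1 (N : ℕ) (hN : 1 ≤ N) (p β α : ℝ) (hp : 1 < p) (hβ : β = 1 / (p - 1))
    (hα₁ : β * (β + 1) / 2 < α) (hα₂ : 1 + 2 * β < α) (hα₃ : 2 < α)
    (r : ℝ) (hr₁ : 1 ≤ r) (hr₂ : 3 ≤ N → r ≤ 2 * (N : ℝ) / ((N : ℝ) - 2))
    (Tmin Tmax : ℝ) (hTmin : 0 < Tmin) (M : ℝ≥0) (E₀ : ℝ) :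
    ∃ C : ℝ, ∀ (T : ℝ), Tmin ≤ T → T ≤ Tmax →
      ∀ (u₀ u₁ : Space N → ℝ) (u v : ℝ → Space N → ℝ),
        IsSolution p T u₀ u₁ u v → Admissible p T M u₀ u₁ v →
        (∀ (a : Space N) (s : ℝ), -Real.log T ≤ s →
          E₀ ≤ energy p β α (-Real.log T) (theta β T v a) (theta00 β T u₀ a) s) →
        ∀ (s : ℝ), -Real.log T + 1 ≤ s → ∀ (a : Space N),
          ((∀ᵐ z ∂(volume.restrict (ball1 (0 : Space N))),
              IntervalIntegrable (fun s' => hTwo β (s - s') * theta β T v a s' z) volume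
                (-Real.log T) s) ∧
            IntegrableOn
              (fun z => |hTwoConv β (-Real.log T) (theta β T v a) s z| ^ r)
              (ball1 (0 : Space N)) ∧
            Real.exp (-(r * s)) *
              (∫ z in ball1 (0 : Space N),
                |hTwoConv β (-Real.log T) (theta β T v a) s z| ^ r) ≤ C) ∧
          ((2 ≤ N → r ≤ 2 * (N : ℝ) / ((N : ℝ) - 1)) →
            IntegrableOn (fun z => |theta β T v a s z| ^ r) (ball1 (0 : Space N)) ∧
            (∫ z in ball1 (0 : Space N), |theta β T v a s z| ^ r) ≤ C) := by
  obtain ⟨C₁, hC₁⟩ := exists_hTwoConv_bound hN hp hβ hα₁ hα₃ hr₁ hr₂ Tmax hTmin M E₀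
  -- The constant must be chosen before the stronger condition on r is assumed, so that condition is
  -- decided first.
  by_cases hr : 2 ≤ N → r ≤ 2 * (N : ℝ) / ((N : ℝ) - 1)
  · obtain ⟨C₂, hC₂⟩ := exists_theta_bound hN hp hβ hα₁ hα₃ hr₁ hr Tmax hTmin M E₀
    refine ⟨max C₁ C₂, fun T h1 h2 u₀ u₁ u v h hadm hE s hs a => ?_⟩
    -- Translating the solution by a moves the centre to the origin.
    have b1 := hC₁ T h1 h2 _ _ _ _ (h.shift a) (hadm.shift a) (EnergyBoundedBelowAll.shift hE a) s
      (by linarith)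
    have b2 := hC₂ T h1 h2 _ _ _ _ (h.shift a) (hadm.shift a) (EnergyBoundedBelowAll.shift hE a) s hs
    rw [theta_shift, add_zero] at b1 b2
    exact ⟨⟨b1.1, b1.2.1, b1.2.2.trans (le_max_left _ _)⟩,
      fun _ => ⟨b2.1, b2.2.trans (le_max_right _ _)⟩⟩
  · refine ⟨C₁, fun T h1 h2 u₀ u₁ u v h hadm hE s hs a => ?_⟩
    have b1 := hC₁ T h1 h2 _ _ _ _ (h.shift a) (hadm.shift a) (EnergyBoundedBelowAll.shift hE a) s
      (by linarith)
    rw [theta_shift, add_zero] at b1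
    exact ⟨b1, fun h' => absurd h' hr⟩
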